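/- Let $p$ be a prime number, $q=p^n$ with $n\ge 1$, and let $l\neq p$ be a prime number. Let $\pi=\zeta\sqrt q\in\mathbb C$ with $\zeta$ a root of unity. Put $K=\mathbb Q(\pi^2)$ and let $\mathcal O$ and $\mathcal O_K$ be the rings of integers of $\mathbb Q(\pi)$ and of $K$. Let $\mathcal E$ be the set of complex numbers $\zeta'\sqrt q$, with $\zeta'$ a primitive $m$-th root of unity for some $m\geq 1$, such that $p\ne 2$, $q$ is not a square, $p\nmid m$, and: $4\nmid m$ if $p\equiv 1\bmod 4$; $4\mid m$ and $8\nmid m$ if $p\equiv 3\bmod 4$. Let $R$ be an order in $\mathbb Q(\pi)$ containing $\mathbb Z[\pi]$, and let $R_l$ be its $l$-adic completion. For a prime ideal $\wp$ of $\mathcal O_K$ over $l$ let $R_\wp$ and $\mathcal O_\wp$ be the $\wp$-adic completions of $R$ and $\mathcal O$, that is, the completions at the ideals generated by $\wp\cap R$ and by $\wp$, respectively; they are $R_l$-modules through the canonical ring homomorphisms $R_l\to R_\wp$ and $R_l\to\mathcal O_\wp$. Let $M$ be a finitely generated $R_l$-module that is torsion-free (no non-zero-divisor of $R_l$ kills a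 non-zero element of $M$) and of rank $e$ (that is, $M\otimes_{\mathbb Z_l}\mathbb Q_l$ is free of rank $e$ over $R_l\otimes_{\mathbb Z_l}\mathbb Q_l$). (1) If it is not the case that $l=2$ and $\pi\in\mathcal E$, then $M\cong R_l^{\,e}$ as $R_l$-modules. (2) If $l=2$ and $\pi\in\mathcal E$, then there are non-negative integers $a_\wp,b_\wp$ with $a_\wp+b_\wp=e$, for each prime ideal $\wp$ of $\mathcal O_K$ over $2$, such that $$M\;\cong\;\prod_{\wp\mid 2}\bigl(R_\wp^{\,a_\wp}\times\mathcal O_\wp^{\,b_\wp}\bigr)$$ as $R_l$-modules. -/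

import Mathlib

open scoped NumberField IntermediateField

noncomputable section

namespace Supersingular

/-- A supersingular `q`-number: a complex number `ζ √q` with `ζ` a root of unity. -/
def IsSupersingularNumber (q : ℕ) (x : ℂ) : Prop :=
  ∃ (m : ℕ) (ζ : ℂ), 0 < m ∧ IsPrimitiveRoot ζ m ∧ x = ζ * (Real.sqrt (q : ℝ) : ℂ)

/-- The exceptional set: the `ζ √q`, with `ζ` a primitive `m`-th root of unity, such that
`p ≠ 2`, `q` is not a square, `p ∤ m`, and `4 ∤ m` if `p ≡ 1 mod 4`, while `4` exactly
divides `m` if `p ≡ 3 mod 4`. -/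
def exceptionalSet (p q : ℕ) : Set ℂ :=
  {x | ∃ (m : ℕ) (ζ : ℂ), 0 < m ∧ IsPrimitiveRoot ζ m ∧ x = ζ * (Real.sqrt (q : ℝ) : ℂ) ∧
    p ≠ 2 ∧ ¬ IsSquare q ∧ ¬ p ∣ m ∧
    (p % 4 = 1 → ¬ 4 ∣ m) ∧ (p % 4 = 3 → 4 ∣ m ∧ ¬ 8 ∣ m)}

section Orders

variable {L : Type*} [Field L] [CharZero L]

/-- `R` is an order in `L`: a subring which is finitely generated (hence free) over `ℤ` and
spans `L` over `ℚ`. -/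
class IsOrder (R : Subalgebra ℤ L) : Prop where
  finite : Module.Finite ℤ R
  span_eq_top : Submodule.span ℚ (R : Set L) = ⊤

theorem IsOrder.le_integralClosure (R : Subalgebra ℤ L) [h : IsOrder R] :
    R ≤ integralClosure ℤ L := by
  intro x hx
  have := h.finite
  exact (Algebra.IsIntegral.isIntegral (R := ℤ) (⟨x, hx⟩ : R)).map R.val

/-- The `l`-adic completion `R_l` of `R`. -/
abbrev LAdic (l : ℕ) (R : Subalgebra ℤ L) : Type _ :=
  AdicCompletion (Ideal.span {(l : R)}) R

/-- For a subfield `K` of `L` and an ideal `P` of its ring of integers, the ideal of `R`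
generated by the elements of `P` that lie in `R`. When `R` contains `𝓞 K` this is `P R`. -/
def primeIdeal {K : IntermediateField ℚ L} (P : Ideal (𝓞 K)) (R : Subalgebra ℤ L) : Ideal R :=
  Ideal.span {r : R | ∃ x ∈ P, (((x : 𝓞 K) : K) : L) = (r : L)}

/-- The `P`-adic completion `R_P` of `R`, where `P` is an ideal of `𝓞 K`. -/
def PrimeAdic {K : IntermediateField ℚ L} (P : Ideal (𝓞 K)) (R : Subalgebra ℤ L) : Type _ :=
  AdicCompletion (primeIdeal P R) R

instance {K : IntermediateField ℚ L} (P : Ideal (𝓞 K)) (R : Subalgebra ℤ L) :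
    CommRing (PrimeAdic P R) :=
  inferInstanceAs (CommRing (AdicCompletion (primeIdeal P R) R))

theorem map_pow_le {A B : Type*} [CommRing A] [CommRing B] (f : A →+* B) {I : Ideal A}
    {J : Ideal B} (h : I ≤ J.comap f) (n : ℕ) : I ^ n ≤ (J ^ n).comap f :=
  (Ideal.pow_right_mono h n).trans (Ideal.le_comap_pow f n)

/-- The ring homomorphism `lim A / I ^ n → lim B / J ^ n` induced by a ring homomorphism
`A → B` that maps `I` into `J`. -/
def completionMap {A B : Type*} [CommRing A] [CommRing B] (f : A →+* B) {I : Ideal A}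
    {J : Ideal B} (h : I ≤ J.comap f) : AdicCompletion I A →+* AdicCompletion J B :=
  AdicCompletion.liftRingHom J
    (fun n => (Ideal.quotientMap (J ^ n) f (map_pow_le f h n)).comp
      (AdicCompletion.evalₐ I n : AdicCompletion I A →+* A ⧸ I ^ n))
    (by
      intro m n hmn
      ext x
      obtain ⟨y, rfl⟩ := AdicCompletion.mk_surjective I A x
      simp only [RingHom.comp_apply, RingHom.coe_coe, AdicCompletion.evalₐ_mk]
      have h1 : Ideal.Quotient.mk (I ^ m) (y.1 n) = Ideal.Quotient.mk (I ^ m) (y.1 m) :=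
        AdicCompletion.Ideal.mk_eq_mk I hmn y
      exact congrArg (Ideal.quotientMap (J ^ m) f (map_pow_le f h m)) h1)

theorem span_le_comap_primeIdeal {K : IntermediateField ℚ L} {l : ℕ}
    (P : (Ideal.span {(l : ℤ)}).primesOver (𝓞 K)) {R S : Subalgebra ℤ L} (h : R ≤ S) :
    Ideal.span {(l : R)} ≤ (primeIdeal P.1 S).comap (Subalgebra.inclusion h : R →+* S) := by
  rw [Ideal.span_singleton_le_iff_mem, Ideal.mem_comap]
  refine Ideal.subset_span ⟨(l : 𝓞 K), ?_, by simp⟩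
  have h1 : (l : ℤ) ∈ Ideal.span {(l : ℤ)} := Ideal.mem_span_singleton_self _
  have h2 := (Ideal.mem_of_liesOver P.1 (Ideal.span {(l : ℤ)}) (l : ℤ)).1 h1
  simpa using h2

/-- The canonical homomorphism `R_l → S_P` for `R ⊆ S` and a prime `P` of `𝓞 K` over `l`. -/
def toPrimeAdic {K : IntermediateField ℚ L} {l : ℕ}
    (P : (Ideal.span {(l : ℤ)}).primesOver (𝓞 K)) {R S : Subalgebra ℤ L} (h : R ≤ S) :
    LAdic l R →+* PrimeAdic P.1 S :=
  completionMap (Subalgebra.inclusion h : R →+* S) (span_le_comap_primeIdeal P h)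

instance {K : IntermediateField ℚ L} {l : ℕ}
    (P : (Ideal.span {(l : ℤ)}).primesOver (𝓞 K)) (R : Subalgebra ℤ L) :
    Module (LAdic l R) (PrimeAdic P.1 R) :=
  Module.compHom _ (toPrimeAdic P (le_refl R))

instance {K : IntermediateField ℚ L} {l : ℕ}
    (P : (Ideal.span {(l : ℤ)}).primesOver (𝓞 K)) (R : Subalgebra ℤ L) [IsOrder R] :
    Module (LAdic l R) (PrimeAdic P.1 (integralClosure ℤ L)) :=
  Module.compHom _ (toPrimeAdic P (IsOrder.le_integralClosure R))

/-- An `R_l`-module `M` has rank `e` if `M ⊗ ℚ_l` is free of rank `e` over `R_l ⊗ ℚ_l = L_l`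
(tensor products over `ℤ_l`). As `ℚ_l` is the localization `ℤ_l[1/l]`, these are the
localizations of `M` and of `R_l` at the powers of `l`. -/
def HasRank (l : ℕ) (R : Subalgebra ℤ L) (M : Type*) [AddCommGroup M] [Module (LAdic l R) M]
    (e : ℕ) : Prop :=
  Nonempty (LocalizedModule (Submonoid.powers (l : LAdic l R)) M
    ≃ₗ[Localization (Submonoid.powers (l : LAdic l R))]
      (Fin e → Localization (Submonoid.powers (l : LAdic l R))))

end Orders

/-- The subfield `ℚ(π²)` of `ℚ(π)`. -/
abbrev squareSubfield (π : ℂ) : IntermediateField ℚ ℚ⟮π⟯ :=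
  IntermediateField.adjoin ℚ {(IntermediateField.AdjoinSimple.gen ℚ π) ^ 2}

end Supersingular

end

/-! The module `M` embeds in `R_l ^ e` with image containing `l ^ N R_l ^ e`
(`exists_submodule_equiv_of_hasRank`), so the task is to classify such lattices. The answer depends
on how far `R` is from being integrally closed at `l`.

The test is `FrobeniusCondition`: in `ℤ[π]`, localized at the integers prime to `l`, there is a `t`
with `t ∣ l ∣ t ^ k` such that some map `y ↦ y ^ Q` is the identity modulo `t`. Then the quotient by
`t` is reduced and every localization at a prime containing `t` has maximal ideal `(t)`, so the ring
is integrally closed (`mem_locAt_of_isIntegral`) and `R_l` inherits the property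
(`isRegularAbove_LAdic`). Over such a semilocal ring a lattice is flat of constant rank, hence free
(`IsRegularAbove.nonempty_basis_submodule`).

To find `t`, write `m = l ^ a m'` with `l ∤ m'`. For odd `l`, `π ^ (2 m')` is an integer prime to
`l` times a primitive `l ^ a`-th root of unity `ξ`; take `t = ξ - 1`, or `t = l` if `a = 0`. Square
`q` at `l = 2` is similar. For nonsquare `q` at `2`, `π ^ m'` is an odd integer times `z = ζ ^ m'
√p`. If some `z ^ 2 ^ j - 1` is twice an odd integer, `t = z - 1` works as for an Eisenstein
polynomial. Otherwise `z ^ 2 = ± p ≡ 1 mod 4`, and if `p ∣ m` a Gauss sum shows `z ≡ 1 mod 2`, so `t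
= 2` works. What is left is the exceptional set.

There, `ω = (1 + z) / 2` is integral and, up to odd factors, `𝓞 K` is `ℤ[π ^ 2]` and `𝓞` is `ℤ[π ^
2] + ℤ[π ^ 2] ω`; both satisfy the Frobenius condition with `t = 2`. The completions split over the
primes `P` above `2`, with `2 O_P ⊆ R_P` and `O_P = R_P + R_P ω`. Modulo `2`, `O_P` is spanned by
`1` and `ω` over the residue field of `P`, so `R_P` is either `O_P` or has that residue field as its
image (`surjective_or_forall_isUnit`). In the second case let `U` be the largest `O_P`-submodule of
a lattice whose `O_P`-span is `O_P ^ e`. Lifts of a residue-field basis of the lattice modulo `U`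
also form an `O_P / 2`-basis of `O_P ^ e / U`; they give the factor `R_P ^ a`, and a free complement
inside `U` gives `O_P ^ b` (`exists_equiv_of_span_eq_top`). -/

noncomputable section

namespace Supersingular

/-! ### Free modules over semilocal rings, and finite presentation of lattices. -/

section SemilocalFree

open Module TensorProduct

/-- Over a semilocal ring, a finite flat module whose rank is `n` at every maximal ideal
is free of rank `n`. -/
theorem nonempty_basis_of_rankAtStalk_eq {A M : Type*} [CommRing A] [AddCommGroup M] [Module A M]
    [Finite (MaximalSpectrum A)] [Module.Finite A M] [Flat A M] (n : ℕ)
    (h : ∀ P : MaximalSpectrum A, rankAtStalk M P.toPrimeSpectrum = n) :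
    Nonempty (Basis (Fin n) A M) := by
  refine nonempty_basis_of_flat_of_finrank_eq A M n fun P => ?_
  let := Ideal.Quotient.field P.1
  -- The fibre dimension at `P` is the rank after base change to `A / P`, whose zero ideal lies over
  -- `P`.
  have h1 := rankAtStalk_baseChange (R := A) (M := M) (S := A ⧸ P.1) (⊥ : PrimeSpectrum (A ⧸ P.1))
  rw [rankAtStalk_eq_finrank_of_free] at h1
  have h2 : PrimeSpectrum.comap (algebraMap A (A ⧸ P.1)) ⊥ = P.toPrimeSpectrum := by
    ext x
    simp [Ideal.Quotient.eq_zero_iff_mem, MaximalSpectrum.toPrimeSpectrum]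
  rw [h2, h P] at h1
  simpa using h1

/-- A quotient by a power of an element `l` with finite `A / l` is finite. -/
theorem finite_quotient_span_pow {A : Type*} [CommRing A] (l : A) [Finite (A ⧸ Ideal.span {l})]
    (N : ℕ) : Finite (A ⧸ Ideal.span {l ^ N}) := by
  induction N with
  | zero =>
    rw [pow_zero, Ideal.span_singleton_one]
    infer_instance
  | succ N ih =>
    let f : (A ⧸ Ideal.span {l}) × (A ⧸ Ideal.span {l ^ N}) → A ⧸ Ideal.span {l ^ (N + 1)} :=
      fun x => Ideal.Quotient.mk _ (x.1.out + l * x.2.out)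
    refine Finite.of_surjective f fun y => ?_
    obtain ⟨y, rfl⟩ := Ideal.Quotient.mk_surjective y
    obtain ⟨z, hz⟩ := Ideal.mem_span_singleton.1 (Ideal.Quotient.eq.1
      (Ideal.Quotient.mk_out (Ideal.Quotient.mk (Ideal.span {l}) y)).symm)
    obtain ⟨w, hw⟩ := Ideal.mem_span_singleton.1 (Ideal.Quotient.eq.1
      (Ideal.Quotient.mk_out (Ideal.Quotient.mk (Ideal.span {l ^ N}) z)).symm)
    refine ⟨(Ideal.Quotient.mk _ y, Ideal.Quotient.mk _ z), ?_⟩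
    refine (Ideal.Quotient.eq.2 (Ideal.mem_span_singleton.2 ⟨w, ?_⟩)).symm
    linear_combination hz + l * hw

/-- A finite module killed by an element `c` with finite `A / c` is finitely presented. -/
theorem finitePresentation_of_finite_of_smul_eq_zero {A X : Type*} [CommRing A] [AddCommGroup X]
    [Module A X] [Finite X] (c : A) [Finite (A ⧸ Ideal.span {c})] (h : ∀ x : X, c • x = 0) :
    Module.FinitePresentation A X := by
  let : Module (A ⧸ Ideal.span {c}) X := Module.IsTorsionBySet.module (I := Ideal.span {c})
    ((Module.isTorsionBySet_span_singleton_iff c).2 fun x => h x)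
  have : IsScalarTower A (A ⧸ Ideal.span {c}) X := Module.IsTorsionBySet.isScalarTower _
  have : Module.FinitePresentation A (A ⧸ Ideal.span {c}) :=
    Module.finitePresentation_of_surjective (Ideal.span {c}).mkQ (Submodule.mkQ_surjective _)
      (by rw [Submodule.ker_mkQ]; exact ⟨{c}, by simp [Ideal.submodule_span_eq]⟩)
  have : IsNoetherianRing (A ⧸ Ideal.span {c}) := inferInstance
  have : Module.Finite (A ⧸ Ideal.span {c}) X := Module.Finite.of_finite
  have : Module.FinitePresentation (A ⧸ Ideal.span {c}) X :=
    (Module.finitePresentation_iff_finite _ _).2 inferInstance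
  exact Module.FinitePresentation.trans A X (A ⧸ Ideal.span {c})

/-- A submodule of `A ^ e` containing `c A ^ e`, for a nonzerodivisor `c` with finite `A / c`,
is finitely presented. -/
theorem finitePresentation_of_smul_top_le {A : Type*} [CommRing A] (c : A)
    (hc : c ∈ nonZeroDivisors A) [Finite (A ⧸ Ideal.span {c})] {e : ℕ}
    (M : Submodule A (Fin e → A)) (hM : ∀ x, c • x ∈ M) : Module.FinitePresentation A M := by
  let g : (Fin e → A) →ₗ[A] M := LinearMap.codRestrict M (c • LinearMap.id) fun x => hM x
  have hg : Function.Injective g := by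
    intro x y hxy
    have h1 : c • x = c • y := congrArg Subtype.val hxy
    funext i
    exact (mul_cancel_left_mem_nonZeroDivisors hc).1 (congrFun h1 i)
  let X := M ⧸ LinearMap.range g
  have hX : ∀ x : X, c • x = 0 := by
    intro x
    obtain ⟨x, rfl⟩ := Submodule.mkQ_surjective _ x
    rw [← map_smul, Submodule.mkQ_apply, Submodule.Quotient.mk_eq_zero]
    exact ⟨x.1, rfl⟩
  have : Finite X := by
    let r : X → (Fin e → A ⧸ Ideal.span {c}) := fun x i => Ideal.Quotient.mk _ (x.out.1 i)
    refine Finite.of_injective r fun x y hxy => ?_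
    rw [← Submodule.Quotient.mk_out x, ← Submodule.Quotient.mk_out y, Submodule.Quotient.eq]
    have h1 : ∀ i, ∃ z, x.out.1 i - y.out.1 i = c * z := fun i =>
      Ideal.mem_span_singleton.1 (Ideal.Quotient.eq.1 (congrFun hxy i))
    choose z hz using h1
    exact ⟨z, Subtype.ext (funext fun i => (hz i).symm)⟩
  have : Module.FinitePresentation A X := finitePresentation_of_finite_of_smul_eq_zero c hX
  have : Module.FinitePresentation A (LinearMap.ker (LinearMap.range g).mkQ) := by
    rw [Submodule.ker_mkQ]
    exact Module.FinitePresentation.of_equiv (R := A) (M := Fin e → A)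
      (N := LinearMap.range g) (LinearEquiv.ofInjective g hg)
  exact Module.finitePresentation_of_ker (LinearMap.range g).mkQ (Submodule.mkQ_surjective _)

end SemilocalFree

/-! ### Rings regular above `l`, and freeness of their lattices. -/

/-- A ring `A` that is "regular of dimension one above `l`": the element `l` is a nonzerodivisor
in the Jacobson radical with finite `A / l`, and up to powers `l` agrees with an element `t`
such that some Frobenius power is the identity on `A / t`. -/
structure IsRegularAbove (A : Type*) [CommRing A] (l : A) : Prop where
  mem_nonZeroDivisors : l ∈ nonZeroDivisors A
  mem_jacobson : l ∈ Ideal.jacobson (⊥ : Ideal A)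
  finite_quotient : Finite (A ⧸ Ideal.span {l})
  exists_uniformizer : ∃ (t : A) (k Q : ℕ), t ∣ l ∧ l ∣ t ^ k ∧ 2 ≤ Q ∧ ∀ y, t ∣ y ^ Q - y

theorem mem_of_mem_jacobson_bot {A : Type*} [CommRing A] {l : A}
    (h : l ∈ Ideal.jacobson (⊥ : Ideal A)) (P : Ideal A) [hP : P.IsMaximal] : l ∈ P := by
  rw [Ideal.jacobson, Ideal.mem_sInf] at h
  exact h ⟨bot_le, hP⟩

/-- Every maximal ideal contains `l`, so it is the preimage of its image in the finite ring `A / l`,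
which has finitely many ideals. -/
theorem finite_maximalSpectrum {A : Type*} [CommRing A] {l : A}
    (h : l ∈ Ideal.jacobson (⊥ : Ideal A)) [Finite (A ⧸ Ideal.span {l})] :
    Finite (MaximalSpectrum A) := by
  have : Finite (Ideal (A ⧸ Ideal.span {l})) :=
    Finite.of_injective (fun I : Ideal (A ⧸ Ideal.span {l}) => (I : Set (A ⧸ Ideal.span {l})))
      SetLike.coe_injective
  refine Finite.of_injective
    (fun P : MaximalSpectrum A => P.asIdeal.map (Ideal.Quotient.mk (Ideal.span {l}))) ?_
  intro P P' hPP'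
  have key : ∀ P : MaximalSpectrum A, (P.asIdeal.map (Ideal.Quotient.mk (Ideal.span {l}))).comap
      (Ideal.Quotient.mk (Ideal.span {l})) = P.asIdeal := fun P => by
    have := P.2
    rw [Ideal.comap_map_of_surjective _ Ideal.Quotient.mk_surjective, ← RingHom.ker_eq_comap_bot,
      Ideal.mk_ker, sup_eq_left, Ideal.span_singleton_le_iff_mem]
    exact mem_of_mem_jacobson_bot h _
  ext1
  rw [← key P, ← key P']
  exact congrArg (Ideal.comap _) hPP'

open Module TensorProduct in
/-- A finitely presented module over a local ring with principal maximal ideal `(t)` is free as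
soon as `t` acts injectively. -/
theorem free_of_maximalIdeal_eq_span {A M : Type*} [CommRing A] [IsLocalRing A] [AddCommGroup M]
    [Module A M] [Module.FinitePresentation A M] (t : A)
    (ht : IsLocalRing.maximalIdeal A = Ideal.span {t}) (h : ∀ x : M, t • x = 0 → x = 0) :
    Module.Free A M := by
  apply Module.free_of_maximalIdeal_rTensor_injective
  have htm : t ∈ IsLocalRing.maximalIdeal A := ht ▸ Ideal.mem_span_singleton_self t
  have key : ∀ z : IsLocalRing.maximalIdeal A ⊗[A] M,
      ∃ x : M, z = (⟨t, htm⟩ : IsLocalRing.maximalIdeal A) ⊗ₜ[A] x := by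
    intro z
    induction z with
    | zero => exact ⟨0, by simp⟩
    | tmul a x =>
      obtain ⟨a, ha⟩ := a
      obtain ⟨b, rfl⟩ := Ideal.mem_span_singleton'.1 (ht ▸ ha)
      refine ⟨b • x, ?_⟩
      rw [← TensorProduct.smul_tmul]
      rfl
    | add z w hz hw =>
      obtain ⟨x, rfl⟩ := hz
      obtain ⟨y, rfl⟩ := hw
      exact ⟨x + y, (TensorProduct.tmul_add _ _ _).symm⟩
  rw [injective_iff_map_eq_zero]
  intro z hz
  obtain ⟨x, rfl⟩ := key z
  have h1 : TensorProduct.lid A M (t ⊗ₜ x) = 0 := by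
    have : t ⊗ₜ[A] x = 0 := hz
    rw [this, map_zero]
  rw [TensorProduct.lid_tmul] at h1
  rw [h x h1, TensorProduct.tmul_zero]

namespace IsRegularAbove

open Module

variable {A : Type*} [CommRing A] {l : A}

/-- For `y` in `P` the factor `1 - y ^ (Q - 1)` of `y - y ^ Q` is a unit at `P`, so `t` divides `y`
there. The bound `2 ≤ Q` is what puts `y ^ (Q - 1)` in `P`. -/
theorem maximalIdeal_localization_eq_span {t : A} {Q : ℕ} (hQ : 2 ≤ Q)
    (h : ∀ y, t ∣ y ^ Q - y) (P : Ideal A) [hP : P.IsPrime] (htP : t ∈ P) :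
    IsLocalRing.maximalIdeal (Localization.AtPrime P)
      = Ideal.span {algebraMap A (Localization.AtPrime P) t} := by
  rw [← Localization.AtPrime.map_eq_maximalIdeal]
  apply le_antisymm
  · rw [Ideal.map_le_iff_le_comap]
    intro y hy
    rw [Ideal.mem_comap, Ideal.mem_span_singleton]
    obtain ⟨z, hz⟩ := h y
    have h1 : y ^ (Q - 1) ∈ P := Ideal.pow_mem_of_mem P hy _ (by omega)
    have h2 : 1 - y ^ (Q - 1) ∈ P.primeCompl := fun h3 =>
      hP.ne_top ((Ideal.eq_top_iff_one P).2 (by simpa using P.add_mem h3 h1))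
    have h4 : y * (1 - y ^ (Q - 1)) = t * (-z) := by
      have : y ^ Q = y * y ^ (Q - 1) := by rw [← pow_succ']; congr 1; omega
      linear_combination -hz + this
    have h5 := IsLocalization.map_units (Localization.AtPrime P) (⟨_, h2⟩ : P.primeCompl)
    have h6 : algebraMap A (Localization.AtPrime P) t ∣ algebraMap A (Localization.AtPrime P)
        (y * (1 - y ^ (Q - 1))) := h4 ▸ map_dvd _ (dvd_mul_right t _)
    rw [map_mul] at h6
    exact (h5.dvd_mul_right).1 h6
  · rw [Ideal.span_singleton_le_iff_mem]
    exact Ideal.mem_map_of_mem _ htP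

/-- At each maximal ideal the local ring has maximal ideal `(t)`, and `t` acts injectively because
it divides the nonzerodivisor `l`; so `M` is locally free, hence flat. Its rank is `e` everywhere,
being squeezed between `l ^ N A ^ e` and `A ^ e`. Finiteness of `A / l ^ N` supplies finite
presentation, so no Noetherian hypothesis is needed. -/
theorem nonempty_basis_submodule (h : IsRegularAbove A l) {e : ℕ} (M : Submodule A (Fin e → A))
    (N : ℕ) (hM : ∀ x, l ^ N • x ∈ M) : Nonempty (Basis (Fin e) A M) := by
  have hfin := h.finite_quotient
  have := finite_maximalSpectrum h.mem_jacobson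
  have := finite_quotient_span_pow l N
  have hlN : l ^ N ∈ nonZeroDivisors A := pow_mem h.mem_nonZeroDivisors N
  have : Module.FinitePresentation A M := finitePresentation_of_smul_top_le (l ^ N) hlN M hM
  obtain ⟨t, k, Q, htl, hlt, hQ, hF⟩ := h.exists_uniformizer
  have htM : ∀ x : M, t • x = 0 → x = 0 := by
    intro x hx
    obtain ⟨c, rfl⟩ := htl
    ext i
    have h1 : t * x.1 i = 0 := congrFun (congrArg Subtype.val hx) i
    exact (mem_nonZeroDivisors_iff.1 h.mem_nonZeroDivisors).1 _
      (by linear_combination c * h1)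
  have htP : ∀ P : Ideal A, P.IsMaximal → t ∈ P := fun P hP =>
    hP.isPrime.mem_of_pow_mem k (Ideal.mem_of_dvd _ hlt (mem_of_mem_jacobson_bot h.mem_jacobson P))
  have hfree : ∀ (P : Ideal A) [P.IsMaximal],
      Module.Free (Localization.AtPrime P) (LocalizedModule P.primeCompl M) := by
    intro P hP
    refine free_of_maximalIdeal_eq_span (M := LocalizedModule P.primeCompl M) _
      (maximalIdeal_localization_eq_span hQ hF P (htP P hP)) fun x hx => ?_
    rw [algebraMap_smul] at hx
    have hinj : Function.Injective (t • (LinearMap.id : M →ₗ[A] M)) := by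
      rw [injective_iff_map_eq_zero]
      exact htM
    have h2 := IsLocalizedModule.map_injective P.primeCompl
      (LocalizedModule.mkLinearMap P.primeCompl M) (LocalizedModule.mkLinearMap P.primeCompl M)
      _ hinj
    rw [map_smul, IsLocalizedModule.map_id] at h2
    exact h2 (by simpa using hx)
  have hflat : Module.Flat A M := Module.flat_of_localized_maximal _ fun P _ => by
    have := hfree P
    exact Module.Flat.trans A (Localization.AtPrime P) _
  refine nonempty_basis_of_rankAtStalk_eq e fun P => ?_
  have hPm := P.2
  have hfreeP := hfree P.1
  have e1 : rankAtStalk (Fin e → A) P.toPrimeSpectrum = e := by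
    have : Nontrivial A := ⟨0, 1, fun h01 => P.2.ne_top
      ((Ideal.eq_top_iff_one _).2 (h01 ▸ P.1.zero_mem))⟩
    rw [rankAtStalk_eq_finrank_of_free]; simp
  -- Rank at `P` is monotone under injections. It is used for `M ⊆ A ^ e` and for multiplication by
  -- `l ^ N` from `A ^ e` to `M`.
  have mono : ∀ {X Y : Type _} [AddCommGroup X] [Module A X] [AddCommGroup Y] [Module A Y]
      [Module.Finite A Y] (f : X →ₗ[A] Y), Function.Injective f →
      rankAtStalk X P.toPrimeSpectrum ≤ rankAtStalk Y P.toPrimeSpectrum := by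
    intro X Y _ _ _ _ _ f hf
    have h2 := IsLocalizedModule.map_injective P.1.primeCompl
      (LocalizedModule.mkLinearMap P.1.primeCompl X) (LocalizedModule.mkLinearMap P.1.primeCompl Y)
      _ hf
    exact LinearMap.finrank_le_finrank_of_injective
      (f := (IsLocalizedModule.map P.1.primeCompl
      (LocalizedModule.mkLinearMap P.1.primeCompl X) (LocalizedModule.mkLinearMap P.1.primeCompl Y)
      f).extendScalarsOfIsLocalization P.1.primeCompl (Localization.AtPrime P.1)) h2
  apply le_antisymm
  · exact (mono M.subtype M.injective_subtype).trans e1.le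
  · refine e1.ge.trans (mono (LinearMap.codRestrict M ((l ^ N) • LinearMap.id) fun x => hM x)
      fun x y hxy => ?_)
    have h1 : l ^ N • x = l ^ N • y := congrArg Subtype.val hxy
    funext i
    exact (mul_cancel_left_mem_nonZeroDivisors hlN).1 (congrFun h1 i)

end IsRegularAbove

/-- A finite module `M` without `l`-torsion such that `M[1/l]` is free of rank `e` over `A[1/l]`
embeds into `A ^ e` with image containing `l ^ N A ^ e`. -/
theorem exists_injective_of_localizedModule_equiv {A M : Type*} [CommRing A] [AddCommGroup M]
    [Module A M] [Module.Finite A M] {l : A} (hl : l ∈ nonZeroDivisors A)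
    (hM : ∀ x : M, l • x = 0 → x = 0) {e : ℕ}
    (E : LocalizedModule (Submonoid.powers l) M ≃ₗ[Localization (Submonoid.powers l)]
      (Fin e → Localization (Submonoid.powers l))) :
    ∃ ψ : M →ₗ[A] (Fin e → A), Function.Injective ψ ∧
      ∃ N : ℕ, ∀ x : Fin e → A, ∃ y, ψ y = l ^ N • x := by
  classical
  let B := Localization (Submonoid.powers l)
  let φ : M →ₗ[A] (Fin e → B) :=
    (E.toLinearMap.restrictScalars A) ∘ₗ LocalizedModule.mkLinearMap (Submonoid.powers l) M
  have hpow : ∀ (n : ℕ) (x : M), l ^ n • x = 0 → x = 0 := by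
    intro n
    induction n with
    | zero => intro x hx; simpa using hx
    | succ n ih => intro x hx; exact hM x (ih _ (by rw [← mul_smul, ← pow_succ]; exact hx))
  have hφ : Function.Injective φ := by
    refine E.injective.comp ?_
    rw [injective_iff_map_eq_zero]
    intro x hx
    obtain ⟨⟨_, n, rfl⟩, hn⟩ := (IsLocalizedModule.eq_zero_iff (Submonoid.powers l)
      (LocalizedModule.mkLinearMap (Submonoid.powers l) M)).1 hx
    exact hpow n x hn
  let ι : (Fin e → A) →ₗ[A] (Fin e → B) :=
    LinearMap.pi fun i => (Algebra.linearMap A B) ∘ₗ LinearMap.proj i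
  have hι : Function.Injective ι := by
    intro x y hxy
    funext i
    exact IsLocalization.injective B (Submonoid.powers_le.2 hl) (congrFun hxy i)
  obtain ⟨s, hs⟩ := (Module.Finite.fg_top : (⊤ : Submodule A M).FG)
  -- A common denominator for the coordinates of finitely many generators.
  have h1 : ∃ j : ℕ, ∀ x, l ^ j • φ x ∈ LinearMap.range ι := by
    obtain ⟨⟨_, j, rfl⟩, hj⟩ := IsLocalization.exist_integer_multiples_of_finset
      (Submonoid.powers l) ((s ×ˢ (Finset.univ : Finset (Fin e))).image fun gi => φ gi.1 gi.2)
    refine ⟨j, fun x => ?_⟩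
    have hx : x ∈ Submodule.span A (s : Set M) := hs ▸ Submodule.mem_top
    induction hx using Submodule.span_induction with
    | mem g hg =>
      have h2 : ∀ i, ∃ a, algebraMap A B a = l ^ j • φ g i := fun i =>
        hj _ (Finset.mem_image.2 ⟨(g, i), by simpa using hg, rfl⟩)
      choose a ha using h2
      exact ⟨a, funext ha⟩
    | zero => simp
    | add x y _ _ hx hy => rw [map_add, smul_add]; exact Submodule.add_mem _ hx hy
    | smul c x _ hx => rw [map_smul, smul_comm]; exact Submodule.smul_mem _ _ hx
  obtain ⟨j, hj⟩ := h1
  let ψ : M →ₗ[A] (Fin e → A) := (LinearEquiv.ofInjective ι hι).symm.toLinearMap ∘ₗ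
    LinearMap.codRestrict (LinearMap.range ι) (l ^ j • φ) hj
  have hψ : ∀ x, ι (ψ x) = l ^ j • φ x := fun x =>
    congrArg Subtype.val ((LinearEquiv.ofInjective ι hι).apply_symm_apply ⟨l ^ j • φ x, hj x⟩)
  refine ⟨ψ, ?_, ?_⟩
  · rw [injective_iff_map_eq_zero]
    intro x hx
    have h2 := hψ x
    rw [hx, map_zero, ← map_smul] at h2
    exact hpow j x (hφ (h2.symm.trans (map_zero φ).symm))
  have h3 : ∀ x : Fin e → A, ∃ (n : ℕ) (y : M), φ y = l ^ n • ι x := by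
    intro x
    obtain ⟨⟨y, ⟨_, n, rfl⟩⟩, hn⟩ := IsLocalizedModule.surj (Submonoid.powers l)
      (LocalizedModule.mkLinearMap (Submonoid.powers l) M) (E.symm (ι x))
    refine ⟨n, y, ?_⟩
    have h4 : φ y = E (l ^ n • E.symm (ι x)) := congrArg E hn.symm
    rw [h4]
    exact ((E.restrictScalars A).map_smul (l ^ n) (E.symm (ι x))).trans
      (congrArg (l ^ n • ·) (E.apply_symm_apply (ι x)))
  choose n y hny using fun i : Fin e => h3 (Pi.single i 1)
  -- `y i` maps under `φ` to `l ^ n i` times the `i`-th unit vector; the extra power of `l` raises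
  -- every exponent to the common value `∑ i, n i`. The summand `j` comes from the scaling in `ψ`.
  refine ⟨j + ∑ i, n i, fun x => ⟨∑ i, (x i * l ^ (∑ i', n i' - n i)) • y i, hι ?_⟩⟩
  rw [hψ, map_sum, map_smul ι]
  have h6 : ∀ i, φ ((x i * l ^ (∑ i', n i' - n i)) • y i)
      = l ^ (∑ i', n i') • x i • ι (Pi.single i 1) := by
    intro i
    have h7 : n i ≤ ∑ i', n i' := Finset.single_le_sum (fun _ _ => Nat.zero_le _) (Finset.mem_univ i)
    rw [map_smul, hny, smul_smul, smul_smul, mul_assoc, ← pow_add, Nat.sub_add_cancel h7, mul_comm]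
  simp_rw [h6]
  rw [← Finset.smul_sum, smul_smul, ← pow_add]
  congr 1
  simp_rw [← map_smul, ← map_sum]
  congr 1
  exact (pi_eq_sum_univ' x).symm

open Module

theorem IsRegularAbove.of_ringEquiv {A B : Type*} [CommRing A] [CommRing B] (E : A ≃+* B) {l : A}
    (h : IsRegularAbove B (E l)) : IsRegularAbove A l where
  mem_nonZeroDivisors := by
    refine mem_nonZeroDivisors_of_injective (f := E) E.injective h.mem_nonZeroDivisors
  mem_jacobson := by
    have h1 := h.mem_jacobson
    rw [Ideal.mem_jacobson_bot] at h1 ⊢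
    intro y
    have h2 := h1 (E y)
    rw [← map_mul, ← map_one E, ← map_add] at h2
    exact (MulEquiv.isUnit_map E).1 h2
  finite_quotient := by
    have := h.finite_quotient
    refine Finite.of_equiv _ (Ideal.quotientEquiv (Ideal.span {l}) (Ideal.span {E l}) E ?_).symm.toEquiv
    simp [Ideal.map_span]
  exists_uniformizer := by
    obtain ⟨t, k, Q, h1, h2, h3, h4⟩ := h.exists_uniformizer
    refine ⟨E.symm t, k, Q, ?_, ?_, h3, fun y => ?_⟩
    · simpa using map_dvd E.symm h1
    · simpa using map_dvd E.symm h2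
    · simpa using map_dvd E.symm (h4 (E y))

/-- A finite vector space structure on a finite quotient: lifts of a basis of `X / U` for a module
`X / U` killed by a maximal ideal. -/
theorem exists_lift_basis_quotient {S X : Type*} [CommRing S] [AddCommGroup X] [Module S X]
    (m : Ideal S) [hm : m.IsMaximal] (U : Submodule S X) [Finite (X ⧸ U)]
    (hU : ∀ s ∈ m, ∀ x : X, s • x ∈ U) :
    ∃ (a : ℕ) (v : Fin a → X), (∀ x, ∃ s : Fin a → S, x - ∑ i, s i • v i ∈ U) ∧
      ∀ s : Fin a → S, ∑ i, s i • v i ∈ U → ∀ i, s i ∈ m := by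
  let := Ideal.Quotient.field m
  let : Module (S ⧸ m) (X ⧸ U) := Module.IsTorsionBySet.module (I := m) (by
    rintro x ⟨s, hs⟩
    obtain ⟨x, rfl⟩ := Submodule.mkQ_surjective _ x
    exact (Submodule.Quotient.mk_eq_zero U).2 (hU s hs x))
  have hsmul : ∀ (s : S) (x : X ⧸ U), (Ideal.Quotient.mk m s) • x = s • x := fun s x => rfl
  let b := Module.finBasis (S ⧸ m) (X ⧸ U)
  choose v hv using fun i => Submodule.mkQ_surjective U (b i)
  refine ⟨_, v, fun x => ?_, fun s hs i => ?_⟩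
  · choose s hs using fun i => Ideal.Quotient.mk_surjective (b.repr (U.mkQ x) i)
    refine ⟨s, ?_⟩
    rw [← Submodule.Quotient.mk_eq_zero, ← Submodule.mkQ_apply, map_sub, map_sum, sub_eq_zero]
    conv_lhs => rw [← b.sum_repr (U.mkQ x)]
    refine Finset.sum_congr rfl fun i _ => ?_
    rw [← hs, hsmul, map_smul, hv]
  · rw [← Submodule.Quotient.mk_eq_zero, ← Submodule.mkQ_apply, map_sum] at hs
    simp_rw [map_smul, hv, ← hsmul] at hs
    exact Ideal.Quotient.eq_zero_iff_mem.1 (Fintype.linearIndependent_iff.1 b.linearIndependent _ hs i)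

/-! ### Lattices over a ring `S` with `l O ⊆ S ⊆ O = S + S ω`. -/

section Lattice

variable {S O : Type*} [CommRing S] [CommRing O] [Algebra S O] {l : ℕ}

/-- The largest `O`-submodule `U` of an `S`-lattice `M` generating `O ^ e`, together with lifts of
a basis of `M / U` over the residue field of `S`: they form a basis of `O ^ e / U` over `O / l`. -/
theorem exists_submodule_and_lift_basis [Nontrivial O] (hO : IsRegularAbove O (l : O))
    (hlO : ∀ x : O, ∃ s : S, algebraMap S O s = l * x) (ω : O)
    (hω : ∀ x : O, ∃ a b : S, x = algebraMap S O a + algebraMap S O b * ω)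
    (hS : ∀ x : S, (∃ y : O, algebraMap S O x = l * y) ∨
      ∃ (y : S) (z : O), algebraMap S O (x * y) = 1 + l * z)
    {e : ℕ} (M : Submodule S (Fin e → O)) (hM : Submodule.span O (M : Set (Fin e → O)) = ⊤) :
    ∃ (U : Submodule O (Fin e → O)) (a : ℕ) (v : Fin a → (Fin e → O)), (∀ x ∈ U, x ∈ M) ∧
      (∀ i, v i ∈ M) ∧ (∀ x ∈ M, ∃ s : Fin a → S, x - ∑ i, s i • v i ∈ U) ∧
      (∀ o : Fin a → O, ∑ i, o i • v i ∈ U → ∀ i, ∃ y, o i = l * y) ∧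
      ∀ x : Fin e → O, ∃ o : Fin a → O, x - ∑ i, o i • v i ∈ U := by
  have hfin := hO.finite_quotient
  have hspan : ∀ x : Fin e → O, x ∈ Submodule.span O (M : Set (Fin e → O)) :=
    fun x => hM ▸ Submodule.mem_top
  have hlM : ∀ x : Fin e → O, (l : O) • x ∈ M := by
    intro x
    induction hspan x using Submodule.closure_induction with
    | zero => simp
    | add x y _ _ hx hy => rw [smul_add]; exact M.add_mem hx hy
    | smul_mem r x hx =>
      obtain ⟨s, hs⟩ := hlO r
      rw [smul_smul, ← hs, algebraMap_smul]
      exact M.smul_mem s hx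
  -- The largest `O`-submodule of `M`; it contains `l O ^ e` by `hlM`.
  let U : Submodule O (Fin e → O) :=
    { carrier := {x | ∀ o : O, o • x ∈ M}
      add_mem' := fun hx hy o => by rw [smul_add]; exact M.add_mem (hx o) (hy o)
      zero_mem' := fun o => by rw [smul_zero]; exact M.zero_mem
      smul_mem' := fun c x hx o => by rw [smul_smul]; exact hx _ }
  have hUM : ∀ x ∈ U, x ∈ M := fun x hx => by simpa using hx 1
  have hlU : ∀ (y : O) (x : Fin e → O), ((l : O) * y) • x ∈ U := fun y x o => by
    rw [smul_smul, mul_left_comm, ← smul_smul]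
    exact hlM _
  have hUω : ∀ x ∈ M, ω • x ∈ M → x ∈ U := by
    intro x hx hωx o
    obtain ⟨a, b, rfl⟩ := hω o
    rw [add_smul, mul_smul, algebraMap_smul, algebraMap_smul]
    exact M.add_mem (M.smul_mem _ hx) (M.smul_mem _ hωx)
  let m : Ideal S := (Ideal.span {(l : O)}).comap (algebraMap S O)
  have hmem : ∀ s, s ∈ m ↔ ∃ y, algebraMap S O s = l * y := fun s => Ideal.mem_span_singleton
  have hm : m.IsMaximal := by
    rw [Ideal.isMaximal_iff]
    constructor
    · intro h1
      obtain ⟨y, hy⟩ := (hmem 1).1 h1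
      obtain ⟨P, hP⟩ := Ideal.exists_maximal O
      refine hP.ne_top ((Ideal.eq_top_iff_one P).2 ?_)
      rw [← map_one (algebraMap S O), hy]
      exact P.mul_mem_right _ (mem_of_mem_jacobson_bot hO.mem_jacobson P)
    · intro J x hJ hx hxJ
      rcases hS x with h1 | ⟨y, z, hyz⟩
      · exact absurd ((hmem x).2 h1) hx
      · have h1 : x * y - 1 ∈ m := (hmem _).2 ⟨z, by rw [map_sub, hyz, map_one]; ring⟩
        simpa using J.sub_mem (J.mul_mem_right y hxJ) (hJ h1)
  let U' : Submodule S M := (U.restrictScalars S).comap M.subtype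
  have : Finite (M ⧸ U') := by
    let r : M ⧸ U' → (Fin e → O ⧸ Ideal.span {(l : O)}) :=
      fun x i => Ideal.Quotient.mk _ (x.out.1 i)
    refine Finite.of_injective r fun x y hxy => ?_
    rw [← Submodule.Quotient.mk_out x, ← Submodule.Quotient.mk_out y, Submodule.Quotient.eq]
    have h1 : ∀ i, ∃ z, x.out.1 i - y.out.1 i = l * z := fun i =>
      Ideal.mem_span_singleton.1 (Ideal.Quotient.eq.1 (congrFun hxy i))
    choose z hz using h1
    have h2 : x.out.1 - y.out.1 = ((l : O) * 1) • z := by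
      funext i
      simpa using hz i
    change x.out.1 - y.out.1 ∈ U
    rw [h2]
    exact hlU _ _
  obtain ⟨a, v, hv1, hv2⟩ := exists_lift_basis_quotient m U' (by
    intro s hs x
    obtain ⟨y, hy⟩ := (hmem s).1 hs
    change s • x.1 ∈ U
    rw [← algebraMap_smul O, hy]
    exact hlU _ _)
  have hv1' : ∀ x ∈ M, ∃ s : Fin a → S, x - ∑ i, s i • (v i).1 ∈ U := by
    intro x hx
    obtain ⟨s, hs⟩ := hv1 ⟨x, hx⟩
    refine ⟨s, ?_⟩
    simpa [U'] using hs
  have hv2' : ∀ s : Fin a → S, ∑ i, s i • (v i).1 ∈ U → ∀ i, s i ∈ m := by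
    intro s hs
    refine hv2 s ?_
    simpa [U'] using hs
  -- Independence passes from the residue field of `S` to `O / l`. Write `o i = s i + t i ω`.
  -- Subtracting `∑ s i v i ∈ M` shows that `ω` carries `∑ t i v i` into `M`, so `∑ t i v i ∈ U` by
  -- `hUω`, and then `∑ s i v i ∈ U` too. Independence over `S / m` applies to both families.
  have hv3 : ∀ o : Fin a → O, ∑ i, o i • (v i).1 ∈ U → ∀ i, ∃ y, o i = l * y := by
    intro o ho
    choose s t hst using fun i => hω (o i)
    have h1 : ∑ i, o i • (v i).1 = ∑ i, s i • (v i).1 + ω • ∑ i, t i • (v i).1 := by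
      rw [Finset.smul_sum, ← Finset.sum_add_distrib]
      refine Finset.sum_congr rfl fun i _ => ?_
      rw [hst i, add_smul, mul_comm, mul_smul, algebraMap_smul, algebraMap_smul]
    have hsum : ∀ s : Fin a → S, ∑ i, s i • (v i).1 ∈ M := fun s =>
      M.sum_mem fun i _ => M.smul_mem _ (v i).2
    have h2 : ∑ i, t i • (v i).1 ∈ U := by
      refine hUω _ (hsum t) ?_
      have := M.sub_mem (hUM _ ho) (hsum s)
      rwa [h1, add_sub_cancel_left] at this
    have h3 : ∑ i, s i • (v i).1 ∈ U := by
      have := U.sub_mem ho (U.smul_mem ω h2)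
      rwa [h1, add_sub_cancel_right] at this
    intro i
    obtain ⟨y, hy⟩ := (hmem _).1 (hv2' s h3 i)
    obtain ⟨z, hz⟩ := (hmem _).1 (hv2' t h2 i)
    exact ⟨y + z * ω, by rw [hst, hy, hz]; ring⟩
  have hv4 : ∀ x : Fin e → O, ∃ o : Fin a → O, x - ∑ i, o i • (v i).1 ∈ U := by
    intro x
    induction hspan x using Submodule.span_induction with
    | mem x hx =>
      obtain ⟨s, hs⟩ := hv1' x hx
      exact ⟨fun i => algebraMap S O (s i), by simpa only [algebraMap_smul] using hs⟩
    | zero => exact ⟨0, by simp⟩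
    | add x y _ _ hx hy =>
      obtain ⟨o, ho⟩ := hx
      obtain ⟨o', ho'⟩ := hy
      refine ⟨o + o', ?_⟩
      have := U.add_mem ho ho'
      simp only [Pi.add_apply, add_smul, Finset.sum_add_distrib]
      rwa [add_sub_add_comm]
    | smul c x _ hx =>
      obtain ⟨o, ho⟩ := hx
      refine ⟨c • o, ?_⟩
      have := U.smul_mem c ho
      rw [smul_sub, Finset.smul_sum] at this
      simpa [smul_smul] using this
  exact ⟨U, a, fun i => (v i).1, hUM, fun i => (v i).2, hv1', hv3, hv4⟩

/-- The kernel of a split surjection `O ^ e → O ^ a` over a semilocal ring is free. -/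
theorem nonempty_basis_ker_of_section {O : Type*} [CommRing O] [Nontrivial O]
    [Finite (MaximalSpectrum O)] {e a : ℕ} (θ : (Fin e → O) →ₗ[O] (Fin a → O))
    (V : (Fin a → O) →ₗ[O] (Fin e → O)) (hθV : ∀ c, θ (V c) = c) :
    a ≤ e ∧ Nonempty (Basis (Fin (e - a)) O (LinearMap.ker θ)) := by
  have hGc : ∀ x, x - V (θ x) ∈ LinearMap.ker θ := fun x => by
    change θ _ = 0
    rw [map_sub, hθV, sub_self]
  let pG : (Fin e → O) →ₗ[O] LinearMap.ker θ :=
    LinearMap.codRestrict (LinearMap.ker θ) (LinearMap.id - V ∘ₗ θ) hGc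
  have hpG : pG ∘ₗ (LinearMap.ker θ).subtype = LinearMap.id := by
    ext x : 1
    have h1 : θ x.1 = 0 := x.2
    apply Subtype.ext
    change x.1 - V (θ x.1) = x.1
    rw [h1, map_zero, sub_zero]
  have : Module.Projective O (LinearMap.ker θ) := Module.Projective.of_split (LinearMap.ker θ).subtype pG hpG
  have : Module.Finite O (LinearMap.ker θ) := Module.Finite.of_surjective pG fun x =>
    ⟨x.1, LinearMap.congr_fun hpG x⟩
  let E : ((Fin a → O) × LinearMap.ker θ) ≃ₗ[O] (Fin e → O) :=
    LinearEquiv.ofLinearMap (V.coprod (LinearMap.ker θ).subtype) (θ.prod pG)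
      (LinearMap.ext fun x => by
        change V (θ x) + (x - V (θ x)) = x
        abel)
      (LinearMap.ext fun x => by
        have h1 : θ (V x.1 + x.2.1) = x.1 := by
          have h2 : θ x.2.1 = 0 := x.2.2
          rw [map_add, hθV, h2, add_zero]
        refine Prod.ext h1 (Subtype.ext ?_)
        change V x.1 + x.2.1 - V (θ (V x.1 + x.2.1)) = x.2.1
        rw [h1, add_sub_cancel_left])
  have hrank : ∀ P : PrimeSpectrum O, a + rankAtStalk (LinearMap.ker θ) P = e := by
    intro P
    have h1 := congrFun (rankAtStalk_eq_of_equiv E) P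
    rw [rankAtStalk_prod, Pi.add_apply, rankAtStalk_eq_finrank_of_free (M := Fin a → O),
      rankAtStalk_eq_finrank_of_free (M := Fin e → O)] at h1
    simpa using h1
  obtain ⟨P₀⟩ := (inferInstance : Nonempty (MaximalSpectrum O))
  have hae : a ≤ e := by have := hrank P₀.toPrimeSpectrum; omega
  refine ⟨hae, nonempty_basis_of_rankAtStalk_eq (A := O) (M := LinearMap.ker θ) (e - a)
    fun P => ?_⟩
  have := hrank P.toPrimeSpectrum
  omega

/-- Elements of `O ^ e` that form a basis of `O ^ e / U` over `O / l` span a free direct summand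
with a free complement inside `U`. -/
theorem exists_retraction_ker_le {O : Type*} [CommRing O] [Nontrivial O] {l : O}
    (hO : IsRegularAbove O l) {e : ℕ} (U : Submodule O (Fin e → O)) {a : ℕ}
    (v : Fin a → (Fin e → O)) (hv3 : ∀ o : Fin a → O, ∑ i, o i • v i ∈ U → ∀ i, ∃ y, o i = l * y)
    (hv4 : ∀ x : Fin e → O, ∃ o : Fin a → O, x - ∑ i, o i • v i ∈ U) :
    ∃ θ : (Fin e → O) →ₗ[O] (Fin a → O), (∀ c : Fin a → O, θ (∑ i, c i • v i) = c) ∧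
      LinearMap.ker θ ≤ U ∧ a ≤ e ∧ Nonempty (Basis (Fin (e - a)) O (LinearMap.ker θ)) := by
  classical
  have hfin := hO.finite_quotient
  have := finite_maximalSpectrum hO.mem_jacobson
  choose o ho using fun j : Fin e => hv4 (Pi.single j 1)
  let V : (Fin a → O) →ₗ[O] (Fin e → O) := Fintype.linearCombination O fun i => v i
  have hV : ∀ c, V c = ∑ i, c i • v i := fun c => Fintype.linearCombination_apply _ _ _
  let θ₀ : (Fin e → O) →ₗ[O] (Fin a → O) := Fintype.linearCombination O o
  have hθ₀ : ∀ x, x - V (θ₀ x) ∈ U := by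
    intro x
    have h1 : x - V (θ₀ x) = ∑ j, x j • (Pi.single j 1 - ∑ i, o j i • v i) := by
      have h2 : V (θ₀ x) = ∑ j, x j • V (o j) := by
        rw [show θ₀ x = ∑ j, x j • o j from Fintype.linearCombination_apply _ _ _, map_sum]
        simp_rw [map_smul]
      rw [h2]
      simp_rw [smul_sub, Finset.sum_sub_distrib, hV]
      congr 1
      exact pi_eq_sum_univ' x
    rw [h1]
    exact U.sum_mem fun j _ => U.smul_mem _ (ho j)
  -- `θ₀` inverts `V` only modulo `l`. By Nakayama `θ₀ ∘ V` is surjective, hence bijective, and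
  -- composing `θ₀` with its inverse gives an exact retraction.
  have hτ : ∀ c, ∃ y : Fin a → O, c - θ₀ (V c) = l • y := by
    intro c
    have h1 : V (c - θ₀ (V c)) ∈ U := by
      rw [map_sub]; exact hθ₀ (V c)
    rw [hV] at h1
    choose y hy using hv3 _ h1
    exact ⟨y, funext hy⟩
  have hsurj : Function.Surjective (θ₀ ∘ₗ V) := by
    rw [← LinearMap.range_eq_top, ← top_le_iff]
    refine Submodule.le_of_le_smul_of_le_jacobson_bot (I := Ideal.span {l})
      Module.Finite.fg_top ?_ ?_
    · rw [Ideal.span_singleton_le_iff_mem]; exact hO.mem_jacobson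
    · intro c _
      obtain ⟨y, hy⟩ := hτ c
      rw [← sub_add_cancel c (θ₀ (V c)), add_comm, hy]
      exact Submodule.add_mem_sup ⟨c, rfl⟩ (Submodule.smul_mem_smul
        (Ideal.mem_span_singleton_self _) Submodule.mem_top)
  have hbij : Function.Bijective (θ₀ ∘ₗ V) :=
    ⟨OrzechProperty.injective_of_surjective_endomorphism _ hsurj, hsurj⟩
  let τ : (Fin a → O) ≃ₗ[O] (Fin a → O) := LinearEquiv.ofBijective _ hbij
  let θ : (Fin e → O) →ₗ[O] (Fin a → O) := τ.symm.toLinearMap ∘ₗ θ₀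
  have hθV : ∀ c, θ (V c) = c := fun c => τ.symm_apply_apply c
  let G : Submodule O (Fin e → O) := LinearMap.ker θ
  have hGU : ∀ x ∈ G, x ∈ U := by
    intro x hx
    have h1 : θ₀ x = 0 := τ.symm.map_eq_zero_iff.1 hx
    have h2 := hθ₀ x
    rwa [h1, map_zero, sub_zero] at h2
  obtain ⟨hae, hG⟩ := nonempty_basis_ker_of_section θ V hθV
  exact ⟨θ, fun c => by rw [← hV, hθV], hGU, hae, hG⟩

/-- Let `S ⊆ O` be rings with `l O ⊆ S`, `O = S + S ω`, `S / l O` a field and `O` regular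
above `l`. An `S`-lattice in `O ^ e` that generates `O ^ e` is isomorphic to `S ^ a × O ^ b`. -/
theorem exists_equiv_of_span_eq_top [Nontrivial O] (hinj : Function.Injective (algebraMap S O))
    (hO : IsRegularAbove O (l : O)) (hlO : ∀ x : O, ∃ s : S, algebraMap S O s = l * x) (ω : O)
    (hω : ∀ x : O, ∃ a b : S, x = algebraMap S O a + algebraMap S O b * ω)
    (hS : ∀ x : S, (∃ y : O, algebraMap S O x = l * y) ∨
      ∃ (y : S) (z : O), algebraMap S O (x * y) = 1 + l * z)
    {e : ℕ} (M : Submodule S (Fin e → O)) (hM : Submodule.span O (M : Set (Fin e → O)) = ⊤) :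
    ∃ a b : ℕ, a + b = e ∧ Nonempty (M ≃ₗ[S] (Fin a → S) × (Fin b → O)) := by
  obtain ⟨U, a, v, hUM, hvM, hv1, hv3, hv4⟩ :=
    exists_submodule_and_lift_basis hO hlO ω hω hS M hM
  obtain ⟨θ, hθV, hGU, hae, ⟨g⟩⟩ := exists_retraction_ker_le hO U v hv3 hv4
  let V : (Fin a → O) →ₗ[O] (Fin e → O) := Fintype.linearCombination O v
  have hV : ∀ c, V c = ∑ i, c i • v i := fun c => Fintype.linearCombination_apply _ _ _
  simp_rw [← hV] at hθV
  have hGc : ∀ x, x - V (θ x) ∈ LinearMap.ker θ := fun x => by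
    rw [LinearMap.mem_ker, map_sub, hθV, sub_self]
  refine ⟨a, e - a, by omega, ⟨LinearEquiv.symm (LinearEquiv.ofBijective
    (LinearMap.codRestrict M (LinearMap.coprod
      (Fintype.linearCombination S v)
      (((LinearMap.ker θ).subtype ∘ₗ g.equivFun.symm.toLinearMap).restrictScalars S)) ?_) ⟨?_, ?_⟩)⟩⟩
  · rintro ⟨s, c⟩
    rw [LinearMap.coprod_apply, Fintype.linearCombination_apply]
    exact M.add_mem (M.sum_mem fun i _ => M.smul_mem _ (hvM i)) (hUM _ (hGU (g.equivFun.symm c).2))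
  · rw [injective_iff_map_eq_zero]
    rintro ⟨s, c⟩ hsc
    have h1 : V (fun i => algebraMap S O (s i)) + (g.equivFun.symm c).1 = 0 := by
      have := congrArg Subtype.val hsc
      rw [hV]
      simpa [Fintype.linearCombination_apply] using this
    have h2 : (fun i => algebraMap S O (s i)) = 0 := by
      have h3 := congrArg θ h1
      rw [map_add, hθV, map_zero] at h3
      have h4 : θ (g.equivFun.symm c).1 = 0 := (g.equivFun.symm c).2
      rwa [h4, add_zero] at h3
    have h3 : s = 0 := funext fun i => hinj (by simpa using congrFun h2 i)
    rw [h2, map_zero, zero_add] at h1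
    have h4 : g.equivFun.symm c = 0 := Subtype.ext h1
    rw [LinearEquiv.map_eq_zero_iff] at h4
    rw [h3, h4]; rfl
  · rintro ⟨x, hx⟩
    obtain ⟨s, hs⟩ := hv1 x hx
    set u := x - ∑ i, s i • v i with hu
    -- `u` is `V (θ u)` plus an element of `ker θ ⊆ U`. As `V (θ u)` lies in `U`, its coefficients
    -- lie in `l O ⊆ S`, so this part is absorbed by the `S`-combinations of the `v i`.
    have h1 : V (θ u) ∈ U := by
      have := U.sub_mem hs (hGU (hGc u))
      rwa [sub_sub_cancel] at this
    rw [hV] at h1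
    choose y hy using hv3 _ h1
    choose r hr using fun i => hlO (y i)
    refine ⟨(s + r, g.equivFun ⟨_, hGc u⟩), Subtype.ext ?_⟩
    have h2 : V (θ u) = ∑ i, r i • v i := by
      rw [hV]
      refine Finset.sum_congr rfl fun i _ => ?_
      rw [hy, ← hr, algebraMap_smul]
    change Fintype.linearCombination S v (s + r)
      + (g.equivFun.symm (g.equivFun ⟨_, hGc u⟩)).1 = x
    rw [LinearEquiv.symm_apply_apply, map_add, Fintype.linearCombination_apply,
      Fintype.linearCombination_apply]
    change _ + (u - V (θ u)) = x
    rw [h2, hu]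
    abel

/-- Let `S ⊆ O` be rings with `l O ⊆ S`, `O = S + S ω`, such that `S = O` or `S / l O` is a field,
and `O` is regular above `l`. A submodule of `S ^ e` containing `l ^ N S ^ e` is isomorphic to
`S ^ a × O ^ b` with `a + b = e`. -/
theorem exists_equiv_prod_of_pow_smul_mem (hinj : Function.Injective (algebraMap S O))
    (hO : IsRegularAbove O (l : O)) (hlO : ∀ x : O, ∃ s : S, algebraMap S O s = l * x) (ω : O)
    (hω : ∀ x : O, ∃ a b : S, x = algebraMap S O a + algebraMap S O b * ω)
    (hS : Function.Surjective (algebraMap S O) ∨ ∀ x : S, (∃ y : O, algebraMap S O x = l * y) ∨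
      ∃ (y : S) (z : O), algebraMap S O (x * y) = 1 + l * z)
    {e : ℕ} (M : Submodule S (Fin e → S)) (N : ℕ) (hM : ∀ x, (l : S) ^ N • x ∈ M) :
    ∃ a b : ℕ, a + b = e ∧ Nonempty (M ≃ₗ[S] (Fin a → S) × (Fin b → O)) := by
  by_cases hsurj : Function.Surjective (algebraMap S O)
  · have hSreg : IsRegularAbove S (l : S) :=
      IsRegularAbove.of_ringEquiv (RingEquiv.ofBijective (algebraMap S O) ⟨hinj, hsurj⟩)
        (by rw [map_natCast]; exact hO)
    obtain ⟨g⟩ := hSreg.nonempty_basis_submodule M N hM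
    exact ⟨e, 0, rfl, ⟨g.equivFun.trans (LinearEquiv.prodUnique (R := S)).symm⟩⟩
  have : Nontrivial O := not_subsingleton_iff_nontrivial.1 fun h =>
    hsurj fun x => ⟨0, Subsingleton.elim _ _⟩
  have hS' := hS.resolve_left hsurj
  let κ : (Fin e → S) →ₗ[S] (Fin e → O) :=
    LinearMap.pi fun i => (Algebra.linearMap S O) ∘ₗ LinearMap.proj i
  have hκ : Function.Injective κ := fun x y hxy => funext fun i => hinj (congrFun hxy i)
  -- The `O`-span of the lattice is free because `O` is regular above `l`; in a basis of it, `M`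
  -- becomes an `S`-lattice generating `O ^ e`.
  let M' : Submodule O (Fin e → O) := Submodule.span O (κ '' M)
  -- The additional factor `l` moves the coordinates from `O` into `S`.
  have hM' : ∀ x, (l : O) ^ (N + 1) • x ∈ M' := by
    intro x
    choose s hs using fun i => hlO (x i)
    have h1 : (l : O) ^ (N + 1) • x = κ ((l : S) ^ N • s) := by
      funext i
      change (l : O) ^ (N + 1) * x i = algebraMap S O ((l : S) ^ N * s i)
      rw [map_mul, hs, map_pow, map_natCast]
      ring
    rw [h1]
    exact Submodule.subset_span ⟨_, hM s, rfl⟩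
  obtain ⟨g⟩ := hO.nonempty_basis_submodule M' (N + 1) hM'
  let j : M →ₗ[S] (Fin e → O) := (g.equivFun.toLinearMap.restrictScalars S) ∘ₗ
    LinearMap.codRestrict (M'.restrictScalars S) (κ ∘ₗ M.subtype)
      fun x => Submodule.subset_span ⟨x.1, x.2, rfl⟩
  have hj : Function.Injective j := by
    refine g.equivFun.injective.comp fun x y hxy => ?_
    exact Subtype.ext (hκ (congrArg Subtype.val hxy))
  have hspan : Submodule.span O (LinearMap.range j : Set (Fin e → O)) = ⊤ := by
    rw [← top_le_iff]
    intro x _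
    obtain ⟨⟨y, hy⟩, rfl⟩ := g.equivFun.surjective x
    induction hy using Submodule.span_induction with
    | mem y hy =>
      obtain ⟨z, hz, rfl⟩ := hy
      exact Submodule.subset_span ⟨⟨z, hz⟩, rfl⟩
    | zero =>
      exact (map_zero g.equivFun).symm ▸ Submodule.zero_mem _
    | add y z hy hz h1 h2 =>
      have := Submodule.add_mem _ (h1 trivial) (h2 trivial)
      rw [← map_add] at this
      exact this
    | smul c y hy h1 =>
      have := Submodule.smul_mem _ c (h1 trivial)
      rw [← map_smul] at this
      exact this
  obtain ⟨a, b, hab, ⟨E⟩⟩ := exists_equiv_of_span_eq_top hinj hO hlO ω hω hS' _ hspan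
  exact ⟨a, b, hab, ⟨(LinearEquiv.ofInjective j hj).trans E⟩⟩

end Lattice

/-! ### Reduction of lattices to the factors of a finite product. -/

/-- Lattices over a ring that decomposes as a finite product can be classified factor by factor. -/
theorem exists_equiv_pi_of_bijective {A ι : Type*} [CommRing A] [Finite ι] {S O : ι → Type*}
    [∀ i, CommRing (S i)] [∀ i, CommRing (O i)] [∀ i, Algebra A (S i)] [∀ i, Algebra A (O i)]
    [∀ i, Algebra (S i) (O i)] [∀ i, IsScalarTower A (S i) (O i)]
    (hbij : Function.Bijective fun (x : A) (i : ι) => algebraMap A (S i) x) {l : ℕ} {e : ℕ}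
    (M : Submodule A (Fin e → A)) (N : ℕ) (hM : ∀ x, (l : A) ^ N • x ∈ M)
    (hloc : ∀ (i : ι) (M' : Submodule (S i) (Fin e → S i)),
      (∀ x : Fin e → S i, (l : S i) ^ N • x ∈ M') →
      ∃ a b : ℕ, a + b = e ∧ Nonempty (M' ≃ₗ[S i] (Fin a → S i) × (Fin b → O i))) :
    ∃ a b : ι → ℕ, (∀ i, a i + b i = e) ∧
      Nonempty (M ≃ₗ[A] ((i : ι) → (Fin (a i) → S i) × (Fin (b i) → O i))) := by
  classical
  cases nonempty_fintype ι
  have hsurj : ∀ i, Function.Surjective (algebraMap A (S i)) := by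
    intro i y
    obtain ⟨x, hx⟩ := hbij.2 (Pi.single i y)
    exact ⟨x, by simpa using congrFun hx i⟩
  let κ : ∀ i, (Fin e → A) →ₗ[A] (Fin e → S i) := fun i =>
    LinearMap.pi fun j => (Algebra.linearMap A (S i)) ∘ₗ LinearMap.proj j
  let M' : ∀ i, Submodule (S i) (Fin e → S i) := fun i =>
    { carrier := {y | ∃ x ∈ M, κ i x = y}
      add_mem' := by
        rintro _ _ ⟨x, hx, rfl⟩ ⟨y, hy, rfl⟩
        exact ⟨x + y, M.add_mem hx hy, map_add _ _ _⟩
      zero_mem' := ⟨0, M.zero_mem, map_zero _⟩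
      smul_mem' := by
        rintro c _ ⟨x, hx, rfl⟩
        obtain ⟨r, rfl⟩ := hsurj i c
        exact ⟨r • x, M.smul_mem r hx, by rw [map_smul, algebraMap_smul]⟩ }
  have hM' : ∀ i (x : Fin e → S i), (l : S i) ^ N • x ∈ M' i := by
    intro i x
    choose y hy using fun j => hsurj i (x j)
    refine ⟨_, hM y, ?_⟩
    funext j
    change algebraMap A (S i) ((l : A) ^ N * y j) = (l : S i) ^ N * x j
    rw [map_mul, map_pow, map_natCast, hy]
  choose a b hab E using fun i => hloc i (M' i) (hM' i)
  refine ⟨a, b, hab, ⟨?_⟩⟩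
  let j : M →ₗ[A] ((i : ι) → M' i) := LinearMap.pi fun i =>
    LinearMap.codRestrict ((M' i).restrictScalars A) (κ i ∘ₗ M.subtype) fun x => ⟨x.1, x.2, rfl⟩
  have hj : Function.Bijective j := by
    constructor
    · intro x y hxy
      refine Subtype.ext (funext fun k => hbij.1 (funext fun i => ?_))
      exact congrFun (congrArg Subtype.val (congrFun hxy i)) k
    · intro y
      choose x hx hxy using fun i => (y i).2
      -- The `ε i` are the idempotents of the product decomposition; they glue local elements to an
      -- element of `M`.
      choose ε hε using fun i => hbij.2 (Pi.single i 1)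
      refine ⟨⟨∑ i, ε i • x i, M.sum_mem fun i _ => M.smul_mem _ (hx i)⟩, ?_⟩
      funext i
      apply Subtype.ext
      change κ i (∑ i', ε i' • x i') = (y i).1
      rw [map_sum, Finset.sum_eq_single i]
      · rw [map_smul, hxy, ← algebraMap_smul (S i)]
        have : algebraMap A (S i) (ε i) = 1 := by simpa using congrFun (hε i) i
        rw [this, one_smul]
      · intro i' _ hi'
        have : algebraMap A (S i) (ε i') = 0 := by
          simpa [Pi.single_eq_of_ne hi'.symm] using congrFun (hε i') i
        rw [map_smul, ← algebraMap_smul (S i), this, zero_smul]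
      · simp
  exact (LinearEquiv.ofBijective j hj).trans
    (LinearEquiv.piCongrRight fun i => (E i).some.restrictScalars A)

/-! ### Functoriality of completions, and the Chinese remainder theorem for them. -/

section Completion

variable {A B C : Type*} [CommRing A] [CommRing B] [CommRing C]

theorem evalₐ_completionMap (f : A →+* B) {I : Ideal A} {J : Ideal B} (h : I ≤ J.comap f) (n : ℕ)
    (x : AdicCompletion I A) : AdicCompletion.evalₐ J n (completionMap f h x)
      = Ideal.quotientMap (J ^ n) f (map_pow_le f h n) (AdicCompletion.evalₐ I n x) := by
  refine AdicCompletion.evalₐ_liftRingHom J (fun n => (Ideal.quotientMap (J ^ n) f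
    (map_pow_le f h n)).comp (AdicCompletion.evalₐ I n : AdicCompletion I A →+* A ⧸ I ^ n)) ?_ n x
  intro m n hmn
  ext x
  obtain ⟨y, rfl⟩ := AdicCompletion.mk_surjective I A x
  simp only [RingHom.comp_apply, RingHom.coe_coe, AdicCompletion.evalₐ_mk]
  exact congrArg (Ideal.quotientMap (J ^ m) f (map_pow_le f h m))
    (AdicCompletion.Ideal.mk_eq_mk I hmn y)

theorem exists_evalₐ_eq_mk (I : Ideal A) (x : AdicCompletion I A) (n : ℕ) :
    ∃ a : A, ∀ m ≤ n, AdicCompletion.evalₐ I m x = Ideal.Quotient.mk (I ^ m) a := by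
  obtain ⟨y, rfl⟩ := AdicCompletion.mk_surjective I A x
  refine ⟨y.1 n, fun m hmn => ?_⟩
  rw [AdicCompletion.evalₐ_mk]
  exact (AdicCompletion.Ideal.mk_eq_mk I hmn y).symm

theorem evalₐ_algebraMap (I : Ideal A) (n : ℕ) (a : A) :
    AdicCompletion.evalₐ I n (algebraMap A (AdicCompletion I A) a) = Ideal.Quotient.mk (I ^ n) a :=
  AdicCompletion.evalₐ_of I n a

theorem completionMap_algebraMap (f : A →+* B) {I : Ideal A} {J : Ideal B} (h : I ≤ J.comap f)
    (a : A) : completionMap f h (algebraMap A _ a) = algebraMap B _ (f a) := by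
  refine AdicCompletion.ext_evalₐ fun n => ?_
  rw [evalₐ_completionMap, evalₐ_algebraMap, evalₐ_algebraMap, Ideal.quotientMap_mk]

theorem completionMap_completionMap (f : A →+* B) (g : B →+* C) (k : A →+* C) {I : Ideal A}
    {J : Ideal B} {K : Ideal C} (hf : I ≤ J.comap f) (hg : J ≤ K.comap g) (hk : I ≤ K.comap k)
    (hfg : ∀ a, g (f a) = k a) (x : AdicCompletion I A) :
    completionMap g hg (completionMap f hf x) = completionMap k hk x := by
  refine AdicCompletion.ext_evalₐ fun n => ?_
  obtain ⟨a, ha⟩ := exists_evalₐ_eq_mk I x n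
  rw [evalₐ_completionMap, evalₐ_completionMap, evalₐ_completionMap, ha n le_rfl,
    Ideal.quotientMap_mk, Ideal.quotientMap_mk, Ideal.quotientMap_mk, hfg]

/-- An element of the completion, given by a compatible sequence of elements of the ring. -/
theorem exists_adicCompletion_of_forall (I : Ideal A) (x : ℕ → A)
    (hx : ∀ n, x (n + 1) - x n ∈ I ^ n) :
    ∃ y : AdicCompletion I A, ∀ n, AdicCompletion.evalₐ I n y = Ideal.Quotient.mk (I ^ n) (x n) := by
  refine ⟨AdicCompletion.mk I A (AdicCompletion.AdicCauchySequence.mk I A x fun n => ?_),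
    fun n => AdicCompletion.evalₐ_mk I n _⟩
  rw [SModEq.sub_mem, Ideal.smul_top_eq_map, Algebra.algebraMap_self, Ideal.map_id]
  simpa using (I ^ n).neg_mem (hx n)

/-- If the ideal `c` contains the product of the pairwise coprime ideals `I i ⊇ c`, then the
`c`-adic completion is the product of the `I i`-adic completions. -/
theorem completionMap_pi_bijective {ι : Type*} [Fintype ι] {c : Ideal A} {I : ι → Ideal A}
    {f : A →+* A} (hf : ∀ a, f a = a) (h : ∀ i, c ≤ (I i).comap f)
    (hI : Pairwise (Function.onFun IsCoprime I))
    (hprod : ∏ i, I i ≤ c) :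
    Function.Bijective fun (x : AdicCompletion c A) (i : ι) => completionMap f (h i) x := by
  classical
  have hpow : ∀ n, Pairwise (Function.onFun IsCoprime fun i => I i ^ n) := fun n i j hij =>
    (hI hij).pow
  -- Pairwise coprime ideals intersect in their product, and `∏ I i ^ n = (∏ I i) ^ n ⊆ c ^ n`.
  have hinf : ∀ n a, (∀ i, a ∈ I i ^ n) → a ∈ c ^ n := by
    intro n a ha
    have h1 : a ∈ ⨅ i ∈ Finset.univ, I i ^ n := by simpa [Ideal.mem_iInf] using ha
    rw [← Ideal.prod_eq_iInf_of_pairwise_isCoprime ((hpow n).set_pairwise _), Finset.prod_pow] at h1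
    exact Ideal.pow_right_mono hprod n h1
  have heval : ∀ i n x a, AdicCompletion.evalₐ c n x = Ideal.Quotient.mk (c ^ n) a →
      AdicCompletion.evalₐ (I i) n (completionMap f (h i) x) = Ideal.Quotient.mk (I i ^ n) a := by
    intro i n x a hx
    rw [evalₐ_completionMap, hx, Ideal.quotientMap_mk, hf]
  constructor
  · intro x y hxy
    refine AdicCompletion.ext_evalₐ fun n => ?_
    obtain ⟨a, ha⟩ := exists_evalₐ_eq_mk c x n
    obtain ⟨b, hb⟩ := exists_evalₐ_eq_mk c y n
    rw [ha n le_rfl, hb n le_rfl, Ideal.Quotient.eq]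
    refine hinf n _ fun i => ?_
    rw [← Ideal.Quotient.eq, ← heval i n x a (ha n le_rfl), ← heval i n y b (hb n le_rfl)]
    exact congrArg _ (congrFun hxy i)
  · intro y
    choose x hx using fun n => Ideal.pi_quotient_surjective (hpow n)
      fun i => AdicCompletion.evalₐ (I i) n (y i)
    obtain ⟨z, hz⟩ := exists_adicCompletion_of_forall c x fun n => by
      refine hinf n _ fun i => ?_
      rw [← Ideal.Quotient.eq, hx n i]
      obtain ⟨a, ha⟩ := exists_evalₐ_eq_mk (I i) (y i) (n + 1)
      have h1 := hx (n + 1) i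
      rw [ha _ le_rfl, Ideal.Quotient.eq] at h1
      rw [ha n (Nat.le_succ n), Ideal.Quotient.eq]
      exact Ideal.pow_le_pow_right (Nat.le_succ n) h1
    refine ⟨z, funext fun i => AdicCompletion.ext_evalₐ fun n => ?_⟩
    rw [heval i n z (x n) (hz n), hx n i]

end Completion

/-! ### Completion at the ideal generated by `l`. -/

section PrincipalCompletion

variable {A : Type*} [CommRing A] {l : ℕ}

/-- By Bézout a multiple of `N` has the form `1 - l v`, a unit as `l` lies in the Jacobson radical.
-/
theorem isUnit_natCast_of_coprime {N : ℕ} (hN : N.Coprime l)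
    (hl : (l : A) ∈ Ideal.jacobson (⊥ : Ideal A)) : IsUnit (N : A) := by
  rw [Ideal.mem_jacobson_bot] at hl
  have h1 := Nat.gcd_eq_gcd_ab N l
  rw [hN, Nat.cast_one] at h1
  have h2 : (1 : A) = N * (N.gcdA l : A) + l * (N.gcdB l : A) := by
    exact_mod_cast congrArg (Int.cast : ℤ → A) h1
  have h3 := hl (-(N.gcdB l : A))
  rw [show (l : A) * -(N.gcdB l : A) + 1 = N * (N.gcdA l : A) by linear_combination h2] at h3
  exact isUnit_of_mul_isUnit_left h3

theorem natCast_mem_jacobson_adicCompletion :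
    (l : AdicCompletion (Ideal.span {(l : A)}) A) ∈
      Ideal.jacobson (⊥ : Ideal (AdicCompletion (Ideal.span {(l : A)}) A)) := by
  have := AdicCompletion.isAdicComplete_self (R := A) (I := Ideal.span {(l : A)})
    ⟨{(l : A)}, by simp⟩
  refine IsAdicComplete.le_jacobson_bot
    ((Ideal.span {(l : A)}).map (algebraMap A (AdicCompletion (Ideal.span {(l : A)}) A))) ?_
  rw [← map_natCast (algebraMap A _)]
  exact Ideal.mem_map_of_mem _ (Ideal.mem_span_singleton_self _)

theorem exists_eq_add_natCast_mul (x : AdicCompletion (Ideal.span {(l : A)}) A) :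
    ∃ (a : A) (y : AdicCompletion (Ideal.span {(l : A)}) A), x = algebraMap A _ a + l * y := by
  obtain ⟨a, ha⟩ := Ideal.Quotient.mk_surjective (AdicCompletion.evalOneₐ (Ideal.span {(l : A)}) x)
  have h1 : x - algebraMap A _ a ∈
      RingHom.ker (AdicCompletion.evalOneₐ (Ideal.span {(l : A)})).toRingHom := by
    rw [RingHom.mem_ker, map_sub, sub_eq_zero]
    refine ha.symm.trans ?_
    exact (AdicCompletion.evalOneₐ_of _ a).symm
  rw [AdicCompletion.ker_evalOneₐ_eq_map _ ⟨{(l : A)}, by simp⟩, Ideal.map_span,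
    Set.image_singleton, map_natCast, Ideal.mem_span_singleton] at h1
  obtain ⟨y, hy⟩ := h1
  exact ⟨a, y, by rw [← hy]; ring⟩

/-- Cancelling `l` costs one level: the product vanishes modulo `l ^ (n + 1)`, so the element
vanishes modulo `l ^ n`. -/
theorem natCast_mem_nonZeroDivisors_adicCompletion (hl : (l : A) ∈ nonZeroDivisors A) :
    (l : AdicCompletion (Ideal.span {(l : A)}) A) ∈ nonZeroDivisors _ := by
  rw [mem_nonZeroDivisors_iff_right]
  intro x hx
  refine AdicCompletion.ext_evalₐ fun n => ?_
  obtain ⟨a, ha⟩ := exists_evalₐ_eq_mk _ x (n + 1)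
  have h1 := congrArg (AdicCompletion.evalₐ (Ideal.span {(l : A)}) (n + 1)) hx
  rw [map_mul, ha _ le_rfl, map_natCast, map_zero, ← map_natCast (Ideal.Quotient.mk _), ← map_mul,
    Ideal.Quotient.eq_zero_iff_mem, Ideal.span_singleton_pow, Ideal.mem_span_singleton] at h1
  obtain ⟨b, hb⟩ := h1
  rw [ha n (Nat.le_succ n), map_zero, Ideal.Quotient.eq_zero_iff_mem, Ideal.span_singleton_pow,
    Ideal.mem_span_singleton]
  refine ⟨b, (mul_cancel_left_mem_nonZeroDivisors hl).1 ?_⟩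
  rw [pow_succ] at hb
  linear_combination hb

/-- The integers `N` prime to `l` record that the divisibilities come from a localization; they
become units in the completion. As every element is `a + l z` with `a` from `A`, and `t` divides `l`
there, the Frobenius congruence has to be checked on `A` only. -/
theorem isRegularAbove_adicCompletion (hl : (l : A) ∈ nonZeroDivisors A)
    [Finite (A ⧸ Ideal.span {(l : A)})] {t : A} {k Q : ℕ} (hQ : 2 ≤ Q)
    (h1 : ∃ N : ℕ, N.Coprime l ∧ t ∣ N * l) (h2 : ∃ N : ℕ, N.Coprime l ∧ (l : A) ∣ N * t ^ k)
    (h3 : ∀ r : A, ∃ N : ℕ, N.Coprime l ∧ t ∣ N * (r ^ Q - r)) :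
    IsRegularAbove (AdicCompletion (Ideal.span {(l : A)}) A) (l : AdicCompletion _ A) where
  mem_nonZeroDivisors := natCast_mem_nonZeroDivisors_adicCompletion hl
  mem_jacobson := natCast_mem_jacobson_adicCompletion
  finite_quotient := by
    let c := AdicCompletion (Ideal.span {(l : A)}) A
    have hle : Ideal.span {(l : A)} ≤ (Ideal.span {(l : c)}).comap (algebraMap A c) := by
      rw [Ideal.span_singleton_le_iff_mem, Ideal.mem_comap, map_natCast]
      exact Ideal.mem_span_singleton_self _
    refine Finite.of_surjective (Ideal.quotientMap (Ideal.span {(l : c)}) (algebraMap A c) hle) ?_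
    intro x
    obtain ⟨x, rfl⟩ := Ideal.Quotient.mk_surjective x
    obtain ⟨a, y, rfl⟩ := exists_eq_add_natCast_mul x
    refine ⟨Ideal.Quotient.mk _ a, ?_⟩
    rw [Ideal.quotientMap_mk, Ideal.Quotient.eq, Ideal.mem_span_singleton]
    exact ⟨-y, by ring⟩
  exists_uniformizer := by
    let c := AdicCompletion (Ideal.span {(l : A)}) A
    have key : ∀ x y : A, (∃ N : ℕ, N.Coprime l ∧ x ∣ N * y) →
        algebraMap A c x ∣ algebraMap A c y := by
      rintro x y ⟨N, hN, hxy⟩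
      have h4 := map_dvd (algebraMap A c) hxy
      rw [map_mul, map_natCast] at h4
      exact (isUnit_natCast_of_coprime hN natCast_mem_jacobson_adicCompletion).dvd_mul_left.1 h4
    have htl : algebraMap A c t ∣ (l : c) := by simpa using key t l h1
    refine ⟨algebraMap A c t, k, Q, htl, ?_, hQ, fun y => ?_⟩
    · simpa using key l (t ^ k) h2
    · obtain ⟨a, z, rfl⟩ := exists_eq_add_natCast_mul y
      have h4 := key t (a ^ Q - a) (h3 a)
      rw [map_sub, map_pow] at h4
      have h5 : (l : c) ∣ (algebraMap A c a + l * z) ^ Q - algebraMap A c a ^ Q :=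
        (dvd_mul_right (l : c) z).trans (by
          simpa using sub_dvd_pow_sub_pow (algebraMap A c a + l * z) (algebraMap A c a) Q)
      have h6 := (htl.trans h5).add (h4.sub (htl.trans (dvd_mul_right (l : c) z)))
      convert h6 using 1
      ring

end PrincipalCompletion

/-! ### Frobenius congruences. -/

section Frobenius

variable {A : Type*} [CommRing A] {l : ℕ}

/-- The elements fixed modulo `t` by the `f`-fold `l`-Frobenius, where `t ∣ l`. -/
def frobeniusFixed (hl : l.Prime) (t : A) (ht : t ∣ (l : A)) (f : ℕ) : Subring A where
  carrier := {y | t ∣ y ^ l ^ f - y}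
  mul_mem' {x y} hx hy := by
    have h1 := (dvd_mul_of_dvd_left hx (y ^ l ^ f)).add (dvd_mul_of_dvd_right hy x)
    change t ∣ _
    convert h1 using 1
    ring
  one_mem' := by simp
  add_mem' {x y} hx hy := by
    obtain ⟨r, hr⟩ := exists_add_pow_prime_pow_eq hl x y f
    have h1 := (dvd_add hx hy).add (ht.trans (dvd_mul_right (l : A) (x * y * r)))
    change t ∣ _
    rw [hr]
    convert h1 using 1
    ring
  zero_mem' := by simp [hl.ne_zero]
  neg_mem' {x} hx := by
    obtain ⟨r, hr⟩ := exists_add_pow_prime_pow_eq hl x (-x) f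
    rw [add_neg_cancel, zero_pow (pow_ne_zero f hl.ne_zero)] at hr
    have h1 := (dvd_neg.2 hx).sub (ht.trans (dvd_mul_right (l : A) (x * -x * r)))
    change t ∣ _
    convert h1 using 1
    linear_combination -hr

theorem dvd_pow_sub_one_of_dvd {t x : A} (h : t ∣ x - 1) (n : ℕ) : t ∣ x ^ n - 1 :=
  h.trans (by simpa using sub_dvd_pow_sub_pow x 1 n)

/-- By Euler's theorem `l ^ (φ(h) g)` is `1` modulo `h`. The free factor `g` lets several generators
share one exponent. -/
theorem dvd_pow_totient_sub_self {t x : A} {h : ℕ} (hh : h.Coprime l)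
    (hx : t ∣ x ^ h - 1) (g : ℕ) : t ∣ x ^ l ^ (h.totient * g) - x := by
  rcases Nat.eq_zero_or_pos l with rfl | hl
  · have : h = 1 := by simpa using hh
    subst this
    rw [pow_one] at hx
    have := (dvd_pow_sub_one_of_dvd hx (0 ^ (Nat.totient 1 * g))).sub hx
    simpa using this
  have h1 : l ^ (h.totient * g) ≡ 1 [MOD h] := by
    rw [pow_mul]
    simpa using (Nat.ModEq.pow_totient hh.symm).pow g
  obtain ⟨j, hj⟩ := (Nat.modEq_iff_dvd' (Nat.one_le_pow _ _ hl)).1 h1.symm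
  have h2 : l ^ (h.totient * g) = h * j + 1 := by
    have := Nat.one_le_pow (h.totient * g) l hl
    omega
  rw [h2, pow_succ, pow_mul]
  have := dvd_mul_of_dvd_left (dvd_pow_sub_one_of_dvd hx j) x
  rwa [sub_mul, one_mul] at this

/-- For a primitive `l ^ s`-th root of unity `ξ` there is an element `t` that agrees with `l` up to
powers and satisfies `ξ ≡ 1` modulo `t`. -/
theorem exists_dvd_sub_one_of_isPrimitiveRoot [IsDomain A] (hl : l.Prime) {s : ℕ} {ξ : A}
    (hξ : IsPrimitiveRoot ξ (l ^ s)) :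
    ∃ (t : A) (k : ℕ), t ∣ (l : A) ∧ (l : A) ∣ t ^ k ∧ t ∣ ξ - 1 := by
  rcases Nat.eq_zero_or_pos s with rfl | hs
  · refine ⟨l, 1, dvd_rfl, by simp, ?_⟩
    have : ξ = 1 := by simpa using hξ
    simp [this]
  -- A power of `ξ` is a primitive `l`-th root of unity, whose powers sum to zero; since each of
  -- them is `1` modulo `ξ - 1`, this gives `ξ - 1 ∣ l`. Conversely `(ξ - 1) ^ l ^ s ≡ ξ ^ l ^ s - 1
  -- = 0` modulo `l`.
  refine ⟨ξ - 1, l ^ s, ?_, ?_, dvd_rfl⟩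
  · have hw : IsPrimitiveRoot (ξ ^ l ^ (s - 1)) l := by
      refine hξ.pow (pow_pos hl.pos s) ?_
      rw [← pow_succ, Nat.sub_add_cancel hs]
    have h1 := hw.geom_sum_eq_zero hl.one_lt
    have h2 : (l : A) = -∑ i ∈ Finset.range l, ((ξ ^ l ^ (s - 1)) ^ i - 1) := by
      rw [Finset.sum_sub_distrib, h1]
      simp
    rw [h2, dvd_neg]
    refine Finset.dvd_sum fun i _ => ?_
    rw [← pow_mul]
    exact dvd_pow_sub_one_of_dvd dvd_rfl _
  · obtain ⟨r, hr⟩ := exists_add_pow_prime_pow_eq hl (ξ - 1) 1 s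
    rw [sub_add_cancel, hξ.pow_eq_one, one_pow] at hr
    exact ⟨-((ξ - 1) * 1 * r), by linear_combination -hr⟩

end Frobenius

/-! ### Localization at the integers prime to `l`, and integral closedness there. -/

section Localization

variable {F : Type*} [Field F] {l : ℕ}

/-- The localization of a subring of a field at the integers coprime to `l`. -/
def locAt (l : ℕ) (C : Subalgebra ℤ F) : Subring F where
  carrier := {x | ∃ N : ℕ, N.Coprime l ∧ (N : F) * x ∈ C}
  mul_mem' := by
    rintro x y ⟨N, hN, hx⟩ ⟨N', hN', hy⟩
    refine ⟨N * N', Nat.Coprime.mul_left hN hN', ?_⟩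
    have := C.mul_mem hx hy
    push_cast
    convert this using 1
    ring
  one_mem' := ⟨1, by simp, by simp⟩
  add_mem' := by
    rintro x y ⟨N, hN, hx⟩ ⟨N', hN', hy⟩
    refine ⟨N * N', Nat.Coprime.mul_left hN hN', ?_⟩
    have := C.add_mem (C.mul_mem (natCast_mem C N') hx) (C.mul_mem (natCast_mem C N) hy)
    push_cast
    convert this using 1
    ring
  zero_mem' := ⟨1, by simp, by simp⟩
  neg_mem' := by
    rintro x ⟨N, hN, hx⟩
    exact ⟨N, hN, by rw [mul_neg]; exact C.neg_mem hx⟩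

theorem le_locAt {C : Subalgebra ℤ F} {x : F} (hx : x ∈ C) : x ∈ locAt l C :=
  ⟨1, by simp, by simpa using hx⟩

theorem isIntegral_natCast (n : ℕ) : IsIntegral ℤ (n : F) := by
  have := isIntegral_algebraMap (R := ℤ) (A := F) (x := (n : ℤ))
  rwa [algebraMap_int_eq, eq_intCast, Int.cast_natCast] at this

variable [CharZero F]

theorem ne_zero_of_coprime (hl : l.Prime) {N : ℕ} (hN : N.Coprime l) : (N : F) ≠ 0 := by
  rintro h
  rw [Nat.cast_eq_zero] at h
  subst h
  exact hl.one_lt.ne' (by simpa using hN)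

theorem inv_natCast_mem_locAt (hl : l.Prime) (C : Subalgebra ℤ F) {N : ℕ} (hN : N.Coprime l) :
    (N : F)⁻¹ ∈ locAt l C :=
  ⟨N, hN, by rw [mul_inv_cancel₀ (ne_zero_of_coprime hl hN)]; exact C.one_mem⟩

theorem isUnit_natCast_locAt (hl : l.Prime) (C : Subalgebra ℤ F) {N : ℕ} (hN : N.Coprime l) :
    IsUnit (N : locAt l C) :=
  IsUnit.of_mul_eq_one ⟨_, inv_natCast_mem_locAt hl C hN⟩
    (Subtype.ext (mul_inv_cancel₀ (ne_zero_of_coprime hl hN)))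

/-- If `C` is generated by elements fixed by Frobenius modulo `t`, then so is `locAt l C`. -/
theorem dvd_pow_sub_self_of_adjoin (hl : l.Prime) {s : Set F}
    {t : locAt l (Algebra.adjoin ℤ s)} (ht : t ∣ (l : locAt l (Algebra.adjoin ℤ s))) {f : ℕ}
    (hs : ∀ x : locAt l (Algebra.adjoin ℤ s), x.1 ∈ s → t ∣ x ^ l ^ f - x)
    (y : locAt l (Algebra.adjoin ℤ s)) : t ∣ y ^ l ^ f - y := by
  have key : ∀ (x : F) (hx : x ∈ Algebra.adjoin ℤ s),
      (⟨x, le_locAt hx⟩ : locAt l (Algebra.adjoin ℤ s)) ∈ frobeniusFixed hl t ht f := by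
    intro x hx
    induction hx using Algebra.adjoin_induction with
    | mem x hx => exact hs _ hx
    | algebraMap r =>
      have : (⟨algebraMap ℤ F r, le_locAt (Subalgebra.algebraMap_mem _ r)⟩ :
          locAt l (Algebra.adjoin ℤ s)) = (r : locAt l (Algebra.adjoin ℤ s)) :=
        Subtype.ext (by simp)
      rw [this]
      exact intCast_mem _ r
    | add x y hx hy h1 h2 => exact add_mem h1 h2
    | mul x y hx hy h1 h2 => exact mul_mem h1 h2
  obtain ⟨N, hN, hy⟩ := y.2
  have h1 : t ∣ ((N : locAt l (Algebra.adjoin ℤ s)) * y) ^ l ^ f - N * y := key _ hy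
  have h2 : t ∣ (N : locAt l (Algebra.adjoin ℤ s)) ^ l ^ f - N :=
    natCast_mem (frobeniusFixed hl t ht f) N
  have h3 := h1.sub (dvd_mul_of_dvd_left h2 (y ^ l ^ f))
  rw [mul_pow, show (N : locAt l (Algebra.adjoin ℤ s)) ^ l ^ f * y ^ l ^ f - N * y
    - (N ^ l ^ f - N) * y ^ l ^ f = N * (y ^ l ^ f - y) by ring] at h3
  exact (isUnit_natCast_locAt hl _ hN).dvd_mul_left.1 h3

/-- A subring `B` such that Frobenius is bijective modulo `t`, with `t` equal to `l` up to powers,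
is `l`-saturated in its integral closure. -/
theorem mem_of_isIntegral_of_natCast_mul_mem {B : Subring F} {t : B} {k Q : ℕ}
    (hlt : (l : B) ∣ t ^ k) (hQ : 2 ≤ Q) (hF : ∀ y : B, t ∣ y ^ Q - y) {x : F}
    (hx : IsIntegral ℤ x) (hlx : (l : F) * x ∈ B) : x ∈ B := by
  have ht0 : (t : F) ≠ 0 := by
    intro h0
    obtain ⟨c, hc⟩ := hF 2
    have h1 : (2 : F) ^ Q - 2 = t * c := congrArg Subtype.val hc
    rw [h0, zero_mul, sub_eq_zero] at h1
    have h2 : 2 ^ Q = 2 := by exact_mod_cast h1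
    have h3 : 2 ^ 2 ≤ 2 ^ Q := Nat.pow_le_pow_right (by norm_num) hQ
    omega
  -- `B / t` is reduced, because `y ^ Q ^ n ≡ y` and `n ≤ Q ^ n`.
  have hred : ∀ (n : ℕ) (y : B), t ∣ y ^ n → t ∣ y := by
    intro n y hy
    have h1 : ∀ j, t ∣ y ^ Q ^ j - y := by
      intro j
      induction j with
      | zero => simp
      | succ j ih =>
        have := (hF (y ^ Q ^ j)).add ih
        rwa [← pow_mul, ← pow_succ, sub_add_sub_cancel] at this
    have h2 : t ∣ y ^ Q ^ n := hy.trans (pow_dvd_pow y (Nat.lt_pow_self hQ).le)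
    have := h2.sub (h1 n)
    rwa [sub_sub_cancel] at this
  -- Multiplying the integral equation of `z` by `t ^ d`, with `d` its degree, shows that `t`
  -- divides `(t z) ^ d` in `B`. Reducedness gives `t z ∈ t B`, and `t` cancels.
  have hstep : ∀ z : F, IsIntegral B z → (t : F) * z ∈ B → z ∈ B := by
    rintro z ⟨p, hp, hpz⟩ htz
    let y : B := ⟨t * z, htz⟩
    have h1 : t ∣ y ^ p.natDegree := by
      have h2 : z ^ p.natDegree = -∑ i ∈ Finset.range p.natDegree, ((p.coeff i : B) : F) * z ^ i := by
        rw [Polynomial.eval₂_eq_sum_range, Finset.sum_range_succ, hp.coeff_natDegree] at hpz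
        simp only [map_one, one_mul] at hpz
        exact eq_neg_of_add_eq_zero_right hpz
      have h3 : y ^ p.natDegree = -∑ i ∈ Finset.range p.natDegree,
          p.coeff i * t ^ (p.natDegree - i) * y ^ i := by
        apply Subtype.ext
        push_cast
        change ((t : F) * z) ^ p.natDegree = -∑ i ∈ Finset.range p.natDegree,
          ((p.coeff i : B) : F) * (t : F) ^ (p.natDegree - i) * (t * z) ^ i
        rw [mul_pow, h2, mul_neg, Finset.mul_sum]
        congr 1
        refine Finset.sum_congr rfl fun i hi => ?_
        have h4 : (t : F) ^ p.natDegree = t ^ (p.natDegree - i) * t ^ i := by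
          rw [← pow_add, Nat.sub_add_cancel (Finset.mem_range.1 hi).le]
        rw [h4]
        ring
      rw [h3, dvd_neg]
      refine Finset.dvd_sum fun i hi => dvd_mul_of_dvd_left (dvd_mul_of_dvd_right ?_ _) _
      exact dvd_pow_self t (Nat.sub_ne_zero_of_lt (Finset.mem_range.1 hi))
    obtain ⟨b, hb⟩ := hred _ y h1
    have h5 : (t : F) * z = t * b := congrArg Subtype.val hb
    rw [mul_left_cancel₀ ht0 h5]
    exact b.2
  have hpow : ∀ n : ℕ, (t : F) ^ n * x ∈ B → x ∈ B := by
    intro n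
    induction n with
    | zero => intro h; simpa using h
    | succ n ih =>
      intro h
      refine ih (hstep _ ?_ ?_)
      · exact (((isIntegral_algebraMap (R := B) (A := F) (x := t)).pow n)).mul hx.tower_top
      · rwa [← mul_assoc, ← pow_succ']
  obtain ⟨c, hc⟩ := hlt
  refine hpow k ?_
  have h1 : (t : F) ^ k = l * c := by exact_mod_cast congrArg Subtype.val hc
  rw [h1, mul_right_comm]
  exact B.mul_mem hlx c.2

/-- The integral elements of the fraction field of `C` lie in `locAt l C`, provided that `locAt l C`
satisfies the Frobenius condition modulo an element equal to `l` up to powers. -/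
theorem mem_locAt_of_isIntegral (hl : l.Prime) {C : Subalgebra ℤ F} {t : locAt l C} {k Q : ℕ}
    (hlt : (l : locAt l C) ∣ t ^ k) (hQ : 2 ≤ Q) (hF : ∀ y : locAt l C, t ∣ y ^ Q - y) {x : F}
    (hx : IsIntegral ℤ x) (hD : ∃ D : ℕ, D ≠ 0 ∧ (D : F) * x ∈ C) : x ∈ locAt l C := by
  obtain ⟨D, hD0, hD⟩ := hD
  obtain ⟨j, N, hN, rfl⟩ := Nat.exists_eq_pow_mul_and_not_dvd hD0 l hl.ne_one
  have hcop : N.Coprime l := ((Nat.Prime.coprime_iff_not_dvd hl).2 hN).symm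
  have key : ∀ i : ℕ, (l : F) ^ i * (N * x) ∈ locAt l C → (N : F) * x ∈ locAt l C := by
    intro i
    induction i with
    | zero => intro h; simpa using h
    | succ i ih =>
      intro h
      refine ih (mem_of_isIntegral_of_natCast_mul_mem hlt hQ hF ?_ ?_)
      · exact ((isIntegral_natCast l).pow i).mul ((isIntegral_natCast N).mul hx)
      · rwa [← mul_assoc, ← pow_succ']
  have h1 : (N : F) * x ∈ locAt l C := key j (le_locAt (by
    push_cast at hD; rwa [mul_assoc] at hD))
  have h2 := mul_mem (inv_natCast_mem_locAt hl C hcop) h1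
  rwa [inv_mul_cancel_left₀ (ne_zero_of_coprime hl hcop)] at h2

/-- Elements of `ℚ(s)` have an integer multiple in `ℤ[s]`. -/
theorem exists_natCast_mul_mem_adjoin {s : Set F} (hs : ∀ x ∈ s, IsIntegral ℤ x) {x : F}
    (hx : x ∈ IntermediateField.adjoin ℚ s) :
    ∃ D : ℕ, D ≠ 0 ∧ (D : F) * x ∈ Algebra.adjoin ℤ s := by
  have h1 : x ∈ Algebra.adjoin ℚ s := by
    rw [← IntermediateField.adjoin_toSubalgebra_of_isAlgebraic (fun y hy =>
      ((hs y hy).tower_top (A := ℚ)).isAlgebraic)]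
    exact hx
  clear hx hs
  induction h1 using Algebra.adjoin_induction with
  | mem x hx => exact ⟨1, one_ne_zero, by rw [Nat.cast_one, one_mul]; exact Algebra.subset_adjoin hx⟩
  | algebraMap r =>
    refine ⟨r.den, r.den_nz, ?_⟩
    have : (r.den : F) * algebraMap ℚ F r = (r.num : F) := by
      rw [← map_natCast (algebraMap ℚ F), ← map_mul, mul_comm, Rat.mul_den_eq_num, map_intCast]
    rw [this]
    exact intCast_mem _ _
  | add x y _ _ h1 h2 =>
    obtain ⟨D, hD, h1⟩ := h1
    obtain ⟨D', hD', h2⟩ := h2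
    refine ⟨D * D', mul_ne_zero hD hD', ?_⟩
    have h3 := add_mem (mul_mem (natCast_mem (Algebra.adjoin ℤ s) D') h1)
      (mul_mem (natCast_mem (Algebra.adjoin ℤ s) D) h2)
    rw [show ((D * D' : ℕ) : F) * (x + y) = D' * (D * x) + D * (D' * y) by push_cast; ring]
    exact h3
  | mul x y _ _ h1 h2 =>
    obtain ⟨D, hD, h1⟩ := h1
    obtain ⟨D', hD', h2⟩ := h2
    refine ⟨D * D', mul_ne_zero hD hD', ?_⟩
    rw [show ((D * D' : ℕ) : F) * (x * y) = (D * x) * (D' * y) by push_cast; ring]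
    exact mul_mem h1 h2

end Localization

/-! ### Criteria for the Frobenius condition on `ℤ[x]`. -/

section FrobeniusCondition

variable {F : Type*} [Field F] {l : ℕ}

/-- Some power of Frobenius is the identity on `locAt l C` modulo an element that agrees with `l`
up to powers. -/
def FrobeniusCondition (l : ℕ) (C : Subalgebra ℤ F) : Prop :=
  ∃ (t : locAt l C) (k Q : ℕ), t ∣ (l : locAt l C) ∧ (l : locAt l C) ∣ t ^ k ∧ 2 ≤ Q ∧
    ∀ y : locAt l C, t ∣ y ^ Q - y

/-- The generator of `ℤ[x]`, as an element of `locAt l ℤ[x]`. -/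
def locGen (l : ℕ) (x : F) : locAt l (Algebra.adjoin ℤ {x}) :=
  ⟨x, le_locAt (Algebra.self_mem_adjoin_singleton ℤ x)⟩

variable [CharZero F]

/-- Only the generator `x` needs checking, and `x ^ h ≡ 1` with `h` prime to `l` makes `Q = l ^
φ(h)` work for it. -/
theorem FrobeniusCondition.of_pow_sub_one (hl : l.Prime) {x : F}
    {t : locAt l (Algebra.adjoin ℤ {x})} {k h : ℕ} (h1 : t ∣ (l : locAt l (Algebra.adjoin ℤ {x})))
    (h2 : (l : locAt l (Algebra.adjoin ℤ {x})) ∣ t ^ k) (hpos : 0 < h) (hh : h.Coprime l)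
    (hx : t ∣ locGen l x ^ h - 1) : FrobeniusCondition l (Algebra.adjoin ℤ {x}) := by
  refine ⟨t, k, l ^ h.totient, h1, h2, ?_, dvd_pow_sub_self_of_adjoin hl h1 ?_⟩
  · exact hl.two_le.trans (Nat.le_self_pow (Nat.totient_pos.2 hpos).ne' l)
  · intro y hy
    have h3 : y = locGen l x := Subtype.ext hy
    rw [h3]
    simpa using dvd_pow_totient_sub_self hh hx 1

theorem isUnit_intCast_locAt (hl : l.Prime) (C : Subalgebra ℤ F) {u : ℤ}
    (hu : u.natAbs.Coprime l) : IsUnit (u : locAt l C) := by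
  have h1 := isUnit_natCast_locAt hl C hu
  rcases Int.natAbs_eq u with h | h
  · have h2 : (u : locAt l C) = (u.natAbs : locAt l C) := by
      conv_lhs => rw [h]
      exact Int.cast_natCast _
    rwa [h2]
  · have h2 : (u : locAt l C) = -(u.natAbs : locAt l C) := by
      conv_lhs => rw [h]
      rw [Int.cast_neg, Int.cast_natCast]
    rw [h2]
    exact h1.neg

/-- The odd integer `r` is `1` modulo `t ∣ 2`, so `x ^ m ≡ z ≡ 1`. -/
theorem FrobeniusCondition.of_pow_eq_mul {x : F} {z t : locAt 2 (Algebra.adjoin ℤ {x})}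
    {k m r : ℕ} (hm : Odd m) (hr : Odd r) (hx : x ^ m = z * r)
    (h1 : t ∣ 2) (h2 : 2 ∣ t ^ k) (hz : t ∣ z - 1) :
    FrobeniusCondition 2 (Algebra.adjoin ℤ {x}) := by
  refine FrobeniusCondition.of_pow_sub_one Nat.prime_two (t := t) (k := k) (h := m)
    (by simpa using h1) (by simpa using h2) hm.pos hm.coprime_two_right ?_
  obtain ⟨j, rfl⟩ := hr
  have h3 : locGen 2 x ^ m = z * (2 * j + 1 : ℕ) := Subtype.ext hx
  have h4 : locGen 2 x ^ m - 1 = (z - 1) * (2 * j + 1 : ℕ) + 2 * j := by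
    rw [h3]; push_cast; ring
  rw [h4]
  exact (dvd_mul_of_dvd_left hz _).add (dvd_mul_of_dvd_left h1 _)

/-- The Eisenstein case. -/
theorem FrobeniusCondition.of_pow_two_pow_sub_one {x : F} {z : locAt 2 (Algebra.adjoin ℤ {x})}
    {m r j : ℕ} {u : ℤ} (hm : Odd m) (hr : Odd r) (hx : x ^ m = z * r) (hu : Odd u)
    (hz : z ^ 2 ^ j - 1 = 2 * u) : FrobeniusCondition 2 (Algebra.adjoin ℤ {x}) := by
  -- `z - 1` divides `z ^ 2 ^ j - 1 = 2 u` with `u` a unit, and `(z - 1) ^ 2 ^ j ≡ z ^ 2 ^ j - 1 ≡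
  -- 0` modulo `2`.
  refine FrobeniusCondition.of_pow_eq_mul (t := z - 1) (k := 2 ^ j) hm hr hx ?_ ?_ dvd_rfl
  · have h1 : z - 1 ∣ 2 * u := by
      rw [← hz]
      exact dvd_pow_sub_one_of_dvd dvd_rfl _
    exact (isUnit_intCast_locAt Nat.prime_two _ (Int.natAbs_odd.2 hu).coprime_two_right).dvd_mul_right.1 h1
  · obtain ⟨w, hw⟩ := exists_add_pow_prime_pow_eq Nat.prime_two (z - 1) 1 j
    rw [sub_add_cancel, one_pow] at hw
    refine ⟨u - (z - 1) * 1 * w, ?_⟩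
    push_cast at hw
    linear_combination hz - hw

end FrobeniusCondition

/-! ### The quadratic Gauss sum modulo `2`. -/

section Gauss

/-- The quadratic Gauss sum lies in `1 + 2 ℤ[η]` and has square `± p`. -/
theorem exists_gauss {p : ℕ} (hp : p.Prime) (hp2 : p ≠ 2) {η : ℂ} (hη : IsPrimitiveRoot η p) :
    ∃ γ ∈ Algebra.adjoin ℤ {η}, (p % 4 = 1 → (1 + 2 * γ) ^ 2 = (p : ℂ)) ∧
      (p % 4 = 3 → (1 + 2 * γ) ^ 2 = -(p : ℂ)) := by
  have := Fact.mk hp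
  have hchar : ringChar (ZMod p) ≠ 2 := by rwa [ZMod.ringChar_zmod_n]
  let χ : MulChar (ZMod p) ℂ := (quadraticChar (ZMod p)).ringHomComp (Int.castRingHom ℂ)
  let ψ : AddChar (ZMod p) ℂ := AddChar.zmodChar p hη.pow_eq_one
  have hψ : ψ.IsPrimitive := AddChar.zmodChar_primitive_of_primitive_root p hη
  have hχ1 : χ ≠ 1 := by
    refine (MulChar.ringHomComp_ne_one_iff (Int.cast_injective (α := ℂ))).2 ?_
    exact quadraticChar_ne_one hchar
  have hχ2 : χ.IsQuadratic := (quadraticChar_isQuadratic (ZMod p)).comp _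
  have hsq := gaussSum_sq hχ1 hχ2 hψ
  have hψη : ∀ a : ZMod p, ψ a ∈ Algebra.adjoin ℤ {η} := fun a => by
    rw [AddChar.zmodChar_apply]
    exact pow_mem (Algebra.self_mem_adjoin_singleton ℤ η) _
  have hsum : ∑ a, ψ a = 0 := AddChar.sum_eq_zero_of_ne_one (by simpa using hψ one_ne_zero)
  -- Off zero the character is `± 1`, so `χ + 1` is even. As the values of `ψ` off zero sum to `-1`,
  -- adding them to the Gauss sum leaves twice an integral element.
  have hval : ∀ a : ZMod p, ∃ c : ℤ, a ≠ 0 → χ a + 1 = 2 * c := by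
    intro a
    by_cases ha : a = 0
    · exact ⟨0, fun h => absurd ha h⟩
    rcases quadraticChar_dichotomy ha with h | h
    · refine ⟨1, fun _ => ?_⟩
      change ((quadraticChar (ZMod p) a : ℤ) : ℂ) + 1 = _
      rw [h]; norm_num
    · refine ⟨0, fun _ => ?_⟩
      change ((quadraticChar (ZMod p) a : ℤ) : ℂ) + 1 = _
      rw [h]; norm_num
  choose c hc using hval
  have hg : gaussSum χ ψ = 1 + 2 * ∑ a ∈ Finset.univ.erase (0 : ZMod p), (c a : ℂ) * ψ a := by
    have h1 : gaussSum χ ψ = ∑ a ∈ Finset.univ.erase (0 : ZMod p), χ a * ψ a := by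
      rw [gaussSum, ← Finset.add_sum_erase _ _ (Finset.mem_univ (0 : ZMod p)), MulChar.map_zero,
        zero_mul, zero_add]
    have h2 : ∑ a ∈ Finset.univ.erase (0 : ZMod p), ψ a = -1 := by
      rw [← Finset.add_sum_erase _ _ (Finset.mem_univ (0 : ZMod p)), AddChar.map_zero_eq_one] at hsum
      linear_combination hsum
    have h3 : ∑ a ∈ Finset.univ.erase (0 : ZMod p), (χ a * ψ a + ψ a)
        = 2 * ∑ a ∈ Finset.univ.erase (0 : ZMod p), (c a : ℂ) * ψ a := by
      rw [Finset.mul_sum]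
      refine Finset.sum_congr rfl fun a ha => ?_
      linear_combination ψ a * hc a (Finset.ne_of_mem_erase ha)
    rw [Finset.sum_add_distrib, h2] at h3
    rw [h1]
    linear_combination h3
  refine ⟨∑ a ∈ Finset.univ.erase (0 : ZMod p), (c a : ℂ) * ψ a,
    sum_mem fun a _ => mul_mem (intCast_mem _ (c a)) (hψη a), ?_, ?_⟩
  all_goals
    intro h4
    rw [← hg, hsq, ZMod.card]
    change ((quadraticChar (ZMod p) (-1) : ℤ) : ℂ) * _ = _
    rw [quadraticChar_neg_one hchar, ZMod.card]
  · rw [ZMod.χ₄_nat_one_mod_four h4]; simp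
  · rw [ZMod.χ₄_nat_three_mod_four h4]; simp

end Gauss

/-! ### The Frobenius condition for supersingular numbers. -/

theorem isPrimitiveRoot_coe_locAt {F : Type*} [Field F] {l : ℕ} {C : Subalgebra ℤ F}
    {z : locAt l C} {n : ℕ} (h : IsPrimitiveRoot (z : F) n) : IsPrimitiveRoot z n :=
  h.of_map_of_injective (f := (locAt l C).subtype) (locAt l C).subtype_injective

theorem mem_locAt_of_eq_mul_natCast {F : Type*} [Field F] {l : ℕ}
    {C : Subalgebra ℤ F} {x z : F} {r : ℕ} (hr : r.Coprime l) (hx : x ∈ C) (h : x = z * r) :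
    z ∈ locAt l C :=
  ⟨r, hr, by rw [mul_comm, ← h]; exact hx⟩

/-- Supersingular numbers satisfy the Frobenius condition at odd primes. -/
theorem frobeniusCondition_of_ne_two {l q m : ℕ} (hl : l.Prime) (hl2 : l ≠ 2) (hq : q.Coprime l)
    (hm : 0 < m) {ζ s x : ℂ} (hζ : IsPrimitiveRoot ζ m) (hs : s ^ 2 = q) (hx : x = ζ * s) :
    FrobeniusCondition l (Algebra.adjoin ℤ {x}) := by
  obtain ⟨a, m', hm', rfl⟩ := Nat.exists_eq_pow_mul_and_not_dvd hm.ne' l hl.ne_one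
  have hm'0 : 0 < m' := Nat.pos_of_ne_zero fun h => hm' (h ▸ dvd_zero l)
  have hlc : m'.Coprime l := ((Nat.Prime.coprime_iff_not_dvd hl).2 hm').symm
  have h2c : Nat.Coprime 2 l := ((Nat.coprime_primes Nat.prime_two hl).2 (Ne.symm hl2))
  have hxm : x ^ (2 * m') = ζ ^ (2 * m') * (q ^ m' : ℕ) := by
    rw [hx, mul_pow, pow_mul s, hs]; push_cast; rfl
  have hmem : ζ ^ (2 * m') ∈ locAt l (Algebra.adjoin ℤ {x}) :=
    mem_locAt_of_eq_mul_natCast (hq.pow_left m')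
      (pow_mem (Algebra.self_mem_adjoin_singleton ℤ x) (2 * m')) hxm
  -- The factor `2` in the exponent removes the square root; it preserves primitivity since `l` is
  -- odd.
  have hξ : IsPrimitiveRoot (ζ ^ (2 * m')) (l ^ a) := by
    have h1 : IsPrimitiveRoot (ζ ^ m') (l ^ a) := hζ.pow hm (mul_comm _ _)
    rw [mul_comm, pow_mul]
    exact h1.pow_of_coprime 2 (h2c.pow_right a)
  obtain ⟨t, k, h1, h2, h3⟩ := exists_dvd_sub_one_of_isPrimitiveRoot hl
    (isPrimitiveRoot_coe_locAt (z := ⟨_, hmem⟩) hξ)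
  -- The factor `l - 1` makes the integer `q ^ m'` trivial modulo `l` by Fermat.
  refine FrobeniusCondition.of_pow_sub_one hl (h := 2 * m' * (l - 1)) h1 h2 ?_ ?_ ?_
  · have := hl.two_le
    exact Nat.mul_pos (by omega) (by omega)
  · refine Nat.Coprime.mul_left (Nat.Coprime.mul_left h2c hlc) ?_
    exact ((Nat.coprime_self_sub_right hl.one_le).2 (by simp)).symm
  · have h4 : locGen l x ^ (2 * m') = ⟨_, hmem⟩ * (q ^ m' : ℕ) := Subtype.ext hxm
    have h5 : (l : locAt l (Algebra.adjoin ℤ {x})) ∣ ((q ^ m' : ℕ) : locAt l _) ^ (l - 1) - 1 := by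
      have h6 := Nat.ModEq.pow_totient (hq.pow_left m')
      rw [Nat.totient_prime hl] at h6
      have h7 := (Nat.modEq_iff_dvd.1 h6.symm)
      have h8 := map_dvd (Int.castRingHom (locAt l (Algebra.adjoin ℤ {x}))) h7
      simpa using h8
    rw [pow_mul, h4, mul_pow]
    have h9 := (dvd_mul_of_dvd_left (dvd_pow_sub_one_of_dvd h3 (l - 1))
      (((q ^ m' : ℕ) : locAt l (Algebra.adjoin ℤ {x})) ^ (l - 1))).add (h1.trans h5)
    convert h9 using 1
    ring

/-- The case of a square `q = r ^ 2` at `2`. -/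
theorem frobeniusCondition_two_of_square {m r : ℕ} (hr : Odd r) (hm : 0 < m) {ζ x : ℂ}
    (hζ : IsPrimitiveRoot ζ m) (hx : x = ζ * r) :
    FrobeniusCondition 2 (Algebra.adjoin ℤ {x}) := by
  obtain ⟨a, m', hm', rfl⟩ := Nat.exists_eq_two_pow_mul_odd hm.ne'
  have hxm : x ^ m' = ζ ^ m' * (r ^ m' : ℕ) := by
    rw [hx, mul_pow]; push_cast; rfl
  have hmem : ζ ^ m' ∈ locAt 2 (Algebra.adjoin ℤ {x}) :=
    mem_locAt_of_eq_mul_natCast (hr.pow).coprime_two_right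
      (pow_mem (Algebra.self_mem_adjoin_singleton ℤ x) m') hxm
  have hξ : IsPrimitiveRoot (ζ ^ m') (2 ^ a) := hζ.pow hm (mul_comm _ _)
  obtain ⟨t, k, h1, h2, h3⟩ := exists_dvd_sub_one_of_isPrimitiveRoot Nat.prime_two
    (isPrimitiveRoot_coe_locAt (z := ⟨_, hmem⟩) hξ)
  exact FrobeniusCondition.of_pow_eq_mul (z := ⟨_, hmem⟩) hm' hr.pow hxm
    (by simpa using h1) (by simpa using h2) h3

/-- Powers of `x = ζ p ^ j √p`. -/
theorem pow_eq_mul_of_odd {p j m' : ℕ} (hm' : Odd m') {ζ s x : ℂ} (hs : s ^ 2 = p)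
    (hx : x = ζ * (p ^ j * s)) :
    x ^ m' = (ζ ^ m' * s) * (p ^ (j * m' + m' / 2) : ℕ) := by
  obtain ⟨i, rfl⟩ := hm'
  have h1 : (2 * i + 1) / 2 = i := by omega
  rw [hx, h1]
  push_cast
  rw [mul_pow, mul_pow, pow_succ s, pow_mul s, hs, pow_add (p : ℂ), pow_mul (p : ℂ) j]
  ring

/-- The case of a non-square `q` at `2`, outside the exceptional set. -/
theorem frobeniusCondition_two_of_nonsquare {p j m : ℕ} (hp : p.Prime) (hp2 : p ≠ 2) (hm : 0 < m)
    {ζ s x : ℂ} (hζ : IsPrimitiveRoot ζ m) (hs : s ^ 2 = p) (hx : x = ζ * (p ^ j * s))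
    (hne : ¬ (¬ p ∣ m ∧ (p % 4 = 1 → ¬ 4 ∣ m) ∧ (p % 4 = 3 → 4 ∣ m ∧ ¬ 8 ∣ m))) :
    FrobeniusCondition 2 (Algebra.adjoin ℤ {x}) := by
  obtain ⟨a, m', hm', rfl⟩ := Nat.exists_eq_two_pow_mul_odd hm.ne'
  have hpodd : Odd p := hp.odd_of_ne_two hp2
  have hp4 : p % 4 = 1 ∨ p % 4 = 3 := by
    obtain ⟨i, rfl⟩ := hpodd
    omega
  set r := p ^ (j * m' + m' / 2) with hr
  have hrodd : Odd r := hpodd.pow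
  have hxm : x ^ m' = (ζ ^ m' * s) * (r : ℕ) := pow_eq_mul_of_odd hm' hs hx
  have hmem : ζ ^ m' * s ∈ locAt 2 (Algebra.adjoin ℤ {x}) :=
    mem_locAt_of_eq_mul_natCast hrodd.coprime_two_right
      (pow_mem (Algebra.self_mem_adjoin_singleton ℤ x) m') hxm
  have hξ : IsPrimitiveRoot (ζ ^ m') (2 ^ a) := hζ.pow hm (mul_comm _ _)
  let z : locAt 2 (Algebra.adjoin ℤ {x}) := ⟨_, hmem⟩
  have eis : ∀ (i : ℕ) (u : ℤ), Odd u → (ζ ^ m' * s) ^ 2 ^ i - 1 = 2 * u →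
      FrobeniusCondition 2 (Algebra.adjoin ℤ {x}) := fun i u hu h =>
    FrobeniusCondition.of_pow_two_pow_sub_one (z := z) hm' hrodd hxm hu (j := i) (Subtype.ext h)
  have hneg : 1 ≤ a → (ζ ^ m') ^ 2 ^ (a - 1) = -1 := by
    intro ha
    refine IsPrimitiveRoot.eq_neg_one_of_two_right (hξ.pow (by positivity) ?_)
    rw [← pow_succ, Nat.sub_add_cancel ha]
  have h4dvd : ∀ i, 2 ^ i ∣ 2 ^ a * m' ↔ i ≤ a := by
    intro i
    rw [Nat.Coprime.dvd_mul_right ((hm'.coprime_two_left).pow_left i),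
      Nat.pow_dvd_pow_iff_le_right (by norm_num)]
  have h4 : 4 ∣ 2 ^ a * m' ↔ 2 ≤ a := h4dvd 2
  have h8 : 8 ∣ 2 ^ a * m' ↔ 3 ≤ a := h4dvd 3
  rw [h4, h8] at hne
  have hsq1 : a ≤ 1 → (ζ ^ m') ^ 2 = 1 := by
    intro ha
    have h5 : 2 = 2 ^ a * 2 ^ (1 - a) := by
      rw [← pow_add, Nat.add_sub_cancel' ha, pow_one]
    rw [h5, pow_mul, hξ.pow_eq_one, one_pow]
  have hsq2 : a = 2 → (ζ ^ m') ^ 2 = -1 := by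
    rintro rfl
    simpa using hneg (by norm_num)
  -- With `d = m / p`, `ζ ^ (2 d)` is a primitive `p`-th root of unity, since `p` is odd; the
  -- exponent `2 d` turns the power of `s` into an integer, so this root lies in the local ring.
  -- Hence so does `γ`, and `z = ± (1 + 2 γ)` is `1` modulo `2`.
  have gauss : p ∣ 2 ^ a * m' → (p % 4 = 1 ∧ (ζ ^ m' * s) ^ 2 = p ∨
      p % 4 = 3 ∧ (ζ ^ m' * s) ^ 2 = -p) → FrobeniusCondition 2 (Algebra.adjoin ℤ {x}) := by
    rintro ⟨d, hd⟩ hsq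
    have hη : IsPrimitiveRoot (ζ ^ (2 * d)) p := by
      rw [mul_comm, pow_mul]
      exact (hζ.pow hm (hd.trans (mul_comm p d))).pow_of_coprime 2 hpodd.coprime_two_left
    have hηmem : ζ ^ (2 * d) ∈ locAt 2 (Algebra.adjoin ℤ {x}) := by
      refine mem_locAt_of_eq_mul_natCast (r := p ^ ((2 * j + 1) * d)) hpodd.pow.coprime_two_right
        (pow_mem (Algebra.self_mem_adjoin_singleton ℤ x) (2 * d)) ?_
      rw [hx, mul_pow, mul_pow, pow_mul s, hs]
      push_cast
      ring
    obtain ⟨γ, hγ, hγ1, hγ3⟩ := exists_gauss hp hp2 hη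
    have hγmem : γ ∈ locAt 2 (Algebra.adjoin ℤ {x}) :=
      (Algebra.adjoin_le (S := subalgebraOfSubring (locAt 2 (Algebra.adjoin ℤ {x})))
        (by simpa using hηmem)) hγ
    have h5 : (ζ ^ m' * s) ^ 2 = (1 + 2 * γ) ^ 2 := by
      rcases hsq with ⟨h, h'⟩ | ⟨h, h'⟩
      · rw [h', hγ1 h]
      · rw [h', hγ3 h]
    refine FrobeniusCondition.of_pow_eq_mul (z := z) (t := 2) (k := 1) hm' hrodd hxm dvd_rfl
      (by simp) ?_
    rcases sq_eq_sq_iff_eq_or_eq_neg.1 h5 with h | h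
    · exact ⟨⟨γ, hγmem⟩, Subtype.ext (show ζ ^ m' * s - 1 = 2 * γ by rw [h]; ring)⟩
    · exact ⟨-1 - ⟨γ, hγmem⟩, Subtype.ext (show ζ ^ m' * s - 1 = 2 * (-1 - γ) by rw [h]; ring)⟩
  -- Here `z ^ 2 ^ (a - 1) = -p ^ 2 ^ (a - 2) ≡ -1` modulo `4`, which is the Eisenstein case.
  by_cases ha3 : 3 ≤ a
  · obtain ⟨b, rfl⟩ : ∃ b, a = b + 3 := ⟨a - 3, by omega⟩
    obtain ⟨c, hc⟩ : ∃ c, p ^ 2 ^ (b + 1) = 4 * c + 1 := by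
      have h5 : (p ^ 2) ^ 2 ^ b % 4 = 1 := by
        have h6 : p ^ 2 % 4 = 1 := by
          rcases hp4 with h | h <;> simp [Nat.pow_mod, h]
        rw [Nat.pow_mod, h6, one_pow]
        norm_num
      refine ⟨p ^ 2 ^ (b + 1) / 4, ?_⟩
      rw [← pow_mul, ← pow_succ'] at h5
      omega
    refine eis (b + 2) (-(2 * c + 1)) ((odd_two_mul_add_one _).neg) ?_
    have h5 := hneg (by omega)
    rw [show b + 3 - 1 = b + 2 by omega] at h5
    rw [mul_pow, h5, pow_succ 2 (b + 1), mul_comm (2 ^ (b + 1)) 2, pow_mul s, hs]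
    have h6 : (p : ℂ) ^ 2 ^ (b + 1) = 4 * c + 1 := by exact_mod_cast hc
    rw [h6]
    push_cast
    ring
  -- Now `z ^ 2 = ± p`. It is the Eisenstein case if this is `3` modulo `4`; if it is `1`, then
  -- `hne` forces `p ∣ m` and the Gauss sum applies.
  by_cases ha2 : a = 2
  · rcases hp4 with hp4 | hp4
    · obtain ⟨i, hi⟩ : ∃ i : ℕ, p = 4 * i + 1 := ⟨p / 4, by omega⟩
      refine eis 1 (-(2 * i + 1)) ((odd_two_mul_add_one _).neg) ?_
      have h5 : (p : ℂ) = 4 * i + 1 := by exact_mod_cast hi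
      rw [pow_one, mul_pow, hsq2 ha2, hs]
      push_cast
      linear_combination -h5
    · exact gauss (by by_contra h; exact hne ⟨h, by omega, by omega⟩)
        (Or.inr ⟨hp4, by rw [mul_pow, hsq2 ha2, hs, neg_one_mul]⟩)
  · rcases hp4 with hp4 | hp4
    · exact gauss (by by_contra h; exact hne ⟨h, by omega, by omega⟩)
        (Or.inl ⟨hp4, by rw [mul_pow, hsq1 (by omega), hs, one_mul]⟩)
    · obtain ⟨i, hi⟩ : ∃ i : ℕ, p = 4 * i + 3 := ⟨p / 4, by omega⟩
      refine eis 1 (2 * i + 1) (odd_two_mul_add_one _) ?_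
      have h5 : (p : ℂ) = 4 * i + 3 := by exact_mod_cast hi
      rw [pow_one, mul_pow, hsq1 (by omega), hs]
      push_cast
      linear_combination h5

theorem finite_quotient_span_natCast_of_finite {A : Type*} [CommRing A] [Module.Finite ℤ A]
    {l : ℕ} (hl : l ≠ 0) : Finite (A ⧸ Ideal.span {(l : A)}) := by
  have h1 : Module.Finite ℤ (A ⧸ Ideal.span {(l : A)}) :=
    Module.Finite.of_surjective (Ideal.Quotient.mk (Ideal.span {(l : A)})).toIntAlgHom.toLinearMap
      Ideal.Quotient.mk_surjective
  have h2 : Module.IsTorsion ℤ (A ⧸ Ideal.span {(l : A)}) := by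
    intro x
    refine ⟨⟨l, mem_nonZeroDivisors_of_ne_zero (by exact_mod_cast hl)⟩, ?_⟩
    obtain ⟨x, rfl⟩ := Ideal.Quotient.mk_surjective x
    change (l : ℤ) • Ideal.Quotient.mk _ x = 0
    rw [zsmul_eq_mul, Int.cast_natCast, ← map_natCast (Ideal.Quotient.mk _), ← map_mul,
      Ideal.Quotient.eq_zero_iff_mem]
    exact Ideal.mul_mem_right _ _ (Ideal.mem_span_singleton_self _)
  exact Module.finite_of_fg_torsion _ h2

/-! ### From the Frobenius condition to the completed order. -/

section Orders

variable {L : Type*} [Field L] [CharZero L]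

theorem finite_quotient_span_natCast {l : ℕ} (hl : l ≠ 0) (R : Subalgebra ℤ L) [h : IsOrder R] :
    Finite (R ⧸ Ideal.span {(l : R)}) := by
  have := h.finite
  exact finite_quotient_span_natCast_of_finite hl

theorem natCast_mem_nonZeroDivisors_order {l : ℕ} (hl : l ≠ 0) (R : Subalgebra ℤ L) :
    (l : R) ∈ nonZeroDivisors R := by
  refine mem_nonZeroDivisors_of_ne_zero fun h => hl ?_
  have h1 : (l : L) = 0 := by simpa using congrArg Subtype.val h
  exact_mod_cast h1

/-- The `l`-adic completion of an order that contains a ring satisfying the Frobenius condition at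
`l` is regular above `l`. -/
theorem isRegularAbove_LAdic {E : Type*} [Field E] [CharZero E] (φ : L →+* E) {l : ℕ}
    (hl : l.Prime) (R : Subalgebra ℤ L) [hR : IsOrder R] {C : Subalgebra ℤ E}
    (hC : FrobeniusCondition l C) (hCR : ∀ c ∈ C, ∃ r : R, φ r = c)
    (hD : ∀ x : L, ∃ D : ℕ, D ≠ 0 ∧ (D : E) * φ x ∈ C) :
    IsRegularAbove (LAdic l R) (l : LAdic l R) := by
  have := finite_quotient_span_natCast hl.ne_zero R
  obtain ⟨t, k, Q, h1, h2, hQ, hF⟩ := hC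
  -- Integral closedness of `locAt l C` makes `R` and `C` agree up to integers prime to `l`; a
  -- multiple `t₀` of `t` then serves in `R`.
  have hint : ∀ r : R, φ r ∈ locAt l C := fun r =>
    mem_locAt_of_isIntegral hl h2 hQ hF
      ((IsOrder.le_integralClosure R r.2 : IsIntegral ℤ (r : L)).map φ.toIntAlgHom) (hD r)
  have inj : ∀ {r s : R}, φ r = φ s → r = s := fun h => Subtype.ext (φ.injective h)
  obtain ⟨N₀, hN₀, hN₀t⟩ := t.2
  obtain ⟨t₀, ht₀⟩ := hCR _ hN₀t
  have key : ∀ (r : R) (x : locAt l C), φ r = x → t ∣ x → ∃ N : ℕ, N.Coprime l ∧ t₀ ∣ N * r := by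
    rintro r x hx ⟨c, hc⟩
    obtain ⟨N, hN, hNc⟩ := c.2
    obtain ⟨s, hs⟩ := hCR _ hNc
    refine ⟨N₀ * N, Nat.Coprime.mul_left hN₀ hN, s, inj ?_⟩
    have h3 : (x : E) = t * c := congrArg Subtype.val hc
    push_cast
    simp only [map_mul, map_natCast]
    rw [ht₀, hs, hx, h3]
    ring
  refine isRegularAbove_adicCompletion (natCast_mem_nonZeroDivisors_order hl.ne_zero R) (t := t₀)
    (k := k) hQ ?_ ?_ ?_
  · exact key l l (by simp) h1
  · obtain ⟨c, hc⟩ := h2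
    obtain ⟨N, hN, hNc⟩ := c.2
    obtain ⟨s, hs⟩ := hCR _ hNc
    refine ⟨N, hN, N₀ ^ k * s, inj ?_⟩
    have h3 : (t : E) ^ k = l * c := congrArg Subtype.val hc
    push_cast
    simp only [map_mul, map_natCast, map_pow]
    rw [ht₀, hs, mul_pow, h3]
    ring
  · intro r
    exact key _ (⟨φ r, hint r⟩ ^ Q - ⟨φ r, hint r⟩) (by push_cast; simp) (hF _)

/-- A finite torsion-free `R_l`-module of rank `e` embeds into `R_l ^ e` with image containing
`l ^ N R_l ^ e`. -/
theorem exists_submodule_equiv_of_hasRank {l : ℕ} (hl : l ≠ 0) (R : Subalgebra ℤ L) (M : Type*)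
    [AddCommGroup M] [Module (LAdic l R) M] [Module.Finite (LAdic l R) M]
    [hM : Module.IsTorsionFree (LAdic l R) M] {e : ℕ} (h : HasRank l R M e) :
    ∃ (M' : Submodule (LAdic l R) (Fin e → LAdic l R)) (N : ℕ),
      (∀ x, (l : LAdic l R) ^ N • x ∈ M') ∧ Nonempty (M ≃ₗ[LAdic l R] M') := by
  obtain ⟨E⟩ := h
  have hreg : (l : LAdic l R) ∈ nonZeroDivisors (LAdic l R) :=
    natCast_mem_nonZeroDivisors_adicCompletion (natCast_mem_nonZeroDivisors_order hl R)
  obtain ⟨ψ, hψ, N, hN⟩ := exists_injective_of_localizedModule_equiv hreg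
    (fun x hx => (hM.isSMulRegular (isRegular_iff_mem_nonZeroDivisors.2 hreg)) (by simpa using hx)) E
  exact ⟨LinearMap.range ψ, N, hN, ⟨LinearEquiv.ofInjective ψ hψ⟩⟩

end Orders

theorem sqrt_natCast_pow_odd (p j : ℕ) :
    ((Real.sqrt ((p ^ (2 * j + 1) : ℕ) : ℝ) : ℝ) : ℂ) = p ^ j * ((Real.sqrt (p : ℝ) : ℝ) : ℂ) := by
  have h1 : ((p ^ (2 * j + 1) : ℕ) : ℝ) = ((p : ℝ) ^ j) ^ 2 * p := by push_cast; ring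
  rw [h1, Real.sqrt_mul (sq_nonneg _), Real.sqrt_sq (by positivity)]
  push_cast
  rfl

/-- Outside the exceptional case the Frobenius condition holds for `ℤ[π]` at `l`. -/
theorem frobeniusCondition_of_not_exceptional {p n q l : ℕ} (hp : p.Prime) (hn : 0 < n)
    (hq : q = p ^ n) (hl : l.Prime) (hlp : l ≠ p) {π : ℂ} (hπ : IsSupersingularNumber q π)
    (hne : ¬ (l = 2 ∧ π ∈ exceptionalSet p q)) :
    FrobeniusCondition l (Algebra.adjoin ℤ {π}) := by
  obtain ⟨m, ζ, hm, hζ, hx⟩ := hπ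
  have hs : ((Real.sqrt (q : ℝ) : ℝ) : ℂ) ^ 2 = q := by
    rw [← Complex.ofReal_pow, Real.sq_sqrt (Nat.cast_nonneg q), Complex.ofReal_natCast]
  by_cases hl2 : l ≠ 2
  · refine frobeniusCondition_of_ne_two hl hl2 ?_ hm hζ hs hx
    rw [hq]
    exact ((Nat.coprime_primes hp hl).2 (Ne.symm hlp)).pow_left n
  push Not at hl2
  subst hl2
  have hp2 : p ≠ 2 := Ne.symm hlp
  have hpodd : Odd p := hp.odd_of_ne_two hp2
  by_cases hsq : IsSquare q
  · obtain ⟨r, hr⟩ := hsq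
    have hrodd : Odd r := by
      have : Odd q := hq ▸ hpodd.pow
      exact (Nat.odd_mul.1 (hr ▸ this)).1
    refine frobeniusCondition_two_of_square hrodd hm hζ ?_
    rw [hx, hr, Nat.cast_mul, Real.sqrt_mul_self (Nat.cast_nonneg r), Complex.ofReal_natCast]
  · have hnodd : Odd n := by
      rw [← Nat.not_even_iff_odd]
      rintro ⟨j, rfl⟩
      exact hsq ⟨p ^ j, by rw [hq, pow_add]⟩
    obtain ⟨j, rfl⟩ := hnodd
    have hs' : ((Real.sqrt (p : ℝ) : ℝ) : ℂ) ^ 2 = p := by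
      rw [← Complex.ofReal_pow, Real.sq_sqrt (Nat.cast_nonneg p), Complex.ofReal_natCast]
    refine frobeniusCondition_two_of_nonsquare (j := j) hp hp2 hm hζ hs' ?_ fun h =>
      hne ⟨rfl, m, ζ, hm, hζ, hx, hp2, hsq, h.1, h.2.1, h.2.2⟩
    rw [hx, hq, sqrt_natCast_pow_odd]

theorem dvd_pow_pow_sub_self {A : Type*} [CommRing A] {t x : A} {n : ℕ} (h : t ∣ x ^ n - x)
    (k : ℕ) : t ∣ x ^ n ^ k - x := by
  induction k with
  | zero => simp
  | succ k ih =>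
    have h1 := (h.trans (sub_dvd_pow_sub_pow (x ^ n) x (n ^ k))).add ih
    rwa [sub_add_sub_cancel, ← pow_mul, ← pow_succ'] at h1

/-! ### The quadratic generator `ω` and the integral closure at `2`. -/

section Quadratic

variable {L : Type*} [Field L]

/-- An odd power of `g` is an odd multiple of `2 ω - 1`, where `ω ^ 2 - ω` is an integer. -/
def IsQuadraticGenerator (g ω : L) : Prop :=
  ∃ (m r : ℕ) (c : ℤ), Odd m ∧ Odd r ∧ g ^ m = (2 * ω - 1) * r ∧ ω ^ 2 = ω + c

variable {g ω : L}

theorem IsQuadraticGenerator.sq_pow_eq {m r : ℕ} {c : ℤ} (h1 : g ^ m = (2 * ω - 1) * r)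
    (h2 : ω ^ 2 = ω + c) : (g ^ 2) ^ m = ((4 * c + 1 : ℤ) : L) * (r ^ 2 : ℕ) := by
  rw [← pow_mul, mul_comm, pow_mul, h1]
  push_cast
  linear_combination 4 * (r : L) ^ 2 * h2

theorem IsQuadraticGenerator.isIntegral_right (h : IsQuadraticGenerator g ω) : IsIntegral ℤ ω := by
  obtain ⟨m, r, c, -, -, -, h2⟩ := h
  refine ⟨.X ^ 2 - .X - .C c, by monicity!, ?_⟩
  simp only [Polynomial.eval₂_sub, Polynomial.eval₂_pow, Polynomial.eval₂_X, Polynomial.eval₂_C, h2]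
  simp

theorem IsQuadraticGenerator.isIntegral_left (h : IsQuadraticGenerator g ω) : IsIntegral ℤ g := by
  have hω := h.isIntegral_right
  obtain ⟨m, r, c, hm, hr, h1, h2⟩ := h
  refine IsIntegral.of_pow hm.pos ?_
  rw [h1]
  have h3 : IsIntegral ℤ (2 : L) := isIntegral_natCast 2
  exact ((h3.mul hω).sub isIntegral_one).mul (isIntegral_natCast r)

variable [CharZero L]

/-- Modulo `2` the odd integer `(g ^ 2) ^ m = (4 c + 1) r ^ 2` is `1`. -/
theorem IsQuadraticGenerator.exists_two_dvd_pow_sub_self (h : IsQuadraticGenerator g ω) :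
    ∃ Q, 2 ≤ Q ∧ ∀ y : locAt 2 (Algebra.adjoin ℤ {g ^ 2}), 2 ∣ y ^ Q - y := by
  obtain ⟨m, r, c, hm, hr, h1, h2⟩ := h
  refine ⟨2 ^ m.totient, Nat.le_self_pow (Nat.totient_pos.2 hm.pos).ne' 2,
    dvd_pow_sub_self_of_adjoin Nat.prime_two (by simp) ?_⟩
  intro x hx
  have h3 : x ^ m = ((4 * c + 1 : ℤ) : locAt 2 (Algebra.adjoin ℤ {g ^ 2})) * (r ^ 2 : ℕ) :=
    Subtype.ext (by
      change (x : L) ^ m = ((4 * c + 1 : ℤ) : L) * (r ^ 2 : ℕ)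
      rw [show (x : L) = g ^ 2 from hx, IsQuadraticGenerator.sq_pow_eq h1 h2])
  obtain ⟨i, rfl⟩ := hr
  simpa using dvd_pow_totient_sub_self (l := 2) (t := 2) hm.coprime_two_right
    ⟨2 * (c : locAt 2 (Algebra.adjoin ℤ {g ^ 2})) * (2 * i + 1) ^ 2 + 2 * i ^ 2 + 2 * i,
      by rw [h3]; push_cast; ring⟩ 1

/-- Modulo `2`, `g ^ m ≡ 1`, and `ω ^ 4 ≡ ω + c (c + 1) ≡ ω`. The exponent `2 ^ (φ(m) * 2)` is a
power of `4` and suits both generators. -/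
theorem IsQuadraticGenerator.exists_two_dvd_pow_sub_self_pair (h : IsQuadraticGenerator g ω) :
    ∃ Q, 2 ≤ Q ∧ ∀ y : locAt 2 (Algebra.adjoin ℤ {g, ω}), 2 ∣ y ^ Q - y := by
  obtain ⟨m, r, c, hm, hr, h1, h2⟩ := h
  have hpos := Nat.totient_pos.2 hm.pos
  refine ⟨2 ^ (m.totient * 2), Nat.le_self_pow (by omega) 2,
    dvd_pow_sub_self_of_adjoin Nat.prime_two (by simp) ?_⟩
  have hωmem : ω ∈ locAt 2 (Algebra.adjoin ℤ {g, ω}) :=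
    le_locAt (Algebra.subset_adjoin (by simp))
  intro x hx
  rcases hx with hx | hx
  · refine dvd_pow_totient_sub_self hm.coprime_two_right ?_ 2
    obtain ⟨i, rfl⟩ := hr
    refine ⟨⟨ω, hωmem⟩ * (2 * i + 1) - i - 1, Subtype.ext ?_⟩
    change (x : L) ^ m - 1 = 2 * (ω * (2 * i + 1) - i - 1)
    rw [hx, h1]
    push_cast
    ring
  · have h3 : x ^ 2 = x + c := Subtype.ext (by
      push_cast
      rw [show (x : L) = ω from hx, h2])
    rw [mul_comm, pow_mul]
    refine dvd_pow_pow_sub_self ?_ _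
    obtain ⟨k, hk⟩ := Int.even_mul_succ_self c
    refine ⟨k + c * x, ?_⟩
    have h4 : (c : locAt 2 (Algebra.adjoin ℤ {g, ω})) * (c + 1) = k + k := by exact_mod_cast hk
    linear_combination (x ^ 2 + x + c + 1) * h3 + h4

theorem IsQuadraticGenerator.frobeniusCondition (h : IsQuadraticGenerator g ω) :
    FrobeniusCondition 2 (Algebra.adjoin ℤ {g, ω}) := by
  obtain ⟨Q, hQ, hF⟩ := h.exists_two_dvd_pow_sub_self_pair
  exact ⟨2, 1, Q, by simp, by simp, hQ, hF⟩

/-- The elements `a + b ω` with `a`, `b` in a subring `B` such that `ω ^ 2 - ω` is in `B`. -/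
def quadraticSubring (B : Subring L) (c : ℤ) (hω : ω ^ 2 = ω + c) : Subring L where
  carrier := {x | ∃ a ∈ B, ∃ b ∈ B, x = a + b * ω}
  mul_mem' := by
    rintro _ _ ⟨a, ha, b, hb, rfl⟩ ⟨a', ha', b', hb', rfl⟩
    refine ⟨a * a' + b * b' * c, add_mem (mul_mem ha ha') (mul_mem (mul_mem hb hb')
      (intCast_mem B c)), a * b' + b * a' + b * b', add_mem (add_mem (mul_mem ha hb')
      (mul_mem hb ha')) (mul_mem hb hb'), ?_⟩
    linear_combination b * b' * hω
  one_mem' := ⟨1, one_mem B, 0, zero_mem B, by ring⟩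
  add_mem' := by
    rintro _ _ ⟨a, ha, b, hb, rfl⟩ ⟨a', ha', b', hb', rfl⟩
    exact ⟨a + a', add_mem ha ha', b + b', add_mem hb hb', by ring⟩
  zero_mem' := ⟨0, zero_mem B, 0, zero_mem B, by ring⟩
  neg_mem' := by
    rintro _ ⟨a, ha, b, hb, rfl⟩
    exact ⟨-a, neg_mem ha, -b, neg_mem hb, by ring⟩

/-- An odd integer is a unit in the localization, so `g ^ 2` is a unit of `B`. With `m = 2 i + 1`
this gives `g = g ^ m (g ^ 2) ^ (-i)`, a `B`-multiple of `2 ω - 1`; hence `B + B ω` contains `g`. -/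
theorem IsQuadraticGenerator.exists_eq_add_mul (h : IsQuadraticGenerator g ω) {x : L}
    (hx : x ∈ locAt 2 (Algebra.adjoin ℤ {g, ω})) :
    ∃ a ∈ locAt 2 (Algebra.adjoin ℤ {g ^ 2}), ∃ b ∈ locAt 2 (Algebra.adjoin ℤ {g ^ 2}),
      x = a + b * ω := by
  obtain ⟨m, r, c, hm, hr, h1, h2⟩ := h
  let B := locAt 2 (Algebra.adjoin ℤ {g ^ 2})
  have hle : Algebra.adjoin ℤ {g, ω} ≤ subalgebraOfSubring (quadraticSubring B c h2) := by
    refine Algebra.adjoin_le ?_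
    rintro y (hy | hy)
    · have h3 : IsUnit (locGen 2 (g ^ 2) ^ m) := by
        have h4 : locGen 2 (g ^ 2) ^ m =
            ((4 * c + 1 : ℤ) : locAt 2 (Algebra.adjoin ℤ {g ^ 2})) *
              ((r ^ 2 : ℕ) : locAt 2 (Algebra.adjoin ℤ {g ^ 2})) :=
          Subtype.ext (IsQuadraticGenerator.sq_pow_eq h1 h2)
        rw [h4]
        refine (isUnit_intCast_locAt Nat.prime_two _ ?_).mul
          (isUnit_natCast_locAt Nat.prime_two _ hr.pow.coprime_two_right)
        refine Odd.coprime_two_right ?_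
        rw [Int.natAbs_odd]
        exact ⟨2 * c, by ring⟩
      obtain ⟨i, rfl⟩ := hm
      obtain ⟨u, hu⟩ := (((isUnit_pow_iff (by omega)).1 h3).pow i).exists_right_inv
      have hu' : (g ^ 2) ^ i * (u : L) = 1 := congrArg Subtype.val hu
      refine ⟨-(r * u), neg_mem (mul_mem (natCast_mem B r) u.2), 2 * (r * u),
        mul_mem (ofNat_mem B 2) (mul_mem (natCast_mem B r) u.2), ?_⟩
      rw [show y = g from hy]
      have h5 : g = g ^ (2 * i + 1) * u := by
        rw [pow_succ, pow_mul]
        linear_combination -g * hu'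
      exact h5.trans (by rw [h1]; ring)
    · exact ⟨0, zero_mem B, 1, one_mem B, by rw [show y = ω from hy]; ring⟩
  obtain ⟨N, hN, hNx⟩ := hx
  obtain ⟨a, ha, b, hb, hab⟩ := hle hNx
  have hN0 : (N : L) ≠ 0 := ne_zero_of_coprime Nat.prime_two hN
  have hinv : (N : L)⁻¹ ∈ B := inv_natCast_mem_locAt Nat.prime_two _ hN
  refine ⟨(N : L)⁻¹ * a, mul_mem hinv ha, (N : L)⁻¹ * b, mul_mem hinv hb, ?_⟩
  rw [mul_assoc, ← mul_add, ← hab, inv_mul_cancel_left₀ hN0]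

theorem IsQuadraticGenerator.exists_natCast_mul_eq (h : IsQuadraticGenerator g ω)
    (hg : IntermediateField.adjoin ℚ {g} = ⊤) {x : L} (hx : IsIntegral ℤ x) :
    ∃ N : ℕ, Odd N ∧ ∃ a ∈ Algebra.adjoin ℤ {g ^ 2}, ∃ b ∈ Algebra.adjoin ℤ {g ^ 2},
      N * x = a + b * ω := by
  obtain ⟨Q, hQ, hF⟩ := h.exists_two_dvd_pow_sub_self_pair
  have hx' : x ∈ locAt 2 (Algebra.adjoin ℤ {g, ω}) := by
    refine mem_locAt_of_isIntegral Nat.prime_two (t := 2) (k := 1) (by simp) hQ hF hx ?_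
    refine exists_natCast_mul_mem_adjoin ?_ ?_
    · rintro y (hy | hy)
      · exact hy ▸ h.isIntegral_left
      · exact (show y = ω from hy) ▸ h.isIntegral_right
    · have h1 : IntermediateField.adjoin ℚ {g} ≤ IntermediateField.adjoin ℚ {g, ω} :=
        IntermediateField.adjoin.mono _ _ _ (by simp)
      exact h1 (hg ▸ IntermediateField.mem_top)
  obtain ⟨a, ⟨N, hN, hNa⟩, b, ⟨N', hN', hNb⟩, hab⟩ := h.exists_eq_add_mul hx'
  refine ⟨N * N', Nat.coprime_two_right.1 (hN.mul_left hN'), N' * (N * a),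
    mul_mem (natCast_mem _ N') hNa, N * (N' * b), mul_mem (natCast_mem _ N) hNb, ?_⟩
  rw [hab]
  push_cast
  ring

theorem IsQuadraticGenerator.exists_natCast_mul_mem (h : IsQuadraticGenerator g ω)
    {x : L} (hx : IsIntegral ℤ x) (hxK : x ∈ IntermediateField.adjoin ℚ {g ^ 2}) :
    x ∈ locAt 2 (Algebra.adjoin ℤ {g ^ 2}) := by
  obtain ⟨Q, hQ, hF⟩ := h.exists_two_dvd_pow_sub_self
  refine mem_locAt_of_isIntegral Nat.prime_two (t := 2) (k := 1) (by simp) hQ hF hx ?_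
  refine exists_natCast_mul_mem_adjoin ?_ hxK
  rintro _ rfl
  exact h.isIntegral_left.pow 2

/-- The half `y` of `x ^ Q - x` lies in the localization, so some odd multiple of it is integral; `2
y` is integral as well, hence so is `y`. -/
theorem IsQuadraticGenerator.exists_two_dvd_ringOfIntegers (h : IsQuadraticGenerator g ω) :
    ∃ Q, 2 ≤ Q ∧ ∀ x : 𝓞 (IntermediateField.adjoin ℚ {g ^ 2}), 2 ∣ x ^ Q - x := by
  obtain ⟨Q, hQ, hF⟩ := h.exists_two_dvd_pow_sub_self
  refine ⟨Q, hQ, fun x => ?_⟩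
  let K := IntermediateField.adjoin ℚ {g ^ 2}
  have hint : IsIntegral ℤ ((x : K) : L) := x.isIntegral_coe.map (algebraMap K L).toIntAlgHom
  obtain ⟨⟨y, hy⟩, hxy⟩ := hF ⟨_, h.exists_natCast_mul_mem hint x.1.2⟩
  have hxy' : ((x : K) : L) ^ Q - ((x : K) : L) = 2 * y := congrArg Subtype.val hxy
  obtain ⟨N, hN, hNy⟩ := hy
  have hNint : IsIntegral ℤ ((N : L) * y) := by
    refine (Algebra.adjoin_le (S := integralClosure ℤ L) ?_) hNy
    rintro _ rfl
    exact h.isIntegral_left.pow 2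
  have hyint : IsIntegral ℤ y := by
    obtain ⟨i, rfl⟩ := Nat.coprime_two_right.1 hN
    have h1 : y = ((2 * i + 1 : ℕ) : L) * y - i * (2 * y) := by push_cast; ring
    rw [h1, ← hxy']
    exact hNint.sub ((isIntegral_natCast i).mul ((hint.pow Q).sub hint))
  let yK : K := ((x : K) ^ Q - x) / 2
  have hyK : (yK : L) = y := by
    change (((x : K) : L) ^ Q - ((x : K) : L)) / 2 = y
    rw [hxy']
    field_simp
  have hyKint : IsIntegral ℤ yK :=
    (isIntegral_algHom_iff (algebraMap K L).toIntAlgHom (algebraMap K L).injective).1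
      (show IsIntegral ℤ (yK : L) from hyK ▸ hyint)
  refine ⟨⟨yK, hyKint⟩, ?_⟩
  apply NumberField.RingOfIntegers.ext
  change (x : K) ^ Q - x = 2 * (((x : K) ^ Q - x) / 2)
  field_simp

end Quadratic

/-! ### Completing an inclusion `A ⊆ B` with `N l B ⊆ A`. -/

section CompletionOfInclusion

variable {A B : Type*} [CommRing A] [CommRing B] {f : A →+* B} {l N : ℕ}

theorem span_natCast_le_comap (f : A →+* B) (l : ℕ) :
    Ideal.span {(l : A)} ≤ (Ideal.span {(l : B)}).comap f := by
  rw [Ideal.span_singleton_le_iff_mem, Ideal.mem_comap, map_natCast]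
  exact Ideal.mem_span_singleton_self _

theorem pow_natCast_dvd_of_coprime (hN : N.Coprime l) {n : ℕ} {a : A}
    (h : (l : A) ^ n ∣ N * a) : (l : A) ^ n ∣ a := by
  have h1 : IsCoprime ((l : A) ^ n) (N : A) := by
    have h2 := (Nat.isCoprime_iff_coprime.2 (hN.symm.pow_left n)).map (Int.castRingHom A)
    simpa using h2
  exact h1.dvd_of_dvd_mul_left h

/-- If `a = l ^ (n + 1) y` in `B`, then `N a = l ^ n (N l y)` with `N l y` in `A`; one power of `l`
is lost and `N` cancels by coprimality. -/
theorem completionMap_injective (hf : Function.Injective f) (hN : N.Coprime l)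
    (hlB : ∀ b : B, ∃ a : A, f a = N * l * b) :
    Function.Injective (completionMap f (span_natCast_le_comap f l)) := by
  rw [injective_iff_map_eq_zero]
  intro x hx
  refine AdicCompletion.ext_evalₐ fun n => ?_
  obtain ⟨a, ha⟩ := exists_evalₐ_eq_mk _ x (n + 1)
  have h1 := evalₐ_completionMap f (span_natCast_le_comap f l) (n + 1) x
  rw [hx, map_zero, ha _ le_rfl, Ideal.quotientMap_mk, eq_comm, Ideal.Quotient.eq_zero_iff_mem,
    Ideal.span_singleton_pow, Ideal.mem_span_singleton] at h1
  obtain ⟨y, hy⟩ := h1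
  obtain ⟨a', ha'⟩ := hlB y
  rw [ha n (Nat.le_succ n), map_zero, Ideal.Quotient.eq_zero_iff_mem, Ideal.span_singleton_pow,
    Ideal.mem_span_singleton]
  refine pow_natCast_dvd_of_coprime hN ⟨a', hf ?_⟩
  rw [map_mul, map_mul, map_pow, map_natCast, map_natCast, ha', hy]
  ring

/-- Multiplication by `N l` carries an approximating sequence from `B` into `A`; afterwards `N` is
inverted in the completion. -/
theorem exists_completionMap_eq_mul (hf : Function.Injective f) (hN : N.Coprime l)
    (hlB : ∀ b : B, ∃ a : A, f a = N * l * b) (x : AdicCompletion (Ideal.span {(l : B)}) B) :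
    ∃ s, completionMap f (span_natCast_le_comap f l) s = l * x := by
  choose g hg using hlB
  choose b hb using fun n => exists_evalₐ_eq_mk _ x (n + 1)
  have hdiv : ∀ n, g (b (n + 1)) - g (b n) ∈ Ideal.span {(l : A)} ^ n := by
    intro n
    have h1 := (hb n n (Nat.le_succ n)).symm.trans (hb (n + 1) n (by omega))
    rw [eq_comm, Ideal.Quotient.eq, Ideal.span_singleton_pow, Ideal.mem_span_singleton] at h1
    obtain ⟨y, hy⟩ := h1
    rw [Ideal.span_singleton_pow, Ideal.mem_span_singleton]
    refine ⟨g y, hf ?_⟩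
    rw [map_sub, hg, hg, map_mul, hg, map_pow, map_natCast, ← mul_sub, hy]
    ring
  obtain ⟨s, hs⟩ := exists_adicCompletion_of_forall _ (fun n => g (b n)) hdiv
  obtain ⟨u, hu⟩ := (isUnit_natCast_of_coprime (A := AdicCompletion (Ideal.span {(l : A)}) A) hN
    natCast_mem_jacobson_adicCompletion).exists_right_inv
  refine ⟨u * s, ?_⟩
  have h2 : completionMap f (span_natCast_le_comap f l) s = N * l * x := by
    refine AdicCompletion.ext_evalₐ fun n => ?_
    rw [evalₐ_completionMap, hs, Ideal.quotientMap_mk, hg, map_mul, map_mul, map_mul, map_mul,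
      hb n n (Nat.le_succ n)]
    simp
  have h3 := congrArg (completionMap f (span_natCast_le_comap f l)) hu
  rw [map_mul, map_natCast, map_one] at h3
  rw [map_mul, h2]
  linear_combination (l : AdicCompletion (Ideal.span {(l : B)}) B) * x * h3

theorem exists_eq_completionMap_add (hf : Function.Injective f) (hN : N.Coprime l)
    (hlB : ∀ b : B, ∃ a : A, f a = N * l * b) {ω : B}
    (hω : ∀ b : B, ∃ n : ℕ, n.Coprime l ∧ ∃ a a' : A, n * b = f a + f a' * ω)
    (x : AdicCompletion (Ideal.span {(l : B)}) B) :
    ∃ s t, x = completionMap f (span_natCast_le_comap f l) s +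
      completionMap f (span_natCast_le_comap f l) t * algebraMap B _ ω := by
  obtain ⟨b, y, rfl⟩ := exists_eq_add_natCast_mul x
  obtain ⟨s, hs⟩ := exists_completionMap_eq_mul hf hN hlB y
  obtain ⟨n, hn, a, a', haa⟩ := hω b
  obtain ⟨u, hu⟩ := (isUnit_natCast_of_coprime (A := AdicCompletion (Ideal.span {(l : A)}) A) hn
    natCast_mem_jacobson_adicCompletion).exists_right_inv
  refine ⟨u * algebraMap A _ a + s, u * algebraMap A _ a', ?_⟩
  have h3 := congrArg (completionMap f (span_natCast_le_comap f l)) hu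
  rw [map_mul, map_natCast, map_one] at h3
  have h4 := congrArg (algebraMap B (AdicCompletion (Ideal.span {(l : B)}) B)) haa
  rw [map_mul, map_natCast, map_add, map_mul] at h4
  rw [map_add, map_mul, map_mul, completionMap_algebraMap, completionMap_algebraMap, hs]
  linear_combination (-algebraMap B (AdicCompletion (Ideal.span {(l : B)}) B) b) * h3 +
    completionMap f (span_natCast_le_comap f l) u * h4

end CompletionOfInclusion

/-! ### Passing properties to the factors of a product. -/

section ProductDecomposition

variable {Λ Γ ι : Type*} [CommRing Λ] [CommRing Γ] {S O : ι → Type*} [∀ i, CommRing (S i)]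
  [∀ i, CommRing (O i)] {j : Λ →+* Γ} {α : ∀ i, Λ →+* S i} {β : ∀ i, Γ →+* O i}
  {γ : ∀ i, S i →+* O i}

theorem surjective_of_pi_bijective [DecidableEq ι]
    (hβ : Function.Bijective fun (x : Γ) (i : ι) => β i x) (i : ι) : Function.Surjective (β i) := by
  intro y
  obtain ⟨x, hx⟩ := hβ.2 (Pi.single i y)
  exact ⟨x, (congrFun hx i).trans (Pi.single_eq_same i y)⟩

/-- Extend an element of the kernel by zero to the other factors and use injectivity of `j`. -/
theorem injective_of_pi_bijective [DecidableEq ι]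
    (hα : Function.Bijective fun (x : Λ) (i : ι) => α i x)
    (hβ : Function.Bijective fun (x : Γ) (i : ι) => β i x)
    (hj : Function.Injective j) (hcomm : ∀ i x, γ i (α i x) = β i (j x)) (i : ι) :
    Function.Injective (γ i) := by
  rw [injective_iff_map_eq_zero]
  intro y hy
  obtain ⟨x, hx⟩ := hα.2 (Pi.single i y)
  have h1 : j x = 0 := by
    refine hβ.1 (funext fun i' => ?_)
    simp only [map_zero]
    rw [← hcomm, show α i' x = _ from congrFun hx i']
    by_cases h : i' = i
    · subst h
      rw [Pi.single_eq_same, hy]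
    · rw [Pi.single_eq_of_ne h, map_zero]
  have h2 : x = 0 := hj (h1.trans (map_zero j).symm)
  have h3 : α i x = y := (congrFun hx i).trans (Pi.single_eq_same i y)
  rw [← h3, h2, map_zero]

theorem IsRegularAbove.of_pi_bijective [DecidableEq ι] {l : ℕ} (h : IsRegularAbove Γ (l : Γ))
    (hβ : Function.Bijective fun (x : Γ) (i : ι) => β i x) (i : ι) :
    IsRegularAbove (O i) (l : O i) where
  mem_nonZeroDivisors := by
    rw [mem_nonZeroDivisors_iff_right]
    intro y hy
    obtain ⟨x, hx⟩ := hβ.2 (Pi.single i y)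
    have h3 : β i x = y := (congrFun hx i).trans (Pi.single_eq_same i y)
    have h1 : x * l = 0 := by
      refine hβ.1 (funext fun i' => ?_)
      simp only [map_mul, map_natCast, map_zero]
      rw [show β i' x = _ from congrFun hx i']
      by_cases h : i' = i
      · subst h
        rw [Pi.single_eq_same, hy]
      · rw [Pi.single_eq_of_ne h, zero_mul]
    rw [← h3, (mem_nonZeroDivisors_iff_right.1 h.mem_nonZeroDivisors) x h1, map_zero]
  mem_jacobson := by
    rw [Ideal.mem_jacobson_bot]
    intro y
    obtain ⟨x, rfl⟩ := surjective_of_pi_bijective hβ i y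
    simpa using (Ideal.mem_jacobson_bot.1 h.mem_jacobson x).map (β i)
  finite_quotient := by
    have := h.finite_quotient
    refine Finite.of_surjective (Ideal.quotientMap (Ideal.span {(l : O i)}) (β i)
      (span_natCast_le_comap (β i) l)) ?_
    exact Ideal.quotientMap_surjective (surjective_of_pi_bijective hβ i)
  exists_uniformizer := by
    obtain ⟨t, k, Q, h1, h2, hQ, hF⟩ := h.exists_uniformizer
    refine ⟨β i t, k, Q, ?_, ?_, hQ, ?_⟩
    · simpa using map_dvd (β i) h1
    · simpa using map_dvd (β i) h2
    · intro y
      obtain ⟨x, rfl⟩ := surjective_of_pi_bijective hβ i y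
      simpa using map_dvd (β i) (hF x)

end ProductDecomposition

/-! ### Splitting the `2`-adic completion over the primes of `𝓞 K`. -/

section PrimesAboveTwo

variable {L : Type*} [Field L] [CharZero L] {K : IntermediateField ℚ L} {Q : ℕ}

theorem two_mem_of_mem_primesOver (P : (Ideal.span {((2 : ℕ) : ℤ)}).primesOver (𝓞 K)) :
    (2 : 𝓞 K) ∈ P.1 := by
  have h := (Ideal.mem_of_liesOver P.1 (Ideal.span {((2 : ℕ) : ℤ)}) ((2 : ℕ) : ℤ)).1
    (Ideal.mem_span_singleton_self _)
  simpa using h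

/-- Modulo `P` the congruence `x ^ Q ≡ x` makes `x ^ (Q - 2)` an inverse of `x`. -/
theorem exists_mul_sub_one_mem (hQ : 2 ≤ Q) (hF : ∀ x : 𝓞 K, 2 ∣ x ^ Q - x)
    (P : (Ideal.span {((2 : ℕ) : ℤ)}).primesOver (𝓞 K)) {x : 𝓞 K} (hx : x ∉ P.1) :
    ∃ y, x * y - 1 ∈ P.1 := by
  obtain ⟨i, rfl⟩ : ∃ i, Q = i + 2 := ⟨Q - 2, by omega⟩
  refine ⟨x ^ i, ?_⟩
  have h1 : x * (x * x ^ i - 1) ∈ P.1 := by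
    have h2 := Ideal.mem_of_dvd P.1 (hF x) (two_mem_of_mem_primesOver P)
    convert h2 using 1
    ring
  exact (P.2.1.mem_or_mem h1).resolve_left hx

/-- Such a `z` lies in the radical of `(2)`, and `𝓞 K / 2` is reduced by the Frobenius congruence.
-/
theorem two_dvd_of_forall_mem_primesOver (hQ : 2 ≤ Q) (hF : ∀ x : 𝓞 K, 2 ∣ x ^ Q - x) {z : 𝓞 K}
    (hz : ∀ P : (Ideal.span {((2 : ℕ) : ℤ)}).primesOver (𝓞 K), z ∈ P.1) : 2 ∣ z := by
  have h1 : z ∈ (Ideal.span {(2 : 𝓞 K)}).radical := by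
    rw [Ideal.radical_eq_sInf, Ideal.mem_sInf]
    rintro J ⟨hJ, hJp⟩
    rw [Ideal.span_singleton_le_iff_mem] at hJ
    refine hz ⟨J, hJp, ⟨?_⟩⟩
    have hmax : (Ideal.span {((2 : ℕ) : ℤ)}).IsMaximal :=
      PrincipalIdealRing.isMaximal_of_irreducible (Nat.prime_iff_prime_int.1 Nat.prime_two).irreducible
    refine hmax.eq_of_le (Ideal.IsPrime.under ℤ J).ne_top ?_
    rw [Ideal.span_singleton_le_iff_mem, Ideal.under_def, Ideal.mem_comap]
    simpa using hJ
  obtain ⟨n, hn⟩ := h1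
  rw [Ideal.mem_span_singleton] at hn
  have h2 := hn.trans (pow_dvd_pow z (Nat.lt_pow_self (show 1 < Q by omega) (n := n)).le)
  exact (dvd_sub_right h2).1 (dvd_pow_pow_sub_self (hF z) n)

variable {S : Subalgebra ℤ L}

theorem natCast_two_mem_primeIdeal (P : (Ideal.span {((2 : ℕ) : ℤ)}).primesOver (𝓞 K)) :
    ((2 : ℕ) : S) ∈ primeIdeal P.1 S :=
  (Ideal.span_singleton_le_iff_mem _).1 (span_le_comap_primeIdeal P (le_refl S))

/-- For `x` in `P` but not in `P'` choose `y` inverse to `x` modulo `P'`. An odd multiple of `x y`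
lies in `S`; it is in the first ideal and is odd modulo the second, which contains `2`. -/
theorem pairwise_isCoprime_primeIdeal (hQ : 2 ≤ Q) (hF : ∀ x : 𝓞 K, 2 ∣ x ^ Q - x)
    (hS : ∀ x : 𝓞 K, ∃ N : ℕ, Odd N ∧ (N : L) * ((x : K) : L) ∈ S) :
    Pairwise (Function.onFun IsCoprime
      fun P : (Ideal.span {((2 : ℕ) : ℤ)}).primesOver (𝓞 K) => primeIdeal P.1 S) := by
  have key : ∀ P P' : (Ideal.span {((2 : ℕ) : ℤ)}).primesOver (𝓞 K), ∀ x ∈ P.1, x ∉ P'.1 →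
      IsCoprime (primeIdeal P.1 S) (primeIdeal P'.1 S) := by
    intro P P' x hx hx'
    obtain ⟨y, hy⟩ := exists_mul_sub_one_mem hQ hF P' hx'
    obtain ⟨N, hN, hNS⟩ := hS (x * y)
    have h1 : (⟨_, hNS⟩ : S) ∈ primeIdeal P.1 S :=
      Ideal.subset_span ⟨N * (x * y), Ideal.mul_mem_left _ _ (Ideal.mul_mem_right _ _ hx), by simp⟩
    have h2 : (⟨_, hNS⟩ : S) - N ∈ primeIdeal P'.1 S :=
      Ideal.subset_span ⟨N * (x * y - 1), Ideal.mul_mem_left _ _ hy, by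
        simp only [map_mul, map_sub, map_natCast, map_one]
        push_cast
        ring⟩
    obtain ⟨i, rfl⟩ := hN
    have h3 := sub_mem (Ideal.mul_mem_left _ (i : S) (natCast_two_mem_primeIdeal (S := S) P'))
      (Ideal.mul_mem_left _ (-1 : S) h2)
    rw [Ideal.isCoprime_iff_exists]
    refine ⟨_, h1, _, neg_mem h3, ?_⟩
    push_cast
    ring
  intro P P' hne
  by_cases h : P.1 ≤ P'.1
  · have h' : ¬ P'.1 ≤ P.1 := fun h' => hne (Subtype.ext (le_antisymm h h'))
    obtain ⟨x, hx, hx'⟩ := SetLike.not_le_iff_exists.1 h'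
    exact (key P' P x hx hx').symm
  · obtain ⟨x, hx, hx'⟩ := SetLike.not_le_iff_exists.1 h
    exact key P P' x hx hx'

/-- A product of generators comes from an element of `𝓞 K` lying in every prime above `2`, hence
divisible by `2`; the odd denominator of the quotient cancels. -/
theorem prod_primeIdeal_le [Fintype ((Ideal.span {((2 : ℕ) : ℤ)}).primesOver (𝓞 K))]
    (hQ : 2 ≤ Q) (hF : ∀ x : 𝓞 K, 2 ∣ x ^ Q - x)
    (hS : ∀ x : 𝓞 K, ∃ N : ℕ, Odd N ∧ (N : L) * ((x : K) : L) ∈ S) :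
    ∏ P : (Ideal.span {((2 : ℕ) : ℤ)}).primesOver (𝓞 K), primeIdeal P.1 S ≤
      Ideal.span {((2 : ℕ) : S)} := by
  simp only [primeIdeal]
  rw [Ideal.prod_span, Ideal.span_le]
  intro s hs
  rw [Set.mem_fintype_prod] at hs
  obtain ⟨g, hg, rfl⟩ := hs
  choose x hxP hx using hg
  obtain ⟨y, hy⟩ := two_dvd_of_forall_mem_primesOver hQ hF (z := ∏ P, x P) fun P =>
    Ideal.mem_of_dvd _ (Finset.dvd_prod_of_mem x (Finset.mem_univ P)) (hxP P)
  obtain ⟨N, hN, hNS⟩ := hS y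
  rw [SetLike.mem_coe, Ideal.mem_span_singleton]
  have h1 := pow_natCast_dvd_of_coprime (A := S) (l := 2) (n := 1) (a := ∏ P, g P)
    hN.coprime_two_right
  rw [pow_one] at h1
  refine h1 ⟨⟨_, hNS⟩, Subtype.ext ?_⟩
  have h2 : ((∏ P, g P : S) : L) = 2 * ((y : K) : L) := by
    rw [← S.val_apply, map_prod]
    simp only [S.val_apply, ← hx]
    have h3 := congrArg ((algebraMap K L).comp (algebraMap (𝓞 K) K)) hy
    rw [map_prod, map_mul, map_ofNat] at h3
    exact h3
  change (N : L) * ((∏ P, g P : S) : L) = ((2 : ℕ) : L) * (N * ((y : K) : L))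
  rw [h2]
  push_cast
  ring

theorem toPrimeAdic_pi_bijective [Finite ((Ideal.span {((2 : ℕ) : ℤ)}).primesOver (𝓞 K))]
    (hQ : 2 ≤ Q) (hF : ∀ x : 𝓞 K, 2 ∣ x ^ Q - x)
    (hS : ∀ x : 𝓞 K, ∃ N : ℕ, Odd N ∧ (N : L) * ((x : K) : L) ∈ S) :
    Function.Bijective fun (x : LAdic 2 S)
      (P : (Ideal.span {((2 : ℕ) : ℤ)}).primesOver (𝓞 K)) => toPrimeAdic P (le_refl S) x := by
  have := Fintype.ofFinite ((Ideal.span {((2 : ℕ) : ℤ)}).primesOver (𝓞 K))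
  exact completionMap_pi_bijective (fun _ => rfl) _ (pairwise_isCoprime_primeIdeal hQ hF hS)
    (prod_primeIdeal_le hQ hF hS)

end PrimesAboveTwo

/-- If every element of `B` has an odd multiple in `T`, then a single odd number works for all. -/
theorem exists_odd_forall_mul_mem {B : Type*} [CommRing B] [Module.Finite ℤ B] (T : AddSubgroup B)
    (h : ∀ b : B, ∃ N : ℕ, Odd N ∧ (N : B) * b ∈ T) :
    ∃ N : ℕ, Odd N ∧ ∀ b : B, (N : B) * b ∈ T := by
  obtain ⟨s, hs⟩ := Module.Finite.fg_top (R := ℤ) (M := B)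
  choose N hN hNT using h
  refine ⟨∏ x ∈ s, N x, Finset.prod_induction _ Odd (fun _ _ => Odd.mul) odd_one fun x _ => hN x,
    fun b => ?_⟩
  have hb : b ∈ Submodule.span ℤ (s : Set B) := hs ▸ Submodule.mem_top
  induction hb using Submodule.span_induction with
  | mem x hx =>
    obtain ⟨k, hk⟩ := Finset.dvd_prod_of_mem N hx
    rw [hk, mul_comm (N x), Nat.cast_mul, mul_assoc, ← nsmul_eq_mul]
    exact T.nsmul_mem (hNT x) k
  | zero => simp
  | add x y _ _ hx hy => rw [mul_add]; exact T.add_mem hx hy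
  | smul c x _ hx => rw [mul_smul_comm]; exact T.zsmul_mem hx c

/-- The ring homomorphism `γ` is surjective, or modulo the kernel of `q` its image is a field. -/
theorem surjective_or_forall_isUnit {D S O T : Type*} [CommRing D] [CommRing S] [CommRing O]
    [CommRing T] {κ : D →+* T} {γ : S →+* O} {q : O →+* T} {ω : O} {P : Ideal D}
    (hker : ∀ y, q y = 0 → ∃ s, γ s = y) (hgen : ∀ y, ∃ s t, y = γ s + γ t * ω)
    (hP : ∀ c ∈ P, κ c = 0) (hinv : ∀ c ∉ P, ∃ c', κ c * κ c' = 1)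
    (hD : ∀ c, ∃ s, q (γ s) = κ c) (hdec : ∀ s, ∃ a b, q (γ s) = κ a + κ b * q ω) :
    Function.Surjective γ ∨ ∀ x, q (γ x) = 0 ∨ ∃ y, q (γ (x * y)) = 1 := by
  -- If the image of `γ` modulo `ker q` leaves `κ D`, dividing by the coefficient `b` recovers `ω`,
  -- and `ker q` is in the range. Otherwise that image consists of values of `κ`, which are zero on
  -- `P` and invertible off `P`.
  by_cases h : ∃ s a b, q (γ s) = κ a + κ b * q ω ∧ b ∉ P
  · left
    obtain ⟨s, a, b, hs, hb⟩ := h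
    obtain ⟨b', hb'⟩ := hinv b hb
    obtain ⟨u, hu⟩ := hD b'
    obtain ⟨v, hv⟩ := hD a
    obtain ⟨w, hw⟩ := hker (ω - γ (u * (s - v))) (by
      simp only [map_sub, map_mul, hs, hu, hv]
      linear_combination -q ω * hb')
    intro y
    obtain ⟨c, d, rfl⟩ := hgen y
    refine ⟨c + d * (w + u * (s - v)), ?_⟩
    rw [map_add, map_mul, map_add, hw]
    ring
  · right
    push Not at h
    intro x
    obtain ⟨a, b, hx⟩ := hdec x
    rw [hP b (h x a b hx), zero_mul, add_zero] at hx
    by_cases ha : a ∈ P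
    · exact Or.inl (hx.trans (hP a ha))
    · obtain ⟨a', ha'⟩ := hinv a ha
      obtain ⟨u, hu⟩ := hD a'
      exact Or.inr ⟨u, by rw [map_mul, map_mul, hx, hu, ha']⟩

theorem natCast_eq_one_of_odd {T : Type*} [CommRing T] (h : ((2 : ℕ) : T) = 0) {N : ℕ} (hN : Odd N) :
    (N : T) = 1 := by
  obtain ⟨i, rfl⟩ := hN
  rw [Nat.cast_add, Nat.cast_mul, h, zero_mul, zero_add, Nat.cast_one]

/-! ### The rings `R_P` and the maps between them. -/

section LocalStructure

variable {L : Type*} [Field L] [CharZero L] {K : IntermediateField ℚ L}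

/-- The inclusion of the integers of a subfield into the integral closure of `ℤ`. -/
def integersToIntegralClosure (K : IntermediateField ℚ L) : 𝓞 K →+* integralClosure ℤ L :=
  ((algebraMap K L).comp (algebraMap (𝓞 K) K)).codRestrict (integralClosure ℤ L) fun x =>
    x.isIntegral_coe.map (algebraMap K L).toIntAlgHom

theorem primeIdeal_le_comap (P : Ideal (𝓞 K)) {R S : Subalgebra ℤ L} (h : R ≤ S) :
    primeIdeal P R ≤ (primeIdeal P S).comap (Subalgebra.inclusion h : R →+* S) := by
  rw [primeIdeal, Ideal.span_le]
  rintro r ⟨x, hx, hxr⟩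
  exact Ideal.subset_span ⟨x, hx, hxr⟩

/-- The homomorphism `R_P → S_P` for `R ⊆ S`. -/
def primeAdicMap (P : Ideal (𝓞 K)) {R S : Subalgebra ℤ L} (h : R ≤ S) :
    PrimeAdic P R →+* PrimeAdic P S :=
  completionMap (Subalgebra.inclusion h : R →+* S) (primeIdeal_le_comap P h)

theorem primeAdicMap_toPrimeAdic {l : ℕ} (P : (Ideal.span {(l : ℤ)}).primesOver (𝓞 K))
    {R S : Subalgebra ℤ L} (h : R ≤ S) (x : LAdic l R) :
    primeAdicMap P.1 h (toPrimeAdic P (le_refl R) x) = toPrimeAdic P h x :=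
  completionMap_completionMap _ _ _ _ _ _ (fun _ => rfl) x

theorem toPrimeAdic_completionMap {l : ℕ} (P : (Ideal.span {(l : ℤ)}).primesOver (𝓞 K))
    {R S : Subalgebra ℤ L} (h : R ≤ S) (x : LAdic l R) :
    toPrimeAdic P (le_refl S) (completionMap (Subalgebra.inclusion h : R →+* S)
      (span_natCast_le_comap _ l) x) = toPrimeAdic P h x :=
  completionMap_completionMap _ _ _ _ _ _ (fun _ => rfl) x

/-- The homomorphism `R → R_P`. -/
def ofPrimeAdic (P : Ideal (𝓞 K)) (R : Subalgebra ℤ L) : R →+* PrimeAdic P R :=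
  algebraMap R (AdicCompletion (primeIdeal P R) R)

theorem toPrimeAdic_algebraMap {l : ℕ} (P : (Ideal.span {(l : ℤ)}).primesOver (𝓞 K))
    {R S : Subalgebra ℤ L} (h : R ≤ S) (r : R) :
    toPrimeAdic P h (algebraMap R (LAdic l R) r) = ofPrimeAdic P.1 S (Subalgebra.inclusion h r) :=
  completionMap_algebraMap _ _ r

theorem ofPrimeAdic_mem_jacobson (P : Ideal (𝓞 K)) (R : Subalgebra ℤ L) [IsNoetherianRing R]
    {r : R} (hr : r ∈ primeIdeal P R) :
    ofPrimeAdic P R r ∈ Ideal.jacobson (⊥ : Ideal (PrimeAdic P R)) := by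
  have := AdicCompletion.isAdicComplete_self (primeIdeal P R) (IsNoetherian.noetherian _)
  exact IsAdicComplete.le_jacobson_bot
    ((primeIdeal P R).map (algebraMap R (AdicCompletion (primeIdeal P R) R)))
    (Ideal.mem_map_of_mem _ hr)

/-- The factor `1 - x ^ (Q - 1)` of `x - x ^ Q` is a unit. Applied to elements of `P`, this shows
that `P` vanishes in `O_P / 2`. -/
theorem two_dvd_of_mem_jacobson {A : Type*} [CommRing A] {x : A}
    (hx : x ∈ Ideal.jacobson (⊥ : Ideal A)) {Q : ℕ} (hQ : 2 ≤ Q) (h : 2 ∣ x ^ Q - x) : 2 ∣ x := by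
  obtain ⟨i, rfl⟩ : ∃ i, Q = i + 2 := ⟨Q - 2, by omega⟩
  have h1 := Ideal.mem_jacobson_bot.1 hx (-x ^ i)
  rw [show x ^ (i + 2) - x = -((x * -x ^ i + 1) * x) by ring, dvd_neg] at h
  exact h1.dvd_mul_left.1 h

end LocalStructure

/-! ### The exceptional case, prime by prime. -/

section ExceptionalCase

variable {L : Type*} [Field L] [CharZero L] {K : IntermediateField ℚ L} {Q : ℕ} {ω : L}
  {R : Subalgebra ℤ L}

theorem exists_odd_mul_eq_of_integral (h1 : ∀ x : L, IsIntegral ℤ x → ∃ N : ℕ, Odd N ∧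
      ∃ a b : 𝓞 K, N * x = ((a : K) : L) + ((b : K) : L) * ω)
    (h2 : ∀ x : 𝓞 K, ∃ N : ℕ, Odd N ∧ (N : L) * ((x : K) : L) ∈ R) {x : L}
    (hx : IsIntegral ℤ x) :
    ∃ N : ℕ, Odd N ∧ ∃ a ∈ R, ∃ b ∈ R, N * x = a + b * ω := by
  obtain ⟨N, hN, a, b, h⟩ := h1 x hx
  obtain ⟨Na, hNa, ha⟩ := h2 a
  obtain ⟨Nb, hNb, hb⟩ := h2 b
  refine ⟨Na * Nb * N, (hNa.mul hNb).mul hN, _, mul_mem (natCast_mem R Nb) ha, _,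
    mul_mem (natCast_mem R Na) hb, ?_⟩
  push_cast
  linear_combination (Na : L) * Nb * h

theorem exists_odd_forall_mul_two_mul_mem [Module.Finite ℤ (integralClosure ℤ L)]
    (h1 : ∀ x : L, IsIntegral ℤ x → ∃ N : ℕ, Odd N ∧
      ∃ a b : 𝓞 K, N * x = ((a : K) : L) + ((b : K) : L) * ω)
    (h2 : ∀ x : 𝓞 K, ∃ N : ℕ, Odd N ∧ (N : L) * ((x : K) : L) ∈ R)
    (h3 : ∃ N : ℕ, Odd N ∧ (N : L) * (2 * ω) ∈ R) :
    ∃ N : ℕ, Odd N ∧ ∀ x : integralClosure ℤ L, (N : L) * 2 * x ∈ R := by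
  let T : AddSubgroup (integralClosure ℤ L) :=
    R.toSubring.toAddSubgroup.comap (((AddMonoidHom.mulLeft (2 : L))).comp
      ((integralClosure ℤ L).val : integralClosure ℤ L →+ L))
  have hT : ∀ x : integralClosure ℤ L, x ∈ T ↔ 2 * (x : L) ∈ R := fun _ => Iff.rfl
  obtain ⟨N, hN, h⟩ := exists_odd_forall_mul_mem T fun x => by
    obtain ⟨N, hN, a, ha, b, hb, h⟩ := exists_odd_mul_eq_of_integral h1 h2 x.2
    obtain ⟨N', hN', h'⟩ := h3
    refine ⟨N * N', hN.mul hN', ?_⟩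
    rw [hT]
    have h4 : 2 * (((N * N' : ℕ) : integralClosure ℤ L) * x : integralClosure ℤ L).1 =
        ((2 * N' : ℕ) : L) * a + b * (N' * (2 * ω)) := by
      push_cast
      linear_combination (2 * (N' : L)) * h
    rw [h4]
    exact add_mem (mul_mem (natCast_mem R _) ha) (mul_mem hb h')
  refine ⟨N, hN, fun x => ?_⟩
  have h5 := (hT _).1 (h x)
  push_cast at h5
  rwa [mul_comm (N : L), mul_assoc]

/-- Elements of `P` vanish in `O_P / 2`, so `𝓞 K` acts there through the residue field of `P`. Odd
integers become `1`, which removes the multipliers `N` in `h1` and `h2`: modulo `2` the image of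
`R_P` contains the residue field, and its elements are combinations of `1` and `ω` over it. -/
theorem primeAdicMap_surjective_or [IsNoetherianRing (integralClosure ℤ L)]
    (hQ : 2 ≤ Q) (hF : ∀ x : 𝓞 K, 2 ∣ x ^ Q - x) (hω : IsIntegral ℤ ω)
    (h1 : ∀ x : L, IsIntegral ℤ x → ∃ N : ℕ, Odd N ∧
      ∃ a b : 𝓞 K, N * x = ((a : K) : L) + ((b : K) : L) * ω)
    (h2 : ∀ x : 𝓞 K, ∃ N : ℕ, Odd N ∧ (N : L) * ((x : K) : L) ∈ R)
    (hRO : R ≤ integralClosure ℤ L) (P : (Ideal.span {((2 : ℕ) : ℤ)}).primesOver (𝓞 K))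
    (hα : Function.Surjective (toPrimeAdic P (le_refl R)))
    (hmul : ∀ y, ∃ s, primeAdicMap P.1 hRO s = (2 : ℕ) * y)
    (hgen : ∀ y, ∃ s t, y = primeAdicMap P.1 hRO s +
      primeAdicMap P.1 hRO t * ofPrimeAdic P.1 (integralClosure ℤ L) ⟨ω, hω⟩) :
    Function.Surjective (primeAdicMap P.1 hRO) ∨ ∀ x : PrimeAdic P.1 R,
      (∃ y, primeAdicMap P.1 hRO x = (2 : ℕ) * y) ∨
        ∃ y z, primeAdicMap P.1 hRO (x * y) = 1 + (2 : ℕ) * z := by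
  let O := integralClosure ℤ L
  let f : R →+* O := (Subalgebra.inclusion hRO : R →+* O)
  let ωO : O := ⟨ω, hω⟩
  let q := Ideal.Quotient.mk (Ideal.span {((2 : ℕ) : PrimeAdic P.1 O)})
  have hq : ∀ y, q y = 0 ↔ ∃ z, y = (2 : ℕ) * z := fun y => by
    rw [Ideal.Quotient.eq_zero_iff_mem, Ideal.mem_span_singleton]
    rfl
  have hT : ((2 : ℕ) : PrimeAdic P.1 O ⧸ Ideal.span {((2 : ℕ) : PrimeAdic P.1 O)}) = 0 := by
    rw [← map_natCast q, hq]
    exact ⟨1, (mul_one _).symm⟩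
  let θ : O →+* PrimeAdic P.1 O ⧸ Ideal.span {((2 : ℕ) : PrimeAdic P.1 O)} :=
    q.comp (ofPrimeAdic P.1 O)
  have hP : ∀ c ∈ P.1, θ (integersToIntegralClosure K c) = 0 := by
    intro c hc
    have h4 : ofPrimeAdic P.1 O (integersToIntegralClosure K c) ∈
        Ideal.jacobson (⊥ : Ideal (PrimeAdic P.1 O)) :=
      ofPrimeAdic_mem_jacobson _ _ (Ideal.subset_span ⟨c, hc, rfl⟩)
    have h5 := map_dvd ((ofPrimeAdic P.1 O).comp (integersToIntegralClosure K)) (hF c)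
    rw [map_ofNat, map_sub, map_pow] at h5
    obtain ⟨z, hz⟩ := two_dvd_of_mem_jacobson h4 hQ h5
    exact (hq _).2 ⟨z, by rw [hz]; push_cast; rfl⟩
  have hθR : ∀ r : R, q (primeAdicMap P.1 hRO (toPrimeAdic P (le_refl R)
      (algebraMap R (LAdic 2 R) r))) = θ (f r) := by
    intro r
    rw [primeAdicMap_toPrimeAdic, toPrimeAdic_algebraMap]
    rfl
  have hN1 : ∀ {N : ℕ} (x : O), Odd N → θ (N * x) = θ x := fun x hN => by
    rw [map_mul, map_natCast, natCast_eq_one_of_odd hT hN, one_mul]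
  have h5 := surjective_or_forall_isUnit (κ := θ.comp (integersToIntegralClosure K))
    (γ := primeAdicMap P.1 hRO) (q := q) (ω := ofPrimeAdic P.1 O ωO) (P := P.1) ?_ hgen hP
    ?_ ?_ ?_
  · refine h5.imp_right fun h x => (h x).imp (fun h => (hq _).1 h) ?_
    rintro ⟨y, hy⟩
    obtain ⟨z, hz⟩ := (hq (primeAdicMap P.1 hRO (x * y) - 1)).1 (by rw [map_sub, hy, map_one, sub_self])
    exact ⟨y, z, by rw [← hz]; ring⟩
  · intro y hy
    obtain ⟨z, rfl⟩ := (hq y).1 hy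
    exact hmul z
  · intro c hc
    obtain ⟨c', hc'⟩ := exists_mul_sub_one_mem hQ hF P hc
    refine ⟨c', ?_⟩
    have h6 := hP _ hc'
    rw [map_sub, map_one, map_mul, map_sub, map_one, map_mul, sub_eq_zero] at h6
    exact h6
  · intro c
    obtain ⟨N, hN, hNR⟩ := h2 c
    refine ⟨_, (hθR ⟨_, hNR⟩).trans ?_⟩
    exact hN1 (integersToIntegralClosure K c) hN
  · intro s
    obtain ⟨x, rfl⟩ := hα s
    obtain ⟨r, y, hxy⟩ := exists_eq_add_natCast_mul x
    obtain ⟨N, hN, a, b, hab⟩ := h1 r (hRO r.2)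
    refine ⟨a, b, ?_⟩
    have h6 : (N : O) * f r = integersToIntegralClosure K a + integersToIntegralClosure K b * ωO :=
      Subtype.ext hab
    have h7 : θ (f r) = θ (integersToIntegralClosure K a) +
        θ (integersToIntegralClosure K b) * θ ωO := by
      rw [← hN1 (f r) hN, h6, map_add, map_mul]
    let σ := q.comp ((primeAdicMap P.1 hRO).comp (toPrimeAdic P (le_refl R)))
    have h8 : σ x = σ (algebraMap R (LAdic 2 R) r) := by
      rw [hxy, map_add, map_mul, map_natCast, hT, zero_mul, add_zero]
    exact h8.trans ((hθR r).trans h7)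

theorem exists_equiv_pi_primeAdic [hR : IsOrder R] [Module.Finite ℤ (integralClosure ℤ L)]
    [Finite ((Ideal.span {((2 : ℕ) : ℤ)}).primesOver (𝓞 K))]
    (hQ : 2 ≤ Q) (hF : ∀ x : 𝓞 K, 2 ∣ x ^ Q - x) (hω : IsIntegral ℤ ω)
    (h1 : ∀ x : L, IsIntegral ℤ x → ∃ N : ℕ, Odd N ∧
      ∃ a b : 𝓞 K, N * x = ((a : K) : L) + ((b : K) : L) * ω)
    (h2 : ∀ x : 𝓞 K, ∃ N : ℕ, Odd N ∧ (N : L) * ((x : K) : L) ∈ R)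
    (h3 : ∃ N : ℕ, Odd N ∧ (N : L) * (2 * ω) ∈ R)
    (hΓ : IsRegularAbove (LAdic 2 (integralClosure ℤ L)) ((2 : ℕ) : LAdic 2 (integralClosure ℤ L)))
    {e : ℕ} (M : Submodule (LAdic 2 R) (Fin e → LAdic 2 R)) (N : ℕ)
    (hM : ∀ x, ((2 : ℕ) : LAdic 2 R) ^ N • x ∈ M) :
    ∃ a b : (Ideal.span {((2 : ℕ) : ℤ)}).primesOver (𝓞 K) → ℕ, (∀ P, a P + b P = e) ∧
      Nonempty (M ≃ₗ[LAdic 2 R]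
        ((P : (Ideal.span {((2 : ℕ) : ℤ)}).primesOver (𝓞 K)) →
          (Fin (a P) → PrimeAdic P.1 R) ×
            (Fin (b P) → PrimeAdic P.1 (integralClosure ℤ L)))) := by
  classical
  let ι := (Ideal.span {((2 : ℕ) : ℤ)}).primesOver (𝓞 K)
  let O := integralClosure ℤ L
  have hRO : R ≤ O := IsOrder.le_integralClosure R
  have hnoeth : IsNoetherianRing O := IsNoetherianRing.of_finite ℤ O
  let f : R →+* O := (Subalgebra.inclusion hRO : R →+* O)
  have hf : Function.Injective f := Subalgebra.inclusion_injective hRO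
  let ωO : O := ⟨ω, hω⟩
  have h2O : ∀ x : 𝓞 K, ∃ N : ℕ, Odd N ∧ (N : L) * ((x : K) : L) ∈ O := fun x =>
    (h2 x).imp fun N h => ⟨h.1, hRO h.2⟩
  obtain ⟨N₀, hN₀, hN₀R⟩ := exists_odd_forall_mul_two_mul_mem h1 h2 h3
  have hlO : ∀ b : O, ∃ a : R, f a = N₀ * (2 : ℕ) * b := fun b =>
    ⟨⟨_, hN₀R b⟩, Subtype.ext rfl⟩
  have hωgen : ∀ b : O, ∃ n : ℕ, n.Coprime 2 ∧ ∃ a a' : R, n * b = f a + f a' * ωO := by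
    intro b
    obtain ⟨n, hn, a, ha, a', ha', h⟩ := exists_odd_mul_eq_of_integral h1 h2 b.2
    exact ⟨n, hn.coprime_two_right, ⟨a, ha⟩, ⟨a', ha'⟩, Subtype.ext h⟩
  let j : LAdic 2 R →+* LAdic 2 O := completionMap f (span_natCast_le_comap f 2)
  have hj : Function.Injective j := completionMap_injective hf hN₀.coprime_two_right hlO
  have hα := toPrimeAdic_pi_bijective hQ hF h2
  have hβ := toPrimeAdic_pi_bijective hQ hF h2O
  have hcomm : ∀ (P : ι) (x : LAdic 2 R), primeAdicMap P.1 hRO (toPrimeAdic P (le_refl R) x) =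
      toPrimeAdic P (le_refl O) (j x) := fun P x =>
    (primeAdicMap_toPrimeAdic P hRO x).trans (toPrimeAdic_completionMap P hRO x).symm
  have hβs : ∀ P : ι, Function.Surjective (toPrimeAdic P (le_refl O)) := fun P =>
    surjective_of_pi_bijective (β := fun P : ι => toPrimeAdic P (le_refl O)) hβ P
  have hαs : ∀ P : ι, Function.Surjective (toPrimeAdic P (le_refl R)) := fun P =>
    surjective_of_pi_bijective (β := fun P : ι => toPrimeAdic P (le_refl R)) hα P
  have hγ : ∀ P : ι, Function.Injective (primeAdicMap P.1 hRO) := fun P =>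
    injective_of_pi_bijective (α := fun P : ι => toPrimeAdic P (le_refl R))
      (β := fun P : ι => toPrimeAdic P (le_refl O)) (γ := fun P : ι => primeAdicMap P.1 hRO)
      hα hβ hj hcomm P
  have hreg : ∀ P : ι, IsRegularAbove (PrimeAdic P.1 O) ((2 : ℕ) : PrimeAdic P.1 O) := fun P =>
    IsRegularAbove.of_pi_bijective (β := fun P : ι => toPrimeAdic P (le_refl O)) hΓ hβ P
  have hmul : ∀ (P : ι) (y : PrimeAdic P.1 O), ∃ s, primeAdicMap P.1 hRO s = (2 : ℕ) * y := by
    intro P y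
    obtain ⟨x, rfl⟩ := hβs P y
    obtain ⟨s, hs⟩ := exists_completionMap_eq_mul hf hN₀.coprime_two_right hlO x
    exact ⟨toPrimeAdic P (le_refl R) s, by rw [hcomm, show j s = _ from hs, map_mul, map_natCast]⟩
  have hgen : ∀ (P : ι) (y : PrimeAdic P.1 O), ∃ s t, y = primeAdicMap P.1 hRO s +
      primeAdicMap P.1 hRO t * ofPrimeAdic P.1 O ωO := by
    intro P y
    obtain ⟨x, rfl⟩ := hβs P y
    obtain ⟨s, t, rfl⟩ := exists_eq_completionMap_add hf hN₀.coprime_two_right hlO hωgen x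
    refine ⟨toPrimeAdic P (le_refl R) s, toPrimeAdic P (le_refl R) t, ?_⟩
    rw [hcomm, hcomm, map_add, map_mul, toPrimeAdic_algebraMap]
    rfl
  have hS := fun P : ι => primeAdicMap_surjective_or hQ hF hω h1 h2 hRO P (hαs P) (hmul P) (hgen P)
  let _ : ∀ P : ι, Algebra (LAdic 2 R) (PrimeAdic P.1 R) := fun P =>
    (toPrimeAdic P (le_refl R)).toAlgebra
  let _ : ∀ P : ι, Algebra (LAdic 2 R) (PrimeAdic P.1 O) := fun P =>
    (toPrimeAdic P hRO).toAlgebra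
  let _ : ∀ P : ι, Algebra (PrimeAdic P.1 R) (PrimeAdic P.1 O) := fun P =>
    (primeAdicMap P.1 hRO).toAlgebra
  have : ∀ P : ι, IsScalarTower (LAdic 2 R) (PrimeAdic P.1 R) (PrimeAdic P.1 O) := fun P =>
    IsScalarTower.of_algebraMap_eq fun x => (primeAdicMap_toPrimeAdic P hRO x).symm
  exact exists_equiv_pi_of_bijective (S := fun P : ι => PrimeAdic P.1 R)
    (O := fun P : ι => PrimeAdic P.1 O) (l := 2) hα M N hM fun P M' hM' =>
      exists_equiv_prod_of_pow_smul_mem (hγ P) (hreg P)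
        (fun x => hmul P x) (ofPrimeAdic P.1 O ωO) (hgen P) (hS P) M' N hM'

end ExceptionalCase

theorem isOrder_integralClosure {L : Type*} [Field L] [CharZero L] [FiniteDimensional ℚ L] :
    IsOrder (integralClosure ℤ L) where
  finite := IsIntegralClosure.finite ℤ ℚ L (integralClosure ℤ L)
  span_eq_top := by
    refine eq_top_iff.2 fun x _ => ?_
    obtain ⟨d, hd, hx⟩ := exists_integral_multiples ℤ ℚ (L := L) {x}
    have h1 : x = (d : ℚ)⁻¹ • (d • x) := by
      rw [← Int.cast_smul_eq_zsmul ℚ d x, inv_smul_smul₀ (by exact_mod_cast hd)]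
    rw [h1]
    exact Submodule.smul_mem _ _ (Submodule.subset_span (hx x (Finset.mem_singleton_self x)))

/-! ### Lattices when `L` has a quadratic generator. -/

section QuadraticGenerator

variable {L : Type*} [Field L] [CharZero L] [FiniteDimensional ℚ L] {g ω : L}

theorem IsQuadraticGenerator.isRegularAbove (h : IsQuadraticGenerator g ω)
    (hg : IntermediateField.adjoin ℚ {g} = ⊤) :
    IsRegularAbove (LAdic 2 (integralClosure ℤ L)) ((2 : ℕ) : LAdic 2 (integralClosure ℤ L)) := by
  have hint : ∀ x ∈ ({g, ω} : Set L), IsIntegral ℤ x := by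
    rintro y (hy | hy)
    · exact hy ▸ h.isIntegral_left
    · exact (show y = ω from hy) ▸ h.isIntegral_right
  have := isOrder_integralClosure (L := L)
  refine isRegularAbove_LAdic (RingHom.id L) Nat.prime_two _ h.frobeniusCondition ?_ ?_
  · intro c hc
    exact ⟨⟨c, (Algebra.adjoin_le (S := integralClosure ℤ L) hint) hc⟩, rfl⟩
  · intro x
    refine exists_natCast_mul_mem_adjoin hint ?_
    have h1 : IntermediateField.adjoin ℚ {g} ≤ IntermediateField.adjoin ℚ {g, ω} :=
      IntermediateField.adjoin.mono _ _ _ (by simp)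
    exact h1 (hg ▸ IntermediateField.mem_top)

theorem IsQuadraticGenerator.exists_equiv_pi_primeAdic (h : IsQuadraticGenerator g ω)
    (hg : IntermediateField.adjoin ℚ {g} = ⊤) (R : Subalgebra ℤ L) [IsOrder R]
    (hR : Algebra.adjoin ℤ {g} ≤ R) {e : ℕ} (M : Submodule (LAdic 2 R) (Fin e → LAdic 2 R)) (N : ℕ)
    (hM : ∀ x, ((2 : ℕ) : LAdic 2 R) ^ N • x ∈ M) :
    ∃ a b : (Ideal.span {((2 : ℕ) : ℤ)}).primesOver
        (𝓞 (IntermediateField.adjoin ℚ {g ^ 2})) → ℕ, (∀ P, a P + b P = e) ∧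
      Nonempty (M ≃ₗ[LAdic 2 R]
        ((P : (Ideal.span {((2 : ℕ) : ℤ)}).primesOver
            (𝓞 (IntermediateField.adjoin ℚ {g ^ 2}))) →
          (Fin (a P) → PrimeAdic P.1 R) ×
            (Fin (b P) → PrimeAdic P.1 (integralClosure ℤ L)))) := by
  let K := IntermediateField.adjoin ℚ {g ^ 2}
  have hgR : g ∈ R := hR (Algebra.self_mem_adjoin_singleton ℤ g)
  have hAR : Algebra.adjoin ℤ {g ^ 2} ≤ R := Algebra.adjoin_le (by simpa using pow_mem hgR 2)
  have hA : ∀ a ∈ Algebra.adjoin ℤ {g ^ 2}, ∃ x : 𝓞 K, ((x : K) : L) = a := by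
    intro a ha
    have haK : a ∈ K :=
      (Algebra.adjoin_le (S := K.toSubalgebra.restrictScalars ℤ) (by
        simpa using IntermediateField.mem_adjoin_simple_self ℚ (g ^ 2))) ha
    have hai : IsIntegral ℤ a :=
      (Algebra.adjoin_le (S := integralClosure ℤ L) (by
        rintro _ rfl
        exact h.isIntegral_left.pow 2)) ha
    exact ⟨⟨⟨a, haK⟩, (isIntegral_algHom_iff (algebraMap K L).toIntAlgHom
      (algebraMap K L).injective).1 hai⟩, rfl⟩
  have : NumberField K := { to_charZero := inferInstance, to_finiteDimensional := inferInstance }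
  have : Finite ((Ideal.span {((2 : ℕ) : ℤ)}).primesOver (𝓞 K)) :=
    (Algebra.QuasiFinite.finite_primesOver _).to_subtype
  have := (isOrder_integralClosure (L := L)).finite
  obtain ⟨Q, hQ, hF⟩ := h.exists_two_dvd_ringOfIntegers
  refine Supersingular.exists_equiv_pi_primeAdic (K := K) hQ hF h.isIntegral_right ?_ ?_ ?_
    (h.isRegularAbove hg) M N hM
  · intro x hx
    obtain ⟨n, hn, a, ha, b, hb, hab⟩ := h.exists_natCast_mul_eq hg hx
    obtain ⟨a', rfl⟩ := hA a ha
    obtain ⟨b', rfl⟩ := hA b hb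
    exact ⟨n, hn, a', b', hab⟩
  · intro x
    obtain ⟨n, hn, hnx⟩ := h.exists_natCast_mul_mem
      (x.isIntegral_coe.map (algebraMap K L).toIntAlgHom) x.1.2
    exact ⟨n, Nat.coprime_two_right.1 hn, hAR hnx⟩
  · obtain ⟨m, r, c, hm, hr, h1, h2⟩ := h
    refine ⟨r, hr, ?_⟩
    rw [show (r : L) * (2 * ω) = g ^ m + r by rw [h1]; ring]
    exact add_mem (pow_mem hgR m) (natCast_mem R r)

end QuadraticGenerator

/-! ### The exceptional set yields a quadratic generator. -/

/-- In the exceptional case the generator of `ℚ(π)` is a quadratic generator. -/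
theorem exists_isQuadraticGenerator {p n q : ℕ} (hp : p.Prime) (hq : q = p ^ n) {π : ℂ}
    (hπ : π ∈ exceptionalSet p q) :
    ∃ ω, IsQuadraticGenerator (IntermediateField.AdjoinSimple.gen ℚ π) ω := by
  obtain ⟨m, ζ, hm, hζ, hx, hp2, hsq, -, hp1, hp3⟩ := hπ
  have hpodd : Odd p := hp.odd_of_ne_two hp2
  have hnodd : Odd n := by
    rw [← Nat.not_even_iff_odd]
    rintro ⟨j, rfl⟩
    exact hsq ⟨p ^ j, by rw [hq, pow_add]⟩
  obtain ⟨j, rfl⟩ := hnodd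
  obtain ⟨a, m', hm', rfl⟩ := Nat.exists_eq_two_pow_mul_odd hm.ne'
  have hs : ((Real.sqrt (p : ℝ) : ℝ) : ℂ) ^ 2 = p := by
    rw [← Complex.ofReal_pow, Real.sq_sqrt (Nat.cast_nonneg p), Complex.ofReal_natCast]
  set s := ((Real.sqrt (p : ℝ) : ℝ) : ℂ)
  rw [hq, sqrt_natCast_pow_odd] at hx
  have hπm := pow_eq_mul_of_odd hm' hs hx
  set r := p ^ (j * m' + m' / 2)
  have hrodd : Odd r := hpodd.pow
  have hξ : IsPrimitiveRoot (ζ ^ m') (2 ^ a) := hζ.pow hm (mul_comm _ _)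
  have hdvd : ∀ i, 2 ^ i ∣ 2 ^ a * m' ↔ i ≤ a := by
    intro i
    rw [Nat.Coprime.dvd_mul_right ((hm'.coprime_two_left).pow_left i),
      Nat.pow_dvd_pow_iff_le_right (by norm_num)]
  have h4 : 4 ∣ 2 ^ a * m' ↔ 2 ≤ a := hdvd 2
  have h8 : 8 ∣ 2 ^ a * m' ↔ 3 ≤ a := hdvd 3
  rw [h4] at hp1
  rw [h4, h8] at hp3
  -- The conditions on `m` make the square `p` if `p ≡ 1` and `-p` if `p ≡ 3` modulo `4`, so it is
  -- always `1` modulo `4`.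
  have hδ : ∃ c : ℤ, (ζ ^ m' * s) ^ 2 = 4 * c + 1 := by
    have hp4 : p % 4 = 1 ∨ p % 4 = 3 := by
      obtain ⟨i, rfl⟩ := hpodd
      omega
    rw [mul_pow, hs]
    rcases hp4 with h | h
    · have ha := hp1 h
      have h5 : 2 = 2 ^ a * 2 ^ (1 - a) := by
        rw [← pow_add, Nat.add_sub_cancel' (by omega), pow_one]
      have h6 : (ζ ^ m') ^ 2 = 1 := by rw [h5, pow_mul, hξ.pow_eq_one, one_pow]
      refine ⟨(p / 4 : ℕ), ?_⟩
      have h7 : (p : ℂ) = 4 * (p / 4 : ℕ) + 1 := by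
        exact_mod_cast (show p = 4 * (p / 4) + 1 by omega)
      rw [h6, one_mul]
      exact_mod_cast h7
    · obtain rfl : a = 2 := by have := hp3 h; omega
      have h6 : (ζ ^ m') ^ 2 = -1 :=
        IsPrimitiveRoot.eq_neg_one_of_two_right (hξ.pow (by norm_num) (by norm_num))
      refine ⟨-((p / 4 : ℕ) : ℤ) - 1, ?_⟩
      have h7 : (p : ℂ) = 4 * (p / 4 : ℕ) + 3 := by
        exact_mod_cast (show p = 4 * (p / 4) + 3 by omega)
      rw [h6, Int.cast_sub, Int.cast_neg, Int.cast_natCast, Int.cast_one]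
      linear_combination -h7
  obtain ⟨c, hc⟩ := hδ
  set g := IntermediateField.AdjoinSimple.gen ℚ π
  have hr0 : (r : ℚ⟮π⟯) ≠ 0 := by exact_mod_cast hrodd.pos.ne'
  have hgδ : algebraMap ℚ⟮π⟯ ℂ (g ^ m' / r) = ζ ^ m' * s := by
    have hr0' : (r : ℂ) ≠ 0 := by exact_mod_cast hrodd.pos.ne'
    rw [map_div₀, map_pow, map_natCast, IntermediateField.AdjoinSimple.algebraMap_gen, hπm,
      mul_div_cancel_right₀ _ hr0']
  -- With `δ = g ^ m' / r`, the element `ω = (1 + δ) / 2` has `ω ^ 2 - ω = (δ ^ 2 - 1) / 4 = c`.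
  refine ⟨(1 + g ^ m' / r) / 2, m', r, c, hm', hrodd, ?_, ?_⟩
  · field_simp
    ring
  · have h9 : (g ^ m' / r) ^ 2 = 4 * (c : ℚ⟮π⟯) + 1 :=
      (algebraMap ℚ⟮π⟯ ℂ).injective (by 
        rw [map_pow, hgδ, hc, map_add, map_mul, map_ofNat, map_intCast, map_one])
    linear_combination h9 / 4

theorem adjoin_gen_eq_top (F : Type*) {E : Type*} [Field F] [Field E] [Algebra F E] (α : E) :
    IntermediateField.adjoin F {IntermediateField.AdjoinSimple.gen F α} = ⊤ := by
  refine eq_top_iff.2 fun x _ => ?_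
  have h1 : (x : E) ∈ (IntermediateField.adjoin F
      {IntermediateField.AdjoinSimple.gen F α}).map (F⟮α⟯).val := by
    rw [IntermediateField.adjoin_map, Set.image_singleton]
    exact x.2
  obtain ⟨y, hy, hyx⟩ := h1
  rwa [← Subtype.ext hyx]

theorem IsSupersingularNumber.isIntegral {q : ℕ} {π : ℂ} (hπ : IsSupersingularNumber q π) :
    IsIntegral ℤ π := by
  obtain ⟨m, ζ, hm, hζ, rfl⟩ := hπ
  refine (hζ.isIntegral hm).mul (IsIntegral.of_pow (n := 2) (by norm_num) ?_)
  rw [← Complex.ofReal_pow, Real.sq_sqrt (Nat.cast_nonneg q), Complex.ofReal_natCast]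
  exact isIntegral_natCast q

end Supersingular

end

open Supersingular in
theorem mainTheorem7 (p n q l : ℕ) (hp : p.Prime) (hn : 0 < n) (hq : q = p ^ n)
    (hl : l.Prime) (hlp : l ≠ p) (π : ℂ) (hπ : IsSupersingularNumber q π)
    (R : Subalgebra ℤ ℚ⟮π⟯) [IsOrder R]
    (hR : Algebra.adjoin ℤ {IntermediateField.AdjoinSimple.gen ℚ π} ≤ R)
    (M : Type*) [AddCommGroup M] [Module (LAdic l R) M] [Module.Finite (LAdic l R) M]
    [Module.IsTorsionFree (LAdic l R) M] (e : ℕ) (hM : HasRank l R M e) :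
    (¬ (l = 2 ∧ π ∈ exceptionalSet p q) →
      Nonempty (M ≃ₗ[LAdic l R] (Fin e → LAdic l R))) ∧
    (l = 2 ∧ π ∈ exceptionalSet p q →
      ∃ a b : (Ideal.span {(l : ℤ)}).primesOver (𝓞 (squareSubfield π)) → ℕ,
        (∀ P, a P + b P = e) ∧
        Nonempty (M ≃ₗ[LAdic l R]
          ((P : (Ideal.span {(l : ℤ)}).primesOver (𝓞 (squareSubfield π))) →
            (Fin (a P) → PrimeAdic P.1 R) ×
              (Fin (b P) → PrimeAdic P.1 (integralClosure ℤ ℚ⟮π⟯))))) := by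
  obtain ⟨M', N, hM', ⟨E⟩⟩ := exists_submodule_equiv_of_hasRank hl.ne_zero R M hM
  constructor
  · intro hne
    have hreg : IsRegularAbove (LAdic l R) (l : LAdic l R) := by
      refine isRegularAbove_LAdic (algebraMap ℚ⟮π⟯ ℂ) hl R
        (frobeniusCondition_of_not_exceptional hp hn hq hl hlp hπ hne) ?_ ?_
      · intro c hc
        have h1 : Algebra.adjoin ℤ {π} ≤ R.map (algebraMap ℚ⟮π⟯ ℂ).toIntAlgHom := by
          refine Algebra.adjoin_le ?_
          rintro _ rfl
          exact ⟨_, hR (Algebra.self_mem_adjoin_singleton ℤ _),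
            IntermediateField.AdjoinSimple.algebraMap_gen ℚ _⟩
        obtain ⟨r, hr, rfl⟩ := h1 hc
        exact ⟨⟨r, hr⟩, rfl⟩
      · intro x
        exact exists_natCast_mul_mem_adjoin (by rintro _ rfl; exact hπ.isIntegral) x.2
    obtain ⟨b⟩ := hreg.nonempty_basis_submodule M' N hM'
    exact ⟨E.trans b.equivFun⟩
  · rintro ⟨rfl, hex⟩
    have : FiniteDimensional ℚ ℚ⟮π⟯ :=
      IntermediateField.adjoin.finiteDimensional hπ.isIntegral.tower_top
    obtain ⟨ω, hω⟩ := exists_isQuadraticGenerator hp hq hex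
    obtain ⟨a, b, hab, ⟨E'⟩⟩ := hω.exists_equiv_pi_primeAdic
      (adjoin_gen_eq_top ℚ π) R hR M' N hM'
    exact ⟨a, b, hab, ⟨E.trans E'⟩⟩
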